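/- Let $K$ be a field of characteristic $0$ and $r,s\in K^\times$ with $r^2\neq s^2$. Let $\mathfrak g$ be of type $A_n$ ($\mathfrak{sl}_{n+1}$), $B_n$ ($\mathfrak{so}_{2n+1}$), $C_n$ ($\mathfrak{sp}_{2n}$) or $D_n$ ($\mathfrak{so}_{2n}$), with Cartan matrix $a_{ij}=2(\alpha_i,\alpha_j)/(\alpha_i,\alpha_i)$, where $\alpha_i=\epsilon_i-\epsilon_{i+1}$, except that $\alpha_n=\epsilon_n$, $2\epsilon_n$, $\epsilon_{n-1}+\epsilon_n$ in types $B$, $C$, $D$. Put $r_i=r^{d_i}$, $s_i=s^{d_i}$, where $d_i=(\alpha_i,\alpha_i)$ in type $B$ and $d_i=(\alpha_i,\alpha_i)/2$ otherwise. Define $\langle\omega_i',\omega_j\rangle$ as follows. For $j<n$, and for all $j$ in type $A_n$: $r^{(\epsilon_j,\alpha_i)}s^{(\epsilon_{j+1},\alpha_i)}$, with both exponents doubled in type $B$. For $j=n$ in types $B$, $C$: $r^{2(\epsilon_n,\alpha_i)}$ if $i<n$, and $r_ns_n^{-1}$ if $i=n$. For $j=n$ in type $D$: $r^{(\epsilon_{n-1},\alpha_i)}s^{-(\epsilon_n,\alpha_i)}$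 if $i\neq n-1$, and $(rs)^{-1}$ if $i=n-1$. $U_{r,s}(\mathfrak g)$ is the unital $K$-algebra generated by $e_i,f_i,\omega_i^{\pm1},\omega_i'^{\pm1}$ $(1\le i\le n)$ with the relations: the $\omega_i^{\pm1},\omega_j'^{\pm1}$ commute, $\omega_i\omega_i^{-1}=\omega_i'\omega_i'^{-1}=1$; $$\omega_je_i\omega_j^{-1}=\langle\omega_i',\omega_j\rangle e_i,\quad \omega_jf_i\omega_j^{-1}=\langle\omega_i',\omega_j\rangle^{-1}f_i,\quad \omega_j'e_i\omega_j'^{-1}=\langle\omega_j',\omega_i\rangle^{-1}e_i,\quad \omega_j'f_i\omega_j'^{-1}=\langle\omega_j',\omega_i\rangle f_i,$$ $$[e_i,f_j]=\delta_{ij}\frac{\omega_i-\omega_i'}{r_i-s_i};$$ for $i<j$ with $a_{ij}=0$: $e_ie_j=c\,e_je_i$ and $f_jf_i=c\,f_if_j$, where $c=rs$ for $(i,j)=(n-1,n)$ in type $D$ and $c=1$ otherwise; for $i<j$ with $a_{ij}\ne0$: $S_{a_{ij}}(r_i,s_i;e_i,e_j)=0$ and $S_{a_{ji}}(r_j^{-1},s_j^{-1};e_j,e_i)=0$,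 together with the same relations for the $f$'s with every word reversed, where $S_{-1}(u,v;x,y)=x^2y-(u+v)xyx+uv\,yx^2$ and, with $\Delta=u^2+uv+v^2$, $S_{-2}(u,v;x,y)=x^3y-\Delta\,x^2yx+uv\Delta\,xyx^2-(uv)^3yx^3$. The associated quantum group is $U_{s^{-1},r^{-1}}(\mathfrak g)$. It is identified with $U_{r,s}(\mathfrak g)$ (with opposite comultiplication) by the $K$-algebra isomorphism $\Theta:U_{r,s}(\mathfrak g)\to U_{s^{-1},r^{-1}}(\mathfrak g)$, $\Theta(e_i)=f_i$, $\Theta(f_i)=(r_is_i)^{-1}e_i$, $\Theta(\omega_i)=\omega_i'$, $\Theta(\omega_i')=\omega_i$ (its existence is part of the assertion). Let $\sigma$ be an automorphism of the field $K$ with $\sigma(r)=s^{-1}$, $\sigma(s)=r^{-1}$. The Lusztig symmetry $\mathcal T_i$ (relative to $\sigma$) is a ring homomorphism $\mathcal T_i:U_{r,s}(\mathfrak g)\to U_{s^{-1},r^{-1}}(\mathfrak g)$ (in particular a $\mathbb Q$-linear map respecting all defining relations) with $\mathcal T_i(c)=\sigma(c)$ for $c\in K$ and, where the right-hand sides are elements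 of $U_{r,s}(\mathfrak g)$ carried to $U_{s^{-1},r^{-1}}(\mathfrak g)$ by $\Theta$, $$\mathcal T_i(\omega_j)=\omega_j\omega_i^{-a_{ij}},\quad \mathcal T_i(\omega_j')=\omega_j'\omega_i'^{-a_{ij}},\quad \mathcal T_i(e_i)=-\omega_i'^{-1}f_i,\quad \mathcal T_i(f_i)=-(r_is_i)e_i\omega_i^{-1},$$ and, for $j\ne i$, with $a=a_{ij}$: in types $A,C,D$ $$\mathcal T_i(e_j)=\sum_{\nu=0}^{-a}(-1)^\nu(rs)^{\frac\nu2(-a-\nu)}\langle\omega_j',\omega_i\rangle^{-\nu}\langle\omega_i',\omega_i\rangle^{\frac\nu2(1+a)}e_i^{(\nu)}e_je_i^{(-a-\nu)},$$ $$\mathcal T_i(f_j)=(r_js_j)^{\delta^+_{ij}}\sum_{\nu=0}^{-a}(-1)^\nu(rs)^{\frac\nu2(-a-\nu)}\langle\omega_i',\omega_j\rangle^{\nu}\langle\omega_i',\omega_i\rangle^{-\frac\nu2(1+a)}f_i^{(-a-\nu)}f_jf_i^{(\nu)};$$ in type $B$ $$\mathcal T_i(e_j)=\sum_{\nu=0}^{-a}(-1)^\nu(rs)^{\frac\nu2(-a-\nu)}\langle\omega_j',\omega_i\rangle^{\nu}\langle\omega_i',\omega_i\rangle^{-\frac\nu2(1+a)}e_i^{(-a-\nu)}e_je_i^{(\nu)},$$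 $$\mathcal T_i(f_j)=(r_js_j)^{\delta^-_{ij}}\sum_{\nu=0}^{-a}(-1)^\nu(rs)^{\frac\nu2(-a-\nu)}\langle\omega_i',\omega_j\rangle^{-\nu}\langle\omega_i',\omega_i\rangle^{\frac\nu2(1+a)}f_i^{(\nu)}f_jf_i^{(-a-\nu)}.$$ Here $x^{(k)}=x^k/\langle k\rangle_i!$ with $\langle k\rangle_i=\frac{s_i^{-k}-r_i^{-k}}{s_i^{-1}-r_i^{-1}}$; the half-integral powers only occur for $a=-2$, where $\langle\omega_i',\omega_i\rangle=rs^{-1}$, and are read with $(rs)^{1/2}(rs^{-1})^{1/2}=r$, $(rs)^{1/2}(rs^{-1})^{-1/2}=s$; $\delta^+_{ij}=2$ if $i<j$ and $a_{ij}\ne0$, $\delta^-_{ij}=2$ if $i>j$ and $a_{ij}\neq0$, and both are $1$ otherwise. We say that $U_{r,s}(\mathfrak g)$ has the Lusztig symmetries if, for some $\sigma$ as above, $\mathcal T_i$ exists for every $i$. **Theorem 3.1.** (i) Let $\mathfrak g=\mathfrak{sl}_3$, $\mathfrak{so}_5$ or $\mathfrak{sp}_4$. For every automorphism $\sigma$ of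 $K$ as above, the Lusztig symmetries $\mathcal T_1,\mathcal T_2:U_{r,s}(\mathfrak g)\to U_{s^{-1},r^{-1}}(\mathfrak g)$ exist, and they are bijective. (ii) Let $\mathfrak g$ be of type $A_n,B_n,C_n$ or $D_n$ with $n>2$. If $U_{r,s}(\mathfrak g)$ has the Lusztig symmetries, then $rs=1$ (where for types $B_n$ and $D_3$ it is assumed that $rs\ne-1$). Conversely, if $rs=1$, i.e. $r=q$, $s=q^{-1}$ (where for types $B_n$ and $C_n$ it is assumed that $r^3\ne s^3$ and $r^4\neq s^4$), then $U_{q,q^{-1}}(\mathfrak g)$ has the Lusztig symmetries. In this case, with $\sigma=\mathrm{id}$, every $\Theta^{-1}\mathcal T_i$ is a $K$-algebra automorphism of $U_{q,q^{-1}}(\mathfrak g)$ and induces a usual Lusztig symmetry of the Drinfel'd–Jimbo quantum group $U_q(\mathfrak g)$ (generators $E_i,F_i,K_i^{\pm1}$, $q_i=q^{d_i}$): for the surjective algebra homomorphism $\pi:U_{q,q^{-1}}(\mathfrak g)\to U_q(\mathfrak g)$, $e_i\mapsto E_i$, $f_i\mapsto F_i$, $\omega_i\mapsto K_i$, $\omega_i'\mapsto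 K_i^{-1}$, one has $\pi\,\Theta^{-1}\mathcal T_i=L_iD_i\,\pi$, where $L_i$ is the Lusztig automorphism $K_j\mapsto K_jK_i^{-a_{ij}}$, $E_i\mapsto-K_iF_i$, $F_i\mapsto-E_iK_i^{-1}$, $E_j\mapsto\sum_\nu(-1)^\nu q_i^\nu E_i^{(\nu)}E_jE_i^{(-a_{ij}-\nu)}$, $F_j\mapsto\sum_\nu(-1)^\nu q_i^{-\nu}F_i^{(-a_{ij}-\nu)}F_jF_i^{(\nu)}$ $(j\ne i$, with $x^{(k)}=x^k/[k]_i!$, $[k]_i=\frac{q_i^k-q_i^{-k}}{q_i-q_i^{-1}})$, and $D_i$ is the identity in types $A,C,D$ and, in type $B$, the rescaling automorphism $E_j\mapsto(-q_i)^{a_{ij}}E_j$, $F_j\mapsto(-q_i)^{-a_{ij}}F_j$ $(j\ne i)$, $E_i\mapsto E_i$, $F_i\mapsto F_i$, $K_j\mapsto K_j$. -/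

import Mathlib

/-! Two-parameter quantum groups of classical type, their Lusztig symmetries,
and the one-parameter Drinfel'd–Jimbo quantum groups. -/

namespace TwoParam

/-- The classical types: `A` is `sl_{n+1}`, `B` is `so_{2n+1}`, `C` is `sp_{2n}`, `D` is `so_{2n}`,
where `n` is the rank. -/
inductive ClassicalType
  | A
  | B
  | C
  | D

/-- Whether the type is `B`. -/
def ClassicalType.isB : ClassicalType → Bool
  | .B => true
  | _ => false

/-! ### Root data.  Nodes are numbered from `0`: node `i : Fin n` is the simple root usually called
`α_{i+1}`, and the coordinate `k` belongs to the orthonormal basis vector `ε_{k+1}`. -/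

/-- `rootCoord X n i k = (ε_{k+1}, α_{i+1})`.  The simple roots are `α_i = ε_i - ε_{i+1}`, except that
the last one is `ε_n` (type `B`), `2 ε_n` (type `C`), `ε_{n-1} + ε_n` (type `D`). -/
def rootCoord (X : ClassicalType) (n i k : ℕ) : ℤ :=
  let diff : ℤ := (if k = i then 1 else 0) - (if k = i + 1 then 1 else 0)
  match X with
  | .A => diff
  | .B => if i + 1 < n then diff else if k = i then 1 else 0
  | .C => if i + 1 < n then diff else if k = i then 2 else 0
  | .D => if i + 1 < n then diff else if k = i ∨ k + 1 = i then 1 else 0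

/-- The Cartan matrix `a_{ij} = 2 (α_i, α_j) / (α_i, α_i)`.  (Mathlib's matrices are
`2 (α_i, α_j) / (α_j, α_j)`, hence the transpose.) -/
def cartan (X : ClassicalType) (n : ℕ) : Matrix (Fin n) (Fin n) ℤ :=
  match X with
  | .A => (CartanMatrix.A n).transpose
  | .B => (CartanMatrix.B n).transpose
  | .C => (CartanMatrix.C n).transpose
  | .D => (CartanMatrix.D n).transpose

/-- The integers `d_i` with `r_i = r ^ d_i`, `s_i = s ^ d_i`: these are `(α_i, α_i)` in type `B` and
`(α_i, α_i) / 2` in the other types. -/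
def sym (X : ClassicalType) (n i : ℕ) : ℕ :=
  match X with
  | .A => 1
  | .B => if i + 1 < n then 2 else 1
  | .C => if i + 1 < n then 1 else 2
  | .D => 1

/-- Exponents of `r` and of `s` in the structure constant `⟨ω_i', ω_j⟩`. -/
def pairExp (X : ClassicalType) (n i j : ℕ) : ℤ × ℤ :=
  let c := rootCoord X n i
  match X with
  | .A => (c j, c (j + 1))
  | .B => if j + 1 < n then (2 * c j, 2 * c (j + 1))
          else if i + 1 < n then (2 * c j, 0)
          else (c j, -c j)
  | .C => if j + 1 < n then (c j, c (j + 1))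
          else if i + 1 < n then (2 * c j, 0)
          else (c j, -c j)
  | .D => if j + 1 < n then (c j, c (j + 1))
          else if i + 2 = n then (c j, -c (j - 1))
          else (c (j - 1), -c j)

variable {K : Type*} [Field K]

/-- The structure constant `⟨ω_i', ω_j⟩`. -/
def pair (X : ClassicalType) (n : ℕ) (r s : K) (i j : Fin n) : K :=
  r ^ (pairExp X n i j).1 * s ^ (pairExp X n i j).2

/-- The coefficient in the relation between `e_i, e_j` (`i < j`) when `a_{ij} = 0`:
it is `1`, except for the two end nodes `(n-1, n)` of type `D`, where it is `rs`. -/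
def commCoeff (X : ClassicalType) (n : ℕ) (r s : K) (i j : Fin n) : K :=
  match X with
  | .D => if (i : ℕ) + 2 = n ∧ (j : ℕ) + 1 = n then r * s else 1
  | _ => 1

/-- The Serre polynomial for `a_{ij} = a ∈ {-1, -2}` with parameters `u`, `v`. -/
def serre {R : Type*} [Ring R] [Algebra K R] (a : ℤ) (u v : K) (x y : R) : R :=
  if a = -2 then
    x ^ 3 * y - (u ^ 2 + u * v + v ^ 2) • (x ^ 2 * y * x)
      + (u * v * (u ^ 2 + u * v + v ^ 2)) • (x * y * x ^ 2) - ((u * v) ^ 3) • (y * x ^ 3)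
  else
    x ^ 2 * y - (u + v) • (x * y * x) + (u * v) • (y * x ^ 2)

/-- The Serre polynomial with all words reversed. -/
def serreRev {R : Type*} [Ring R] [Algebra K R] (a : ℤ) (u v : K) (x y : R) : R :=
  if a = -2 then
    y * x ^ 3 - (u ^ 2 + u * v + v ^ 2) • (x * y * x ^ 2)
      + (u * v * (u ^ 2 + u * v + v ^ 2)) • (x ^ 2 * y * x) - ((u * v) ^ 3) • (x ^ 3 * y)
  else
    y * x ^ 2 - (u + v) • (x * y * x) + (u * v) • (x ^ 2 * y)

/-! ### The two-parameter quantum group -/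

/-- Generators `e_i, f_i, ω_i, ω_i⁻¹, ω_i', ω_i'⁻¹`. -/
inductive Gen (n : ℕ)
  | e (i : Fin n)
  | f (i : Fin n)
  | w (i : Fin n)
  | wInv (i : Fin n)
  | w' (i : Fin n)
  | w'Inv (i : Fin n)

/-- The generators `ω_i^{±1}`, `ω_i'^{±1}`. -/
def Gen.IsTorus {n : ℕ} : Gen n → Prop
  | .e _ => False
  | .f _ => False
  | _ => True

open FreeAlgebra in
/-- The defining relations of `U_{r,s}(𝔤)`. -/
inductive Rel (X : ClassicalType) (n : ℕ) (r s : K) :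
    FreeAlgebra K (Gen n) → FreeAlgebra K (Gen n) → Prop
  | torus_comm (a b : Gen n) (ha : a.IsTorus) (hb : b.IsTorus) :
      Rel X n r s (ι K a * ι K b) (ι K b * ι K a)
  | w_inv (i : Fin n) : Rel X n r s (ι K (.w i) * ι K (.wInv i)) 1
  | w'_inv (i : Fin n) : Rel X n r s (ι K (.w' i) * ι K (.w'Inv i)) 1
  | w_e (i j : Fin n) : Rel X n r s (ι K (.w j) * ι K (.e i) * ι K (.wInv j))
      (pair X n r s i j • ι K (.e i))
  | w_f (i j : Fin n) : Rel X n r s (ι K (.w j) * ι K (.f i) * ι K (.wInv j))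
      ((pair X n r s i j)⁻¹ • ι K (.f i))
  | w'_e (i j : Fin n) : Rel X n r s (ι K (.w' j) * ι K (.e i) * ι K (.w'Inv j))
      ((pair X n r s j i)⁻¹ • ι K (.e i))
  | w'_f (i j : Fin n) : Rel X n r s (ι K (.w' j) * ι K (.f i) * ι K (.w'Inv j))
      (pair X n r s j i • ι K (.f i))
  | e_f (i j : Fin n) : Rel X n r s (ι K (.e i) * ι K (.f j) - ι K (.f j) * ι K (.e i))
      (if i = j then (r ^ sym X n i - s ^ sym X n i)⁻¹ • (ι K (.w i) - ι K (.w' i)) else 0)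
  | e_comm (i j : Fin n) (hij : i < j) (ha : cartan X n i j = 0) :
      Rel X n r s (ι K (.e i) * ι K (.e j)) (commCoeff X n r s i j • (ι K (.e j) * ι K (.e i)))
  | f_comm (i j : Fin n) (hij : i < j) (ha : cartan X n i j = 0) :
      Rel X n r s (ι K (.f j) * ι K (.f i)) (commCoeff X n r s i j • (ι K (.f i) * ι K (.f j)))
  | e_serre (i j : Fin n) (hij : i < j) (ha : cartan X n i j ≠ 0) :
      Rel X n r s
        (serre (cartan X n i j) (r ^ sym X n i) (s ^ sym X n i) (ι K (.e i)) (ι K (.e j))) 0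
  | e_serre' (i j : Fin n) (hij : i < j) (ha : cartan X n i j ≠ 0) :
      Rel X n r s
        (serre (cartan X n j i) (r ^ sym X n j)⁻¹ (s ^ sym X n j)⁻¹ (ι K (.e j)) (ι K (.e i))) 0
  | f_serre (i j : Fin n) (hij : i < j) (ha : cartan X n i j ≠ 0) :
      Rel X n r s
        (serreRev (cartan X n i j) (r ^ sym X n i) (s ^ sym X n i) (ι K (.f i)) (ι K (.f j))) 0
  | f_serre' (i j : Fin n) (hij : i < j) (ha : cartan X n i j ≠ 0) :
      Rel X n r s
        (serreRev (cartan X n j i) (r ^ sym X n j)⁻¹ (s ^ sym X n j)⁻¹ (ι K (.f j)) (ι K (.f i))) 0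

/-- The two-parameter quantum group `U_{r,s}(𝔤)`, as a `K`-algebra. -/
def U (X : ClassicalType) (n : ℕ) (r s : K) : Type _ := RingQuot (Rel X n r s)

noncomputable instance (X : ClassicalType) (n : ℕ) (r s : K) : Ring (U X n r s) :=
  inferInstanceAs (Ring (RingQuot (Rel X n r s)))

noncomputable instance (X : ClassicalType) (n : ℕ) (r s : K) : Algebra K (U X n r s) :=
  inferInstanceAs (Algebra K (RingQuot (Rel X n r s)))

section Generators

variable {X : ClassicalType} {n : ℕ} {r s : K}

/-- The image of a generator in `U_{r,s}(𝔤)`. -/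
noncomputable def gen (g : Gen n) : U X n r s :=
  RingQuot.mkAlgHom K (Rel X n r s) (FreeAlgebra.ι K g)

noncomputable def e (i : Fin n) : U X n r s := gen (.e i)
noncomputable def f (i : Fin n) : U X n r s := gen (.f i)
noncomputable def w (i : Fin n) : U X n r s := gen (.w i)
noncomputable def wInv (i : Fin n) : U X n r s := gen (.wInv i)
noncomputable def w' (i : Fin n) : U X n r s := gen (.w' i)
noncomputable def w'Inv (i : Fin n) : U X n r s := gen (.w'Inv i)

/-- The integral power `ω_i ^ m`. -/
noncomputable def wPow (i : Fin n) : ℤ → U X n r s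
  | .ofNat k => w i ^ k
  | .negSucc k => wInv i ^ (k + 1)

/-- The integral power `ω_i' ^ m`. -/
noncomputable def w'Pow (i : Fin n) : ℤ → U X n r s
  | .ofNat k => w' i ^ k
  | .negSucc k => w'Inv i ^ (k + 1)

end Generators

/-! ### The associated quantum group

`U_{s⁻¹,r⁻¹}(𝔤)` is, as an algebra, another copy of `U_{r,s}(𝔤)`, in which the roles of `e_i` and
`f_i` (up to a scalar) and of `ω_i` and `ω_i'` are exchanged.  (This identification reverses the
comultiplication `Δ e_i = e_i ⊗ 1 + ω_i ⊗ e_i`, `Δ f_i = 1 ⊗ f_i + f_i ⊗ ω_i'`: it is the isomorphism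
of the co-opposite Hopf algebra `U_{r,s}(𝔤)^cop` with `U_{s⁻¹,r⁻¹}(𝔤)`.) -/

/-- `Θ` is the canonical identification of `U_{r,s}(𝔤)` with `U_{s⁻¹,r⁻¹}(𝔤)`. -/
def IsAssocIdentification {X : ClassicalType} {n : ℕ} {r s : K}
    (Θ : U X n r s ≃ₐ[K] U X n s⁻¹ r⁻¹) : Prop :=
  ∀ i : Fin n, Θ (e i) = f i ∧ Θ (f i) = (r ^ sym X n i * s ^ sym X n i)⁻¹ • e i ∧
    Θ (w i) = w' i ∧ Θ (w' i) = w i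

/-! ### The Lusztig symmetries -/

/-- `⟨k⟩_i = (s_i^{-k} - r_i^{-k}) / (s_i^{-1} - r_i^{-1})`, for `u = r_i`, `v = s_i`. -/
def angleInt (u v : K) (k : ℕ) : K := (v⁻¹ ^ k - u⁻¹ ^ k) / (v⁻¹ - u⁻¹)

/-- `⟨k⟩_i!` -/
def angleFact (u v : K) (k : ℕ) : K := ∏ l ∈ Finset.range k, angleInt u v (l + 1)

/-- The divided power `x^{(k)} = x^k / ⟨k⟩_i!`. -/
def divPow {R : Type*} [Ring R] [Algebra K R] (u v : K) (x : R) (k : ℕ) : R :=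
  (angleFact u v k)⁻¹ • x ^ k

/-- The scalar `(rs)^{(ν/2)(-a-ν)} ⟨ω_i', ω_i⟩^{(ν/2)(1+a)}`, for `a = a_{ij} ∈ {0, -1, -2}` and
`0 ≤ ν ≤ -a`.  Here `⟨ω_i', ω_i⟩ = r_i s_i⁻¹`.  If `a ≠ -2` both exponents are `0`; if `a = -2` then
`r_i = r`, `s_i = s`, and collecting the powers of `r` and `s` leaves integral exponents. -/
def halfCoeff (r s : K) (a ν : ℤ) : K :=
  r ^ (-(ν * (ν - 1) / 2)) * s ^ (ν * (-2 * a - 1 - ν) / 2)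

/-- The scalar `(rs)^{(ν/2)(-a-ν)} ⟨ω_i', ω_i⟩^{-(ν/2)(1+a)}`, in the same situation. -/
def halfCoeff' (r s : K) (a ν : ℤ) : K :=
  r ^ (ν * (-2 * a - 1 - ν) / 2) * s ^ (-(ν * (ν - 1) / 2))

/-- `halfCoeff` is a square root of the scalar with doubled exponents. -/
theorem halfCoeff_sq (r s : K) (hr : r ≠ 0) (hs : s ≠ 0) (a ν : ℤ)
    (ha : a = 0 ∨ a = -1 ∨ a = -2) (h0 : 0 ≤ ν) (h1 : ν ≤ -a) :
    halfCoeff r s a ν ^ 2 = (r * s) ^ (ν * (-a - ν)) * (r * s⁻¹) ^ (ν * (1 + a)) := by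
  rcases ha with rfl | rfl | rfl <;> interval_cases ν <;> norm_num [halfCoeff] <;> field_simp

/-- `halfCoeff'` is a square root of the scalar with doubled exponents. -/
theorem halfCoeff'_sq (r s : K) (hr : r ≠ 0) (hs : s ≠ 0) (a ν : ℤ)
    (ha : a = 0 ∨ a = -1 ∨ a = -2) (h0 : 0 ≤ ν) (h1 : ν ≤ -a) :
    halfCoeff' r s a ν ^ 2 = (r * s) ^ (ν * (-a - ν)) * (r * s⁻¹) ^ (-(ν * (1 + a))) := by
  rcases ha with rfl | rfl | rfl <;> interval_cases ν <;> norm_num [halfCoeff'] <;>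
    field_simp

/-- The exponent `δ_{ij}^+` (types `A`, `C`, `D`) or `δ_{ij}^-` (type `B`). -/
def deltaExp (X : ClassicalType) (n : ℕ) (i j : Fin n) : ℕ :=
  if X.isB then (if j < i ∧ cartan X n i j ≠ 0 then 2 else 1)
  else (if i < j ∧ cartan X n i j ≠ 0 then 2 else 1)

section Symmetries

variable {X : ClassicalType} {n : ℕ} {r s : K}

/-- The element by which `T_i(e_j)` is given. -/
noncomputable def lusztigE (i j : Fin n) : U X n r s :=
  let a := cartan X n i j
  let ei : ℕ → U X n r s := divPow (r ^ sym X n i) (s ^ sym X n i) (e i)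
  if j = i then -(w'Inv i * f i)
  else if X.isB then
    ∑ ν ∈ Finset.range ((-a).toNat + 1),
      ((-1) ^ ν * halfCoeff' r s a ν * pair X n r s j i ^ ν) •
        (ei ((-a).toNat - ν) * e j * ei ν)
  else
    ∑ ν ∈ Finset.range ((-a).toNat + 1),
      ((-1) ^ ν * halfCoeff r s a ν * (pair X n r s j i)⁻¹ ^ ν) •
        (ei ν * e j * ei ((-a).toNat - ν))

/-- The element by which `T_i(f_j)` is given. -/
noncomputable def lusztigF (i j : Fin n) : U X n r s :=
  let a := cartan X n i j
  let fi : ℕ → U X n r s := divPow (r ^ sym X n i) (s ^ sym X n i) (f i)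
  if j = i then -((r ^ sym X n i * s ^ sym X n i) • (e i * wInv i))
  else if X.isB then
    (r ^ sym X n j * s ^ sym X n j) ^ deltaExp X n i j •
      ∑ ν ∈ Finset.range ((-a).toNat + 1),
        ((-1) ^ ν * halfCoeff r s a ν * (pair X n r s i j)⁻¹ ^ ν) •
          (fi ν * f j * fi ((-a).toNat - ν))
  else
    (r ^ sym X n j * s ^ sym X n j) ^ deltaExp X n i j •
      ∑ ν ∈ Finset.range ((-a).toNat + 1),
        ((-1) ^ ν * halfCoeff' r s a ν * pair X n r s i j ^ ν) •
          (fi ((-a).toNat - ν) * f j * fi ν)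

/-- `T` is the `i`-th Lusztig symmetry from `U_{r,s}(𝔤)` to its associated quantum group: a ring
homomorphism (in particular `ℚ`-linear) which restricts to the field automorphism `σ` on scalars and which takes the prescribed
values on the generators.  The prescribed values are written in the generators of `U_{r,s}(𝔤)` and
are placed in `U_{s⁻¹,r⁻¹}(𝔤)` by the identification `Θ`. -/
structure IsLusztigSymmetry (Θ : U X n r s ≃ₐ[K] U X n s⁻¹ r⁻¹) (σ : K ≃+* K) (i : Fin n)
    (T : U X n r s →+* U X n s⁻¹ r⁻¹) : Prop where
  map_scalar : ∀ c : K, T (algebraMap K _ c) = algebraMap K _ (σ c)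
  map_w : ∀ j, T (w j) = Θ (w j * wPow i (-cartan X n i j))
  map_w' : ∀ j, T (w' j) = Θ (w' j * w'Pow i (-cartan X n i j))
  map_e : ∀ j, T (e j) = Θ (lusztigE i j)
  map_f : ∀ j, T (f j) = Θ (lusztigF i j)

end Symmetries

/-- The field automorphism `σ` exchanges `r` with `s⁻¹`. -/
def IsSwap (r s : K) (σ : K ≃+* K) : Prop := σ r = s⁻¹ ∧ σ s = r⁻¹

/-- `U_{r,s}(𝔤)` has the Lusztig symmetries: all the `T_i` exist. -/
def HasLusztigSymmetries {X : ClassicalType} {n : ℕ} {r s : K}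
    (Θ : U X n r s ≃ₐ[K] U X n s⁻¹ r⁻¹) : Prop :=
  ∃ σ : K ≃+* K, IsSwap r s σ ∧
    ∀ i : Fin n, ∃ T : U X n r s →+* U X n s⁻¹ r⁻¹, IsLusztigSymmetry Θ σ i T

/-! ### The one-parameter quantum group of Drinfel'd–Jimbo type -/

/-- Generators `E_i, F_i, K_i, K_i⁻¹`. -/
inductive DJGen (n : ℕ)
  | E (i : Fin n)
  | F (i : Fin n)
  | k (i : Fin n)
  | kInv (i : Fin n)

open FreeAlgebra in
/-- The defining relations of `U_q(𝔤)`, with `q_i = q ^ d_i`. -/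
inductive DJRel (X : ClassicalType) (n : ℕ) (q : K) :
    FreeAlgebra K (DJGen n) → FreeAlgebra K (DJGen n) → Prop
  | k_comm (i j : Fin n) : DJRel X n q (ι K (.k i) * ι K (.k j)) (ι K (.k j) * ι K (.k i))
  | k_inv (i : Fin n) : DJRel X n q (ι K (.k i) * ι K (.kInv i)) 1
  | inv_k (i : Fin n) : DJRel X n q (ι K (.kInv i) * ι K (.k i)) 1
  | k_E (i j : Fin n) : DJRel X n q (ι K (.k i) * ι K (.E j) * ι K (.kInv i))
      ((q ^ sym X n i) ^ cartan X n i j • ι K (.E j))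
  | k_F (i j : Fin n) : DJRel X n q (ι K (.k i) * ι K (.F j) * ι K (.kInv i))
      ((q ^ sym X n i) ^ (-cartan X n i j) • ι K (.F j))
  | E_F (i j : Fin n) : DJRel X n q (ι K (.E i) * ι K (.F j) - ι K (.F j) * ι K (.E i))
      (if i = j then (q ^ sym X n i - (q ^ sym X n i)⁻¹)⁻¹ • (ι K (.k i) - ι K (.kInv i)) else 0)
  | E_comm (i j : Fin n) (ha : cartan X n i j = 0) :
      DJRel X n q (ι K (.E i) * ι K (.E j)) (ι K (.E j) * ι K (.E i))
  | F_comm (i j : Fin n) (ha : cartan X n i j = 0) :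
      DJRel X n q (ι K (.F i) * ι K (.F j)) (ι K (.F j) * ι K (.F i))
  | E_serre (i j : Fin n) (hij : i ≠ j) (ha : cartan X n i j ≠ 0) :
      DJRel X n q
        (serre (cartan X n i j) (q ^ sym X n i) (q ^ sym X n i)⁻¹ (ι K (.E i)) (ι K (.E j))) 0
  | F_serre (i j : Fin n) (hij : i ≠ j) (ha : cartan X n i j ≠ 0) :
      DJRel X n q
        (serre (cartan X n i j) (q ^ sym X n i) (q ^ sym X n i)⁻¹ (ι K (.F i)) (ι K (.F j))) 0

/-- The Drinfel'd–Jimbo quantum group `U_q(𝔤)`, as a `K`-algebra. -/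
def Uq (X : ClassicalType) (n : ℕ) (q : K) : Type _ := RingQuot (DJRel X n q)

noncomputable instance (X : ClassicalType) (n : ℕ) (q : K) : Ring (Uq X n q) :=
  inferInstanceAs (Ring (RingQuot (DJRel X n q)))

noncomputable instance (X : ClassicalType) (n : ℕ) (q : K) : Algebra K (Uq X n q) :=
  inferInstanceAs (Algebra K (RingQuot (DJRel X n q)))

namespace Uq

variable {X : ClassicalType} {n : ℕ} {q : K}

noncomputable def gen (g : DJGen n) : Uq X n q :=
  RingQuot.mkAlgHom K (DJRel X n q) (FreeAlgebra.ι K g)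

noncomputable def E (i : Fin n) : Uq X n q := gen (.E i)
noncomputable def F (i : Fin n) : Uq X n q := gen (.F i)
noncomputable def k (i : Fin n) : Uq X n q := gen (.k i)
noncomputable def kInv (i : Fin n) : Uq X n q := gen (.kInv i)

/-- The integral power `K_i ^ m`. -/
noncomputable def kPow (i : Fin n) : ℤ → Uq X n q
  | .ofNat m => k i ^ m
  | .negSucc m => kInv i ^ (m + 1)

/-- `[m]_i = (q_i^m - q_i^{-m}) / (q_i - q_i^{-1})`, for `p = q_i`. -/
def qInt (p : K) (m : ℕ) : K := (p ^ m - p⁻¹ ^ m) / (p - p⁻¹)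

/-- `[m]_i!` -/
def qFact (p : K) (m : ℕ) : K := ∏ l ∈ Finset.range m, qInt p (l + 1)

/-- The divided power `x^{(m)} = x^m / [m]_i!`. -/
noncomputable def divPow (p : K) (x : Uq X n q) (m : ℕ) : Uq X n q := (qFact p m)⁻¹ • x ^ m

/-- `L` is the usual Lusztig symmetry of `U_q(𝔤)` at the node `i`, in the normalization `T'_{i,1}`
of Lusztig's book:
`K_j ↦ K_j K_i^{-a_ij}`, `E_i ↦ -K_i F_i`, `F_i ↦ -E_i K_i⁻¹`, and for `j ≠ i`
`E_j ↦ ∑_ν (-1)^ν q_i^ν E_i^{(ν)} E_j E_i^{(-a_ij-ν)}`,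
`F_j ↦ ∑_ν (-1)^ν q_i^{-ν} F_i^{(-a_ij-ν)} F_j F_i^{(ν)}`. -/
structure IsLusztig (i : Fin n) (L : Uq X n q ≃ₐ[K] Uq X n q) : Prop where
  map_k : ∀ j, L (k j) = k j * kPow i (-cartan X n i j)
  map_E_self : L (E i) = -(k i * F i)
  map_F_self : L (F i) = -(E i * kInv i)
  map_E : ∀ j, j ≠ i → L (E j) = ∑ ν ∈ Finset.range ((-cartan X n i j).toNat + 1),
    ((-1) ^ ν * (q ^ sym X n i) ^ ν) •
      (divPow (q ^ sym X n i) (E i) ν * E j *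
        divPow (q ^ sym X n i) (E i) ((-cartan X n i j).toNat - ν))
  map_F : ∀ j, j ≠ i → L (F j) = ∑ ν ∈ Finset.range ((-cartan X n i j).toNat + 1),
    ((-1) ^ ν * (q ^ sym X n i)⁻¹ ^ ν) •
      (divPow (q ^ sym X n i) (F i) ((-cartan X n i j).toNat - ν) * F j *
        divPow (q ^ sym X n i) (F i) ν)

/-- The rescaling constants relating the symmetries of `U_{q,q⁻¹}(𝔤)` to those of `U_q(𝔤)`: all equal
to `1` in types `A`, `C`, `D`; in type `B` they are `(-q_i)^{a_ij}` for `j ≠ i`, and `1` for `j = i`. -/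
def rescale (X : ClassicalType) (n : ℕ) (q : K) (i j : Fin n) : K :=
  if X.isB ∧ j ≠ i then (-q ^ sym X n i) ^ cartan X n i j else 1

/-- `D` is the rescaling automorphism `E_j ↦ c_j E_j`, `F_j ↦ c_j⁻¹ F_j`, `K_j ↦ K_j`. -/
structure IsRescaling (c : Fin n → K) (D : Uq X n q ≃ₐ[K] Uq X n q) : Prop where
  map_k : ∀ j, D (k j) = k j
  map_E : ∀ j, D (E j) = c j • E j
  map_F : ∀ j, D (F j) = (c j)⁻¹ • F j

/-- `π` is the canonical projection `U_{r,s}(𝔤) → U_q(𝔤)`, `ω_i ↦ K_i`, `ω_i' ↦ K_i⁻¹`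
(meaningful for `r = q`, `s = q⁻¹`). -/
structure IsProjection {r s : K} (π : U X n r s →ₐ[K] Uq X n q) : Prop where
  surjective : Function.Surjective π
  map_e : ∀ i, π (e i) = E i
  map_f : ∀ i, π (f i) = F i
  map_w : ∀ i, π (w i) = k i
  map_w' : ∀ i, π (w' i) = kInv i

end Uq

end TwoParam

/-! Everything rests on one notion: a family `e, f, w, v` in an algebra satisfying the relations
`QG` attached to a matrix `p`, scalars `lam` and integers `m`. For `p = pair` the algebra `U_{r,s}`
carries the universal such family (`U.qg`, `U.lift`), its Serre polynomials being iterated skew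
commutators whose ratios are entries of `p`. Replacing `(r, s)` by `(s⁻¹, r⁻¹)` transposes `p`
(`pair_swap`); exchanging `e` with `f`, passing to the opposite algebra, and applying `σ` to the
scalars also transpose it.

The core is `QG.refl`. Fix a node `i`, replace `e_i` by a multiple of `v_i⁻¹ f_i` and each other
`e_j` by the top of its `i`-string `[e_i, [e_i, … e_j]]`, and treat the `f`'s dually. The result is
a family for the transposed matrix, under the conditions `ReflData`. The essential one says that the
bicharacter `p`, evaluated on the reflected roots of `j` and `k`, is its own transpose; cases
involving `i` or equal indices are automatic. Commutators come from `es_f_self`, `es_fs_comm` and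
`es_fs_self`. The Serre relations come from lowering strings, from computations in rank two, and for
nodes different from `i` from `serre_top`, which transports a relation along strings and must divide
by quantum integers.

In rank two there are no three distinct nodes, so there is no condition on `rs`. If `rs = 1`, then
`p i j = q_i ^ a_ij` is symmetric and reflection invariant; the extra inequalities in types `B` and
`C` keep the quantum integers in `serre_top` from vanishing. The prescribed values of the symmetries
are those of a reflection with suitable scalars (`lusztigE_eq`, `lusztigF_eq`, `lusztigScale_mul`).
Read in the opposite algebra, a reflection is an anti-endomorphism whose square is a rescaling,
hence it is bijective; composing it with a semilinear anti-automorphism gives the Lusztig symmetry.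

For necessity, apply `T_i` to the relation between `ω_j` and an `e_k` with `a_ik = 0`. Two scalars
multiplying the same element must agree, and for well-chosen nodes this forces `rs = 1` or `(rs)² =
1`. The element is non-zero because `e_k` acts non-trivially on a quotient of a Verma-type module
(`U.e_ne_zero`).

Finally `U_q` carries a family for the same `p` when `rs = 1`, so it has the same reflections, and
the projection intertwines them. In type `B` the prescribed normalization differs from the usual one
by the rescaling `D_i`. -/

namespace TwoParam

/-! ### Skew commutators -/

section SkewCommutator

variable {K A : Type*} [Field K] [Ring A] [Algebra K A]

/-- `u y = c y u`. -/
def QComm (c : K) (u y : A) : Prop := u * y = c • (y * u)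

namespace QComm

variable {c d : K} {u u' y z : A}

theorem mul_right (h : QComm c u y) (h' : QComm d u z) : QComm (c * d) u (y * z) := by
  unfold QComm at *
  rw [← mul_assoc, h, smul_mul_assoc, mul_assoc, h', mul_smul_comm, smul_smul, mul_assoc]

theorem mul_left (h : QComm c u y) (h' : QComm d u' y) : QComm (c * d) (u * u') y := by
  unfold QComm at *
  rw [mul_assoc, h', mul_smul_comm, ← mul_assoc, h, smul_mul_assoc, smul_smul, mul_assoc, mul_comm d]

theorem smul_right (h : QComm c u y) (a : K) : QComm c u (a • y) := by
  unfold QComm at *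
  rw [mul_smul_comm, h, smul_mul_assoc, smul_comm]

theorem sub_right (h : QComm c u y) (h' : QComm c u z) : QComm c u (y - z) := by
  unfold QComm at *
  rw [mul_sub, h, h', sub_mul, smul_sub]

theorem pow_left (h : QComm c u y) (n : ℕ) : QComm (c ^ n) (u ^ n) y := by
  induction n with
  | zero => simp [QComm]
  | succ n ih => rw [pow_succ, pow_succ]; exact ih.mul_left h

theorem of_eq (h : QComm c u y) (hcd : c = d) : QComm d u y := hcd ▸ h

theorem of_commute (h : u * y = y * u) : QComm (1 : K) u y := by
  rw [QComm, one_smul, h]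

theorem units_inv {u : Aˣ} (h : QComm c (u : A) y) (hc : c ≠ 0) :
    QComm c⁻¹ ((u⁻¹ : Aˣ) : A) y := by
  unfold QComm at *
  have h2 : y * (u : A) = c⁻¹ • (u * y) := by rw [h, smul_smul, inv_mul_cancel₀ hc, one_smul]
  calc ((u⁻¹ : Aˣ) : A) * y = ((u⁻¹ : Aˣ) : A) * (y * u) * ((u⁻¹ : Aˣ) : A) := by
        rw [mul_assoc, mul_assoc, Units.mul_inv, mul_one]
    _ = c⁻¹ • (y * ((u⁻¹ : Aˣ) : A)) := by
        rw [h2, mul_smul_comm, ← mul_assoc, Units.inv_mul, one_mul, smul_mul_assoc]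

theorem symm (h : QComm c u y) (hc : c ≠ 0) : QComm c⁻¹ y u := by
  unfold QComm at *
  rw [h, smul_smul, inv_mul_cancel₀ hc, one_smul]

end QComm

/-- The skew commutator `x y - c y x`. -/
def qstep (x : A) (c : K) (y : A) : A := x * y - c • (y * x)

/-- The iterated skew commutator with the ratios `c, c Q, c Q², …`. -/
def qad (x : A) (c Q : K) (y : A) : ℕ → A
  | 0 => y
  | n + 1 => qstep x (c * Q ^ n) (qad x c Q y n)

@[simp] theorem qad_zero (x : A) (c Q : K) (y : A) : qad x c Q y 0 = y := rfl

theorem qad_succ (x : A) (c Q : K) (y : A) (n : ℕ) :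
    qad x c Q y (n + 1) = qstep x (c * Q ^ n) (qad x c Q y n) := rfl

theorem qstep_smul (x : A) (c a : K) (y : A) : qstep x c (a • y) = a • qstep x c y := by
  simp only [qstep, mul_smul_comm, smul_mul_assoc, smul_sub]
  rw [smul_comm]

theorem smul_qstep (x : A) (c a : K) (y : A) : qstep (a • x) c y = a • qstep x c y := by
  simp only [qstep, mul_smul_comm, smul_mul_assoc, smul_sub]
  rw [smul_comm]

/-- Both operators are polynomials in left and right multiplication by `x`, which commute. -/
theorem qstep_comm (x : A) (c d : K) (y : A) :
    qstep x c (qstep x d y) = qstep x d (qstep x c y) := by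
  simp only [qstep, mul_sub, sub_mul, mul_smul_comm, smul_mul_assoc, mul_assoc]
  module

theorem qad_smul (x : A) (c Q a : K) (y : A) (n : ℕ) :
    qad x c Q (a • y) n = a • qad x c Q y n := by
  induction n with
  | zero => rfl
  | succ n ih => rw [qad_succ, qad_succ, ih, qstep_smul]

theorem smul_qad (x : A) (c Q a : K) (y : A) (n : ℕ) :
    qad (a • x) c Q y n = a ^ n • qad x c Q y n := by
  induction n with
  | zero => simp
  | succ n ih => rw [qad_succ, qad_succ, ih, smul_qstep, qstep_smul, smul_smul, pow_succ']

@[simp] theorem qad_of_zero (x : A) (c Q : K) (n : ℕ) : qad x c Q (0 : A) n = 0 := by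
  simpa using qad_smul x c Q 0 (0 : A) n

theorem qad_qstep (x : A) (c Q d : K) (y : A) (n : ℕ) :
    qad x c Q (qstep x d y) n = qstep x d (qad x c Q y n) := by
  induction n with
  | zero => rfl
  | succ n ih => rw [qad_succ, qad_succ, ih, qstep_comm]

theorem qad_succ' (x : A) (c Q : K) (y : A) (n : ℕ) :
    qad x c Q y (n + 1) = qad x (c * Q) Q (qstep x c y) n := by
  induction n with
  | zero => simp [qad]
  | succ n ih => rw [qad_succ, ih, qad_succ, pow_succ', mul_assoc]

/-- By `qstep_comm` the order of the ratios is immaterial, and `c Q ^ n, …, c Q, c` is the list `c,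
c Q, …, c Q ^ n` read backwards. -/
theorem qad_reverse (x : A) (c Q : K) (hQ : Q ≠ 0) (y : A) (n : ℕ) :
    qad x (c * Q ^ n) Q⁻¹ y (n + 1) = qad x c Q y (n + 1) := by
  induction n generalizing y with
  | zero => simp [qad]
  | succ n ih =>
    rw [qad_succ' x (c * Q ^ (n + 1)), qad_succ x c Q, ← qad_qstep, ← ih]
    congr 1
    field_simp
    ring

theorem map_qstep {B : Type*} [Ring B] [Algebra K B] (φ : A →ₐ[K] B) (x : A) (c : K) (y : A) :
    φ (qstep x c y) = qstep (φ x) c (φ y) := by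
  simp [qstep]

theorem map_qad {B : Type*} [Ring B] [Algebra K B] (φ : A →ₐ[K] B) (x : A) (c Q : K) (y : A)
    (n : ℕ) : φ (qad x c Q y n) = qad (φ x) c Q (φ y) n := by
  induction n with
  | zero => rfl
  | succ n ih => rw [qad_succ, qad_succ, map_qstep, ih]

open MulOpposite in
theorem qstep_op (x : A) (c : K) (hc : c ≠ 0) (y : A) :
    qstep (op x) c (op y) = op ((-c) • qstep x c⁻¹ y) := by
  simp only [qstep, ← op_mul, ← op_smul, ← op_sub]
  congr 1
  match_scalars <;> field_simp

open MulOpposite in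
theorem qad_op (x : A) (c Q : K) (hc : c ≠ 0) (hQ : Q ≠ 0) (y : A) (n : ℕ) :
    ∃ a : K, qad (op x) c Q (op y) n = op (a • qad x c⁻¹ Q⁻¹ y n) := by
  induction n with
  | zero => exact ⟨1, by simp⟩
  | succ n ih =>
    obtain ⟨a, ha⟩ := ih
    refine ⟨-(c * Q ^ n) * a, ?_⟩
    rw [qad_succ, ha, qstep_op _ _ (by positivity), qstep_smul, smul_smul, qad_succ, mul_inv,
      inv_pow]

-- Reversing products inverts every ratio, up to a scalar. The condition `h` says that the inverted
-- list of ratios is the list for `c'` read backwards, so the two iterated commutators vanish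
-- together. This is what makes Serre relations survive in the opposite algebra.
open MulOpposite in
theorem qad_op_eq_zero (x : A) (c c' Q : K) (hc : c ≠ 0) (hQ : Q ≠ 0) (y : A) (n : ℕ)
    (h : c * c' * Q ^ n = 1) (h0 : qad x c' Q y (n + 1) = 0) :
    qad (op x) c Q (op y) (n + 1) = 0 := by
  obtain ⟨a, ha⟩ := qad_op x c Q hc hQ y (n + 1)
  have : c⁻¹ = c' * Q ^ n := by
    apply inv_eq_of_mul_eq_one_right
    rw [← h]; ring
  rw [ha, this, qad_reverse _ _ _ hQ, h0]
  simp

theorem QComm.qstep {c d a : K} {u x y : A} (hx : QComm c u x) (hy : QComm d u y) :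
    QComm (c * d) u (qstep x a y) :=
  (hx.mul_right hy).sub_right (((hy.mul_right hx).smul_right a).of_eq (mul_comm d c))

theorem QComm.qad {c d a Q : K} {u x y : A} (hx : QComm c u x) (hy : QComm d u y) (n : ℕ) :
    QComm (c ^ n * d) u (qad x a Q y n) := by
  induction n with
  | zero => simpa using hy
  | succ n ih => exact (hx.qstep ih).of_eq (by ring)

end SkewCommutator

/-! ### Multiparameter quantum groups -/

/-- A family of elements of `A` satisfying the defining relations of a multiparameter quantum group,
except for the quantum Serre relations.  The units `v i` play the role of `ω_i'`. -/
structure PreQG {K ι : Type*} [Field K] (p : ι → ι → K) (lam : ι → K)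
    (A : Type*) [Ring A] [Algebra K A] where
  e : ι → A
  f : ι → A
  w : ι → Aˣ
  v : ι → Aˣ
  w_w : ∀ i j, w i * w j = w j * w i
  w_v : ∀ i j, w i * v j = v j * w i
  v_v : ∀ i j, v i * v j = v j * v i
  w_e : ∀ i j, QComm (p i j) (w j : A) (e i)
  w_f : ∀ i j, QComm (p i j)⁻¹ (w j : A) (f i)
  v_e : ∀ i j, QComm (p j i)⁻¹ (v j : A) (e i)
  v_f : ∀ i j, QComm (p j i) (v j : A) (f i)
  e_f : ∀ i, e i * f i - f i * e i = lam i • ((w i : A) - v i)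
  e_f_ne : ∀ i j, i ≠ j → e i * f j = f j * e i

/-- A family of elements satisfying all defining relations of a multiparameter quantum group with
Cartan integers `a i j = - m i j`, `i ≠ j`. -/
structure QG {K ι : Type*} [Field K] (p : ι → ι → K) (lam : ι → K) (m : ι → ι → ℕ)
    (A : Type*) [Ring A] [Algebra K A] extends PreQG p lam A where
  -- Each ratio is the eigenvalue of `w i` on the commutator reached so far; for the `f`'s it is the
  -- eigenvalue of `v i`. These are thus braided adjoint actions, and the cancellations below depend
  -- on this choice.
  serre_e : ∀ i j, i ≠ j → qad (e i) (p j i) (p i i) (e j) (m i j + 1) = 0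
  serre_f : ∀ i j, i ≠ j → qad (f i) (p i j) (p i i) (f j) (m i j + 1) = 0

section Basic

variable {K ι : Type*} [Field K] {p : ι → ι → K} {lam : ι → K} {m : ι → ι → ℕ}
  {A : Type*} [Ring A] [Algebra K A]

/-- Exchange of `e` and `f`, and of `w` and `v`. -/
def PreQG.dual (q : PreQG p lam A) : PreQG (fun i j => p j i) lam A where
  e := q.f
  f := q.e
  w := q.v
  v := q.w
  w_w := q.v_v
  w_v i j := (q.w_v j i).symm
  v_v := q.w_w
  w_e := q.v_f
  w_f := q.v_e
  v_e := q.w_f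
  v_f := q.w_e
  e_f i := by
    have := q.e_f i
    rw [← neg_sub, this, ← smul_neg, neg_sub]
  e_f_ne i j h := (q.e_f_ne j i h.symm).symm

/-- Exchange of `e` and `f`, and of `w` and `v`. -/
def QG.dual (q : QG p lam m A) : QG (fun i j => p j i) lam m A where
  toPreQG := q.toPreQG.dual
  serre_e := q.serre_f
  serre_f := q.serre_e

theorem QComm.op {c : K} {u y : A} (h : QComm c u y) (hc : c ≠ 0) :
    QComm c⁻¹ (MulOpposite.op u) (MulOpposite.op y) := by
  unfold QComm at *
  rw [← MulOpposite.op_mul, ← MulOpposite.op_mul, ← MulOpposite.op_smul, h, smul_smul,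
    inv_mul_cancel₀ hc, one_smul]

/-- A unit, as a unit of the opposite algebra. -/
def opUnit (u : Aˣ) : Aᵐᵒᵖˣ := Units.opEquiv.symm (MulOpposite.op u)

@[simp] theorem coe_opUnit (u : Aˣ) : ((opUnit u : Aᵐᵒᵖˣ) : Aᵐᵒᵖ) = MulOpposite.op (u : A) := rfl

theorem opUnit_comm {a b : Aˣ} (h : a * b = b * a) : opUnit a * opUnit b = opUnit b * opUnit a := by
  ext
  simp only [Units.val_mul, coe_opUnit, ← MulOpposite.op_mul]
  rw [← Units.val_mul, ← Units.val_mul, h]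

/-- The structure on the opposite algebra, with `w` and `v` exchanged. -/
def PreQG.op (q : PreQG p lam A) (hp : ∀ i j, p i j ≠ 0) : PreQG (fun i j => p j i) lam Aᵐᵒᵖ where
  e i := MulOpposite.op (q.e i)
  f i := MulOpposite.op (q.f i)
  w i := opUnit (q.v i)
  v i := opUnit (q.w i)
  w_w i j := opUnit_comm (q.v_v i j)
  w_v i j := opUnit_comm (q.w_v j i).symm
  v_v i j := opUnit_comm (q.w_w i j)
  w_e i j := ((q.v_e i j).op (inv_ne_zero (hp _ _))).of_eq (inv_inv _)
  w_f i j := (q.v_f i j).op (hp _ _)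
  v_e i j := (q.w_e i j).op (hp _ _)
  v_f i j := ((q.w_f i j).op (inv_ne_zero (hp _ _))).of_eq (inv_inv _)
  e_f i := by
    have := q.e_f i
    simp only [coe_opUnit, ← MulOpposite.op_mul, ← MulOpposite.op_sub, ← MulOpposite.op_smul]
    rw [← neg_sub, this, ← smul_neg, neg_sub]
  e_f_ne i j h := by
    rw [← MulOpposite.op_mul, ← MulOpposite.op_mul, q.e_f_ne i j h]

/-- The structure on the opposite algebra, with `w` and `v` exchanged. -/
def QG.op (q : QG p lam m A) (hp : ∀ i j, p i j ≠ 0)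
    (hm : ∀ i j, i ≠ j → p i j * p j i * p i i ^ m i j = 1) :
    QG (fun i j => p j i) lam m Aᵐᵒᵖ where
  toPreQG := q.toPreQG.op hp
  serre_e i j h := qad_op_eq_zero _ _ _ _ (hp _ _) (hp _ _) _ _ (hm i j h) (q.serre_e i j h)
  serre_f i j h := qad_op_eq_zero _ _ _ _ (hp _ _) (hp _ _) _ _
    (by rw [mul_comm (p j i)]; exact hm i j h) (q.serre_f i j h)

/-- Transport of the structure along an algebra homomorphism. -/
def QG.map {B : Type*} [Ring B] [Algebra K B] (q : QG p lam m A) (φ : A →ₐ[K] B) :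
    QG p lam m B where
  e i := φ (q.e i)
  f i := φ (q.f i)
  w i := Units.map φ (q.w i)
  v i := Units.map φ (q.v i)
  w_w i j := by rw [← map_mul, q.w_w, map_mul]
  w_v i j := by rw [← map_mul, q.w_v, map_mul]
  v_v i j := by rw [← map_mul, q.v_v, map_mul]
  w_e i j := by simpa [QComm] using congrArg φ (q.w_e i j)
  w_f i j := by simpa [QComm] using congrArg φ (q.w_f i j)
  v_e i j := by simpa [QComm] using congrArg φ (q.v_e i j)
  v_f i j := by simpa [QComm] using congrArg φ (q.v_f i j)
  e_f i := by simpa using congrArg φ (q.e_f i)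
  e_f_ne i j h := by simpa using congrArg φ (q.e_f_ne i j h)
  serre_e i j h := by simpa [map_qad] using congrArg φ (q.serre_e i j h)
  serre_f i j h := by simpa [map_qad] using congrArg φ (q.serre_f i j h)

/-- Rescaling of the generators `e` and `f`. -/
def QG.rescale {lam' : ι → K} (q : QG p lam m A) (c d : ι → K)
    (h : ∀ i, c i * d i * lam i = lam' i) : QG p lam' m A where
  e i := c i • q.e i
  f i := d i • q.f i
  w := q.w
  v := q.v
  w_w := q.w_w
  w_v := q.w_v
  v_v := q.v_v
  w_e i j := (q.w_e i j).smul_right _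
  w_f i j := (q.w_f i j).smul_right _
  v_e i j := (q.v_e i j).smul_right _
  v_f i j := (q.v_f i j).smul_right _
  e_f i := by
    rw [← h, mul_smul, ← q.e_f]
    simp only [smul_mul_assoc, mul_smul_comm, smul_smul, smul_sub]
    rw [mul_comm (d i)]
  e_f_ne i j h := by
    simp only [smul_mul_assoc, mul_smul_comm, q.e_f_ne i j h]
    rw [smul_comm]
  serre_e i j h := by rw [smul_qad, qad_smul, q.serre_e i j h, smul_zero, smul_zero]
  serre_f i j h := by rw [smul_qad, qad_smul, q.serre_f i j h, smul_zero, smul_zero]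

end Basic

end TwoParam

/-! ### Root strings and their commutators with the generators `f`. -/

namespace TwoParam

section Strings

variable {K ι : Type*} [Field K] {p : ι → ι → K} {lam : ι → K}
  {A : Type*} [Ring A] [Algebra K A]

/-- The quantum integer `1 + Q + ⋯ + Q^(n-1)`. -/
def qnum (Q : K) (n : ℕ) : K := ∑ t ∈ Finset.range n, Q ^ t

theorem qnum_succ (Q : K) (n : ℕ) : qnum Q (n + 1) = qnum Q n + Q ^ n :=
  Finset.sum_range_succ _ _

theorem qnum_add (Q : K) (a b : ℕ) : qnum Q (a + b) = qnum Q a + Q ^ a * qnum Q b := by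
  simp [qnum, Finset.sum_range_add, Finset.mul_sum, pow_add]

@[simp] theorem qnum_zero (Q : K) : qnum Q 0 = 0 := rfl
@[simp] theorem qnum_one (Q : K) : qnum Q 1 = 1 := by simp [qnum]
@[simp] theorem qnum_two (Q : K) : qnum Q 2 = 1 + Q := by simp [qnum, Finset.sum_range_succ]

theorem qnum_mul (Q : K) (n : ℕ) : qnum Q n * (1 - Q) = 1 - Q ^ n := by
  induction n with
  | zero => simp
  | succ n ih => rw [qnum_succ, add_mul, ih]; ring

namespace PreQG

variable (q : PreQG p lam A)

/-- The string `e_j, [e_i, e_j], [e_i, [e_i, e_j]], …` of skew commutators. -/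
def es (i j : ι) (n : ℕ) : A := qad (q.e i) (p j i) (p i i) (q.e j) n

/-- The string `f_j, [f_i, f_j], [f_i, [f_i, f_j]], …` of skew commutators. -/
def fs (i j : ι) (n : ℕ) : A := qad (q.f i) (p i j) (p i i) (q.f j) n

theorem es_succ (i j : ι) (n : ℕ) :
    q.es i j (n + 1) = q.e i * q.es i j n - (p j i * p i i ^ n) • (q.es i j n * q.e i) := rfl

theorem fs_succ (i j : ι) (n : ℕ) :
    q.fs i j (n + 1) = q.f i * q.fs i j n - (p i j * p i i ^ n) • (q.fs i j n * q.f i) := rfl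

@[simp] theorem es_zero (i j : ι) : q.es i j 0 = q.e j := rfl

@[simp] theorem fs_zero (i j : ι) : q.fs i j 0 = q.f j := rfl

@[simp] theorem dual_es (i j : ι) (n : ℕ) : q.dual.es i j n = q.fs i j n := rfl

@[simp] theorem dual_fs (i j : ι) (n : ℕ) : q.dual.fs i j n = q.es i j n := rfl

theorem w_es (i j l : ι) (n : ℕ) : QComm (p i l ^ n * p j l) (q.w l : A) (q.es i j n) :=
  (q.w_e i l).qad (q.w_e j l) n

theorem v_es (i j l : ι) (n : ℕ) :
    QComm ((p l i)⁻¹ ^ n * (p l j)⁻¹) (q.v l : A) (q.es i j n) :=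
  (q.v_e i l).qad (q.v_e j l) n

theorem v_fs (i j l : ι) (n : ℕ) : QComm (p l i ^ n * p l j) (q.v l : A) (q.fs i j n) :=
  (q.v_f i l).qad (q.v_f j l) n

theorem es_f_ne (i j l : ι) (hi : i ≠ l) (hj : j ≠ l) (n : ℕ) :
    q.es i j n * q.f l = q.f l * q.es i j n := by
  induction n with
  | zero => exact q.e_f_ne _ _ hj
  | succ n ih =>
    have h := q.e_f_ne i l hi
    rw [es_succ, sub_mul, mul_sub, mul_assoc, ih, ← mul_assoc, h, smul_mul_assoc,
      mul_assoc (q.es i j n), h, ← mul_assoc (q.es i j n), ih]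
    simp only [mul_assoc, mul_smul_comm]

/-- The scalar in `[es i j (n + 1), f i] = loc * es i j n * v i`. -/
def loc (p : ι → ι → K) (lam : ι → K) (i j : ι) (M n : ℕ) : K :=
  lam i * p j i * qnum (p i i) (n + 1) * (1 - p i i ^ M * (p i i)⁻¹ ^ n)

/-- Each further `e i` contributes a commutator `e_i f_i - f_i e_i`. Its `w i` part cancels, since
the ratio of the step is the eigenvalue of `w i` on the string; only `v i` survives. The
coefficients add up to `loc`, whose last factor vanishes at `n = M`; this is where Serre relations
of order `M + 1` come from. -/
theorem es_f_self (hp : ∀ i j, p i j ≠ 0) (i j : ι) (hij : i ≠ j) (M : ℕ)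
    (hM : p i j * p j i * p i i ^ M = 1) (n : ℕ) :
    q.es i j (n + 1) * q.f i - q.f i * q.es i j (n + 1) =
      loc p lam i j M n • (q.es i j n * q.v i) := by
  have hQ := hp i i
  have hχ : (p i j)⁻¹ = p j i * p i i ^ M := by
    apply inv_eq_of_mul_eq_one_right; rw [← hM]; ring
  have step : ∀ k, q.es i j (k + 1) * q.f i - q.f i * q.es i j (k + 1) =
      q.e i * (q.es i j k * q.f i - q.f i * q.es i j k)
      - (p j i * p i i ^ k) • ((q.es i j k * q.f i - q.f i * q.es i j k) * q.e i)
      + (lam i * (p j i * p i i ^ k - (p i j)⁻¹ * (p i i)⁻¹ ^ k)) • (q.es i j k * q.v i) := by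
    intro k
    have h1 := q.e_f i
    have h2 : (q.w i : A) * q.es i j k = (p i i ^ k * p j i) • (q.es i j k * q.w i) := q.w_es i j i k
    have h3 : (q.v i : A) * q.es i j k = ((p i i)⁻¹ ^ k * (p i j)⁻¹) • (q.es i j k * q.v i) :=
      q.v_es i j i k
    have h4 : q.e i * q.f i = q.f i * q.e i + lam i • ((q.w i : A) - q.v i) := by
      rw [← h1]; abel
    rw [es_succ]
    set E := q.es i j k
    calc _ = q.e i * (E * q.f i - q.f i * E) + (q.e i * q.f i) * E - q.f i * q.e i * E
          - (p j i * p i i ^ k) • ((E * q.f i - q.f i * E) * q.e i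
            + E * (q.e i * q.f i) - E * q.f i * q.e i) := by
          simp only [mul_sub, sub_mul, mul_smul_comm, smul_mul_assoc, mul_assoc]
          module
      _ = _ := by
        rw [h4, add_mul, smul_mul_assoc, sub_mul, h2, h3]
        simp only [mul_add, mul_sub, mul_smul_comm, mul_assoc]
        module
  induction n with
  | zero =>
    rw [step]
    simp only [es_zero, q.e_f_ne j i hij.symm, sub_self, mul_zero, zero_mul, smul_zero, zero_add,
      loc, hχ, pow_zero, mul_one, qnum_one]
    congr 1
    ring
  | succ n ih =>
    have h5 : (q.v i : A) * q.e i = (p i i)⁻¹ • (q.e i * q.v i) := q.v_e i i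
    have h6 : loc p lam i j M (n + 1) = loc p lam i j M n + lam i * (p j i * p i i ^ (n + 1) -
        (p i j)⁻¹ * (p i i)⁻¹ ^ (n + 1)) := by
      have := qnum_mul (p i i) (n + 1)
      simp only [loc, hχ, qnum_succ (p i i) (n + 1), inv_pow]
      field_simp
      linear_combination (-(lam i * p j i * p i i ^ n * p i i ^ M)) * this
    -- Moving `v i` past `e i` costs `(p i i)⁻¹`, which lowers the ratio of step `n + 1` to that of
    -- step `n`; the bracket around `es i j n` then reassembles to `es i j (n + 1)`.
    have h7 : p j i * p i i ^ (n + 1) * (p i i)⁻¹ = p j i * p i i ^ n := by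
      field_simp
      ring
    rw [step, ih, h6, add_smul]
    congr 1
    rw [mul_smul_comm, smul_mul_assoc, mul_assoc (q.es i j n), h5, q.es_succ i j n, sub_mul,
      smul_sub, mul_smul_comm, smul_smul, smul_smul, smul_mul_assoc, smul_smul, ← h7]
    simp only [mul_assoc]
    congr 2
    ring

end PreQG

end Strings

end TwoParam

/-! ### Commutators between strings of `e`'s and strings of `f`'s. -/

namespace TwoParam

section Commutators

variable {K ι : Type*} [Field K] {p : ι → ι → K} {lam : ι → K}
  {A : Type*} [Ring A] [Algebra K A]

namespace PreQG

variable (q : PreQG p lam A)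

/-- Commuting with the outer `f i` leaves a multiple of a shorter string times `v i`. These
corrections cancel, because `v i` acts on `fs i k n` by exactly the ratio of the next step. The
induction therefore needs all lengths `l` at once. -/
theorem es_fs_comm (hp : ∀ i j, p i j ≠ 0) {i j k : ι} (hij : i ≠ j) (hik : i ≠ k) (hjk : j ≠ k)
    (M : ℕ) (hM : p i j * p j i * p i i ^ M = 1) (l n : ℕ) :
    q.es i j l * q.fs i k n = q.fs i k n * q.es i j l := by
  induction n generalizing l with
  | zero => exact q.es_f_ne i j k hik hjk l
  | succ n ih =>
    obtain ⟨g, l', h⟩ : ∃ (g : K) (l' : ℕ), q.es i j l * q.f i =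
        q.f i * q.es i j l + g • (q.es i j l' * q.v i) := by
      cases l with
      | zero => exact ⟨0, 0, by simpa using q.e_f_ne j i hij.symm⟩
      | succ l => exact ⟨_, l, by rw [← q.es_f_self hp i j hij M hM l]; abel⟩
    have hv : (q.v i : A) * q.fs i k n = (p i i ^ n * p i k) • (q.fs i k n * q.v i) :=
      q.v_fs i k i n
    rw [fs_succ, mul_sub, sub_mul, ← mul_assoc, h, mul_smul_comm, ← mul_assoc, ih l, smul_mul_assoc,
      mul_assoc (q.fs i k n) _ (q.f i), h, add_mul, mul_add, mul_assoc _ _ (q.fs i k n), ih l,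
      smul_mul_assoc, mul_assoc _ _ (q.fs i k n), hv, mul_smul_comm, ← mul_assoc _ _ (q.v i : A),
      ih l', mul_smul_comm]
    simp only [mul_assoc]
    match_scalars <;> ring

/-- As `e j` commutes with `f i`, the bracket is the iterated skew commutator of `f i` with `lam j •
(w j - v j)`. The first ratio kills the `w j` term; on the `v j` term the step with index `t`
contributes `p i j * (p i i ^ M - p i i ^ t)`, so everything vanishes once `n ≥ M`. -/
theorem e_fs (hp : ∀ i j, p i j ≠ 0) {i j : ι} (hij : i ≠ j) (M : ℕ)
    (hM : p i j * p j i * p i i ^ M = 1) (n : ℕ) :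
    q.e j * q.fs i j (n + 1) - q.fs i j (n + 1) * q.e j =
      (-lam j * p i j ^ (n + 1) * ∏ t ∈ Finset.range (n + 1), (p i i ^ M - p i i ^ t)) •
        ((q.v j : A) * q.f i ^ (n + 1)) := by
  have hχ : (p j i)⁻¹ = p i j * p i i ^ M := by
    apply inv_eq_of_mul_eq_one_right; rw [← hM]; ring
  have hfv : q.f i * q.v j = (p i j * p i i ^ M) • (q.v j * q.f i) :=
    hχ ▸ (q.v_f i j).symm (hp _ _)
  have hfw : q.f i * q.w j = p i j • (q.w j * q.f i) :=
    ((q.w_f i j).symm (inv_ne_zero (hp _ _))).of_eq (inv_inv _)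
  have hef := q.e_f_ne j i hij.symm
  have step : ∀ k, q.e j * q.fs i j (k + 1) - q.fs i j (k + 1) * q.e j =
      q.f i * (q.e j * q.fs i j k - q.fs i j k * q.e j) -
      (p i j * p i i ^ k) • ((q.e j * q.fs i j k - q.fs i j k * q.e j) * q.f i) := by
    intro k
    rw [fs_succ, mul_sub, ← mul_assoc, hef]
    simp only [mul_smul_comm, ← mul_assoc, mul_sub, sub_mul, smul_mul_assoc]
    rw [mul_assoc _ (q.e j) (q.f i), hef]
    simp only [mul_assoc]
    module
  induction n with
  | zero =>
    rw [step, fs_zero, q.e_f j, mul_smul_comm, mul_sub, hfv, hfw, smul_mul_assoc, sub_mul]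
    simp only [Finset.prod_range_one, zero_add, pow_one, pow_zero]
    module
  | succ n ih =>
    rw [step, ih, Finset.prod_range_succ _ (n + 1), mul_smul_comm, ← mul_assoc, hfv]
    simp only [smul_mul_assoc, mul_assoc, ← pow_succ, ← pow_succ']
    module

/-- A recursion that removes the outer `e i`: moving it past the string of `f`'s is `es_f_self` for
the dual family. It ends at `e_fs`. -/
theorem es_fs_succ (hp : ∀ i j, p i j ≠ 0) {i j : ι} (hij : i ≠ j) (M : ℕ)
    (hM : p i j * p j i * p i i ^ M = 1) (k l : ℕ) :
    q.es i j (k + 1) * q.fs i j (l + 1) - q.fs i j (l + 1) * q.es i j (k + 1) =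
      q.e i * (q.es i j k * q.fs i j (l + 1) - q.fs i j (l + 1) * q.es i j k)
      - (p j i * p i i ^ k) • ((q.es i j k * q.fs i j (l + 1) - q.fs i j (l + 1) * q.es i j k) * q.e i)
      + (loc (fun a b => p b a) lam i j M l * (p j i * p i i ^ k)) •
        ((q.es i j k * q.fs i j l - q.fs i j l * q.es i j k) * q.w i) := by
  have h : q.fs i j (l + 1) * q.e i - q.e i * q.fs i j (l + 1) =
      loc (fun a b => p b a) lam i j M l • (q.fs i j l * q.w i) :=
    q.dual.es_f_self (fun i j => hp j i) i j hij M (by rw [← hM]; ring) l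
  have h' : q.fs i j (l + 1) * q.e i = q.e i * q.fs i j (l + 1) +
      loc (fun a b => p b a) lam i j M l • (q.fs i j l * q.w i) := by rw [← h]; abel
  have h2 : (q.w i : A) * q.es i j k = (p i i ^ k * p j i) • (q.es i j k * q.w i) := q.w_es i j i k
  rw [es_succ]
  simp only [mul_sub, sub_mul, smul_mul_assoc, mul_smul_comm, mul_assoc, smul_sub]
  rw [← mul_assoc (q.fs i j (l + 1)) (q.e i), h']
  simp only [add_mul, mul_add, smul_mul_assoc, mul_assoc, h2, mul_smul_comm]
  module

/-- The scalar in `[es i j M, fs i j M] = kap * (w_j w_i ^ M - v_j v_i ^ M)`. -/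
def kap (p : ι → ι → K) (lam : ι → K) (i j : ι) (M : ℕ) : K :=
  lam j * (lam i * (1 - p i i)) ^ M * (∏ t ∈ Finset.range M, qnum (p i i) (t + 1)) ^ 2 *
    ∏ t ∈ Finset.range M, (p i i)⁻¹ ^ (t + 1)

theorem es_fs_one (hp : ∀ i j, p i j ≠ 0) {i j : ι} (hij : i ≠ j) (M : ℕ)
    (hM : p i j * p j i * p i i ^ M = 1) :
    q.es i j 1 * q.fs i j 1 - q.fs i j 1 * q.es i j 1 =
      (lam i * lam j * p i j * p j i * (1 - p i i ^ M)) •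
        ((q.w j : A) * q.w i - q.v j * q.v i) := by
  have h1 := q.e_fs hp hij M hM 0
  simp only [Finset.prod_range_one, zero_add, pow_one, pow_zero] at h1
  have h4 : q.e i * q.f i = q.f i * q.e i + lam i • ((q.w i : A) - q.v i) := by
    rw [← q.e_f i]; abel
  have hev : q.e i * q.v j = p j i • (q.v j * q.e i) :=
    ((q.v_e i j).symm (inv_ne_zero (hp _ _))).of_eq (inv_inv _)
  rw [q.es_fs_succ hp hij M hM 0 0]
  simp only [es_zero, fs_zero, zero_add, h1, q.e_f j, mul_smul_comm, smul_mul_assoc, pow_zero,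
    mul_one, loc, qnum_one]
  rw [← mul_assoc, hev, smul_mul_assoc, mul_assoc (q.v j : A) (q.e i), h4]
  simp only [mul_add, mul_sub, sub_mul, mul_smul_comm, mul_assoc]
  module

theorem es_fs_one_two (hp : ∀ i j, p i j ≠ 0) {i j : ι} (hij : i ≠ j)
    (hM : p i j * p j i * p i i ^ 2 = 1) :
    q.es i j 1 * q.fs i j 2 - q.fs i j 2 * q.es i j 1 =
      (lam i * lam j * p j i * p i j ^ 2 * (1 - p i i ^ 2) * (p i i ^ 2 - p i i) * - (1 + p i i)) •
        ((q.v j : A) * (q.f i * q.v i)) := by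
  have hQ := hp i i
  have h1 := q.e_fs hp hij 2 hM 0
  simp only [Finset.prod_range_one, zero_add, pow_one, pow_zero] at h1
  have h2 := q.e_fs hp hij 2 hM 1
  simp only [Finset.prod_range_succ, Finset.prod_range_zero, Nat.reduceAdd, pow_one, pow_zero,
    one_mul] at h2
  have h4 : q.e i * q.f i = q.f i * q.e i + lam i • ((q.w i : A) - q.v i) := by
    rw [← q.e_f i]; abel
  have hev : q.e i * q.v j = p j i • (q.v j * q.e i) :=
    ((q.v_e i j).symm (inv_ne_zero (hp _ _))).of_eq (inv_inv _)
  have hwf : (q.w i : A) * q.f i = (p i i)⁻¹ • (q.f i * q.w i) := q.w_f i i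
  have hvf : (q.v i : A) * q.f i = p i i • (q.f i * q.v i) := q.v_f i i
  have h5 : q.e i * (q.v j * q.f i ^ 2) = p j i • (q.v j * (q.f i ^ 2 * q.e i)) +
      (p j i * lam i) • (q.v j * (q.f i * ((1 + (p i i)⁻¹) • (q.w i : A) - (1 + p i i) • q.v i))) := by
    rw [← mul_assoc, hev, sq]
    simp only [smul_mul_assoc, mul_assoc]
    rw [← mul_assoc (q.e i), h4]
    simp only [add_mul, mul_assoc, h4, smul_mul_assoc, sub_mul, hwf, hvf, mul_add, mul_sub,
      mul_smul_comm, smul_sub]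
    module
  rw [q.es_fs_succ hp hij 2 hM 0 1]
  simp only [es_zero, Nat.reduceAdd, h1, h2, mul_smul_comm, smul_mul_assoc, pow_zero,
    mul_one, loc, qnum_two, pow_one, h5]
  simp only [mul_add, mul_sub, mul_smul_comm, mul_assoc, smul_sub]
  match_scalars
  · ring
  · field_simp
    ring
  · ring

/-- The tops of the strings behave like `e` and `f` for the reflected root, with torus elements `w_j
w_i ^ M` and `v_j v_i ^ M`. Lengths `M ≤ 2` are all that the classical types require, and each is
computed from the recursion. -/
theorem es_fs_self (hp : ∀ i j, p i j ≠ 0) {i j : ι} (hij : i ≠ j) (M : ℕ)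
    (hM : p i j * p j i * p i i ^ M = 1) (hM2 : M ≤ 2) :
    q.es i j M * q.fs i j M - q.fs i j M * q.es i j M =
      kap p lam i j M • (((q.w j * q.w i ^ M : Aˣ) : A) - ((q.v j * q.v i ^ M : Aˣ) : A)) := by
  have hQ := hp i i
  interval_cases M
  · simp [kap, q.e_f]
  · rw [q.es_fs_one hp hij 1 hM]
    have : p i j * p j i = (p i i)⁻¹ := by
      apply eq_inv_of_mul_eq_one_left; simpa using hM
    simp only [Units.val_mul, pow_one, kap, Finset.prod_range_one, zero_add, qnum_one]
    congr 1
    rw [mul_assoc (lam i * lam j), this]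
    ring
  · have h11 := q.es_fs_one hp hij 2 hM
    have h12 := q.es_fs_one_two hp hij hM
    have hji := hp j i
    have hχ' : p i j = (p j i)⁻¹ * (p i i)⁻¹ ^ 2 := by
      field_simp
      exact hM
    have h4 : q.e i * q.f i = q.f i * q.e i + lam i • ((q.w i : A) - q.v i) := by
      rw [← q.e_f i]; abel
    have hev : q.e i * q.v j = p j i • (q.v j * q.e i) :=
      ((q.v_e i j).symm (inv_ne_zero (hp _ _))).of_eq (inv_inv _)
    have hve : (q.v i : A) * q.e i = (p i i)⁻¹ • (q.e i * q.v i) := q.v_e i i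
    have hwv : (q.w i : A) * q.v i = q.v i * q.w i := by
      rw [← Units.val_mul, ← Units.val_mul, q.w_v]
    have h5 : q.e i * (q.v j * (q.f i * q.v i)) =
        p j i • (q.v j * (q.f i * (q.e i * q.v i))) +
        (p j i * lam i) • (q.v j * (q.v i * q.w i) - q.v j * (q.v i * q.v i)) := by
      rw [← mul_assoc, hev]
      simp only [smul_mul_assoc, mul_assoc]
      rw [← mul_assoc (q.e i), h4]
      simp only [add_mul, mul_assoc, smul_mul_assoc, sub_mul, mul_add, mul_sub,
        mul_smul_comm, smul_sub, hwv]
      module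
    rw [q.es_fs_succ hp hij 2 hM 1 1]
    simp only [Nat.reduceAdd, h11, h12, mul_smul_comm, smul_mul_assoc, loc, qnum_two, pow_one, h5,
      hve, mul_assoc]
    simp only [Units.val_mul, pow_two, kap, Finset.prod_range_succ, Finset.prod_range_zero, zero_add,
      qnum_one, qnum_two, pow_one, sub_mul, mul_assoc, smul_sub, one_mul, Nat.reduceAdd]
    match_scalars
    · field_simp
      ring
    all_goals
      rw [hχ']
      field_simp
      ring

end PreQG

end Commutators

end TwoParam

/-! ### Divided strings and the transport of Serre relations along them. -/

namespace TwoParam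

section DividedStrings

variable {K A : Type*} [Field K] [Ring A] [Algebra K A]

/-- A sequence of divided skew commutators with `x`. -/
def QString (x : A) (Q χ : K) (a : ℕ → A) : Prop :=
  ∀ n, x * a n - (χ * Q ^ n) • (a n * x) = qnum Q (n + 1) • a (n + 1)

/-- The divided skew commutators of a product. -/
def mulStr (χ : K) (a b : ℕ → A) (n : ℕ) : A :=
  ∑ ij ∈ Finset.HasAntidiagonal.antidiagonal n, χ ^ ij.2 • (a ij.1 * b ij.2)

/-- A quantum Leibniz rule: the skew commutator with `x` hits one factor or the other, and the two
contributions recombine through `[a + b] = [a] + Q ^ a [b]`. -/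
theorem QString.mul {x : A} {Q χ ψ : K} {a b : ℕ → A} (ha : QString x Q χ a)
    (hb : QString x Q ψ b) : QString x Q (χ * ψ) (mulStr χ a b) := by
  intro n
  have h1 : x * mulStr χ a b n - (χ * ψ * Q ^ n) • (mulStr χ a b n * x) =
      ∑ ij ∈ Finset.HasAntidiagonal.antidiagonal n, (χ ^ ij.2 * qnum Q (ij.1 + 1)) • (a (ij.1 + 1) * b ij.2) +
      ∑ ij ∈ Finset.HasAntidiagonal.antidiagonal n, (χ ^ (ij.2 + 1) * (Q ^ ij.1 * qnum Q (ij.2 + 1))) •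
        (a ij.1 * b (ij.2 + 1)) := by
    simp only [mulStr]
    rw [Finset.mul_sum, Finset.sum_mul, Finset.smul_sum, ← Finset.sum_sub_distrib,
      ← Finset.sum_add_distrib]
    refine Finset.sum_congr rfl fun ij hij => ?_
    have hn : ij.1 + ij.2 = n := Finset.HasAntidiagonal.mem_antidiagonal.mp hij
    have e1 : x * a ij.1 = (χ * Q ^ ij.1) • (a ij.1 * x) + qnum Q (ij.1 + 1) • a (ij.1 + 1) := by
      rw [← ha]; abel
    have e2 : x * b ij.2 = (ψ * Q ^ ij.2) • (b ij.2 * x) + qnum Q (ij.2 + 1) • b (ij.2 + 1) := by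
      rw [← hb]; abel
    rw [mul_smul_comm, ← mul_assoc, e1, add_mul, smul_mul_assoc, mul_assoc, e2, ← hn]
    simp only [mul_add, smul_mul_assoc, mul_smul_comm, mul_assoc, pow_add]
    module
  have h2 : qnum Q (n + 1) • mulStr χ a b (n + 1) =
      ∑ ij ∈ Finset.HasAntidiagonal.antidiagonal (n + 1), (χ ^ ij.2 * qnum Q ij.1) • (a ij.1 * b ij.2) +
      ∑ ij ∈ Finset.HasAntidiagonal.antidiagonal (n + 1), (χ ^ ij.2 * (Q ^ ij.1 * qnum Q ij.2)) •
        (a ij.1 * b ij.2) := by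
    rw [mulStr, Finset.smul_sum, ← Finset.sum_add_distrib]
    refine Finset.sum_congr rfl fun ij hij => ?_
    rw [← Finset.HasAntidiagonal.mem_antidiagonal.mp hij, qnum_add]
    module
  rw [h1, h2, Finset.Nat.sum_antidiagonal_succ, Finset.Nat.sum_antidiagonal_succ' (n := n)
    (f := fun ij => (χ ^ ij.2 * (Q ^ ij.1 * qnum Q ij.2)) • (a ij.1 * b ij.2))]
  simp

theorem QString.smul {x : A} {Q χ : K} {a : ℕ → A} (ha : QString x Q χ a) (c : K) :
    QString x Q χ (fun n => c • a n) := by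
  intro n
  have := congrArg (fun y => c • y) (ha n)
  simp only [smul_sub] at this
  rw [mul_smul_comm, smul_mul_assoc, smul_comm (χ * Q ^ n), this, smul_comm]

theorem QString.sub {x : A} {Q χ : K} {a b : ℕ → A} (ha : QString x Q χ a)
    (hb : QString x Q χ b) : QString x Q χ (fun n => a n - b n) := by
  intro n
  rw [smul_sub, ← ha, ← hb, mul_sub, sub_mul, smul_sub]
  abel

/-- The divided skew commutators of `qstep y c z`. -/
def qstepStr (c χ ψ : K) (a b : ℕ → A) (n : ℕ) : A := mulStr χ a b n - c • mulStr ψ b a n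

theorem QString.qstepStr {x : A} {Q χ ψ : K} {a b : ℕ → A} (ha : QString x Q χ a)
    (hb : QString x Q ψ b) (c : K) : QString x Q (χ * ψ) (qstepStr c χ ψ a b) :=
  (ha.mul hb).sub ((mul_comm ψ χ ▸ hb.mul ha).smul c)

/-- Each term determines the next as long as the quantum integer can be divided out. This is the
sole source of the non-vanishing conditions `ReflData.num`. -/
theorem QString.eq_zero {x : A} {Q χ : K} {a : ℕ → A} (ha : QString x Q χ a) (h0 : a 0 = 0)
    (N : ℕ) (hN : ∀ n, 0 < n → n ≤ N → qnum Q n ≠ 0) : a N = 0 := by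
  induction N with
  | zero => exact h0
  | succ N ih =>
    have h := ha N
    rw [ih fun n h1 h2 => hN n h1 (h2.trans N.le_succ)] at h
    simp only [mul_zero, zero_mul, smul_zero, sub_zero] at h
    exact (smul_eq_zero.mp h.symm).resolve_left (hN _ N.succ_pos le_rfl)

theorem mulStr_top {χ : K} {a b : ℕ → A} {M N : ℕ} (ha : ∀ n, M < n → a n = 0)
    (hb : ∀ n, N < n → b n = 0) : mulStr χ a b (M + N) = χ ^ N • (a M * b N) := by
  rw [mulStr, Finset.sum_eq_single (M, N)]
  · rintro ⟨s, t⟩ hst hne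
    have hst' : s + t = M + N := Finset.HasAntidiagonal.mem_antidiagonal.mp hst
    rcases lt_trichotomy s M with h | h | h
    · simp [hb t (by omega)]
    · exact absurd (by ext <;> simp <;> omega) hne
    · simp [ha s h]
  · intro h
    exact absurd (by simp) h

theorem mulStr_eq_zero {χ : K} {a b : ℕ → A} {M N : ℕ} (ha : ∀ n, M < n → a n = 0)
    (hb : ∀ n, N < n → b n = 0) (n : ℕ) (hn : M + N < n) : mulStr χ a b n = 0 := by
  refine Finset.sum_eq_zero ?_
  rintro ⟨s, t⟩ hst
  have hst' : s + t = n := Finset.HasAntidiagonal.mem_antidiagonal.mp hst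
  rcases lt_or_ge M s with h | h
  · simp [ha s h]
  · simp [hb t (by omega)]

@[simp] theorem mulStr_zero (χ : K) (a b : ℕ → A) : mulStr χ a b 0 = a 0 * b 0 := by
  simp [mulStr]

theorem mulStr_one (χ : K) (a b : ℕ → A) : mulStr χ a b 1 = a 1 * b 0 + χ • (a 0 * b 1) := by
  simp [mulStr, Finset.Nat.antidiagonal_succ]
  abel

theorem mulStr_two (χ : K) (a b : ℕ → A) :
    mulStr χ a b 2 = a 2 * b 0 + χ • (a 1 * b 1) + χ ^ 2 • (a 0 * b 2) := by
  simp [mulStr, Finset.Nat.antidiagonal_succ]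
  abel

/-- The quantum factorial. -/
def qfac (Q : K) (n : ℕ) : K := ∏ t ∈ Finset.range n, qnum Q (t + 1)

theorem qfac_succ (Q : K) (n : ℕ) : qfac Q (n + 1) = qfac Q n * qnum Q (n + 1) :=
  Finset.prod_range_succ _ _

theorem qfac_ne_zero {Q : K} {n : ℕ} (h : ∀ t, 0 < t → t ≤ n → qnum Q t ≠ 0) : qfac Q n ≠ 0 :=
  Finset.prod_ne_zero_iff.mpr fun t ht => h _ t.succ_pos (Finset.mem_range.mp ht)

/-- The divided skew commutators of `y` with `x`, up to the order `M`. -/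
def divStr (x : A) (χ Q : K) (y : A) (M n : ℕ) : A :=
  if n ≤ M then (qfac Q n)⁻¹ • qad x χ Q y n else 0

/-- Since the commutator of order `M + 1` vanishes, the string may be cut off there, and only the
quantum integers up to `M` have to be invertible. -/
theorem divStr_qstring {x : A} {χ Q : K} {y : A} {M : ℕ} (h : qad x χ Q y (M + 1) = 0)
    (hM : ∀ t, 0 < t → t ≤ M → qnum Q t ≠ 0) : QString x Q χ (divStr x χ Q y M) := by
  intro n
  rcases lt_trichotomy n M with hn | rfl | hn
  · simp only [divStr, if_pos hn.le, if_pos (Nat.succ_le_of_lt hn)]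
    have := hM (n + 1) n.succ_pos hn
    rw [qad_succ, qfac_succ, smul_smul, mul_inv_rev, mul_inv_cancel_left₀ this, qstep,
      mul_smul_comm, smul_mul_assoc, smul_sub, smul_comm (χ * Q ^ n)]
  · simp only [divStr, if_pos le_rfl, if_neg (Nat.lt_irrefl _), Nat.succ_le_iff, smul_zero]
    rw [mul_smul_comm, smul_mul_assoc, smul_comm (χ * Q ^ n), ← smul_sub]
    rw [qad_succ, qstep] at h
    rw [h, smul_zero]
  · simp only [divStr, if_neg (not_le.mpr hn), if_neg (not_le.mpr (hn.trans n.lt_succ_self)),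
      mul_zero, zero_mul, smul_zero, sub_zero]

/-- Quantum Serre relations are preserved by passing to the ends of the strings. -/
theorem serre_top {x y z : A} {Q P χ ψ c : K} {M N l : ℕ} (hχ : χ ≠ 0)
    (hy : qad x χ Q y (M + 1) = 0) (hz : qad x ψ Q z (N + 1) = 0)
    (h : qad y c P z (l + 1) = 0)
    (hQ : ∀ t, 0 < t → t ≤ (l + 1) * M + N → qnum Q t ≠ 0) :
    qad (qad x χ Q y M) (c * ψ ^ M * χ⁻¹ ^ N) P (qad x ψ Q z N) (l + 1) = 0 := by
  have hQM : ∀ t, 0 < t → t ≤ M → qnum Q t ≠ 0 := fun t h1 h2 => hQ t h1 (by nlinarith)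
  have hQN : ∀ t, 0 < t → t ≤ N → qnum Q t ≠ 0 := fun t h1 h2 => hQ t h1 (by nlinarith)
  set a := divStr x χ Q y M with ha
  set b := divStr x ψ Q z N with hb
  have haS : QString x Q χ a := divStr_qstring hy hQM
  have hbS : QString x Q ψ b := divStr_qstring hz hQN
  have ha0 : ∀ n, M < n → a n = 0 := fun n hn => by simp [ha, divStr, not_le.mpr hn]
  -- For each `t` there is a string starting at the `t`-fold commutator of `y` with `z`, ending in
  -- degree `t * M + N`, whose last term is a non-zero multiple of the `t`-fold commutator of the
  -- tops.
  have key : ∀ t, ∃ (r : ℕ → A) (g : K), QString x Q (χ ^ t * ψ) r ∧ g ≠ 0 ∧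
      r 0 = qad y c P z t ∧ (∀ n, t * M + N < n → r n = 0) ∧
      r (t * M + N) = g • qad (a M) (c * ψ ^ M * χ⁻¹ ^ N) P (b N) t := by
    intro t
    induction t with
    | zero =>
      refine ⟨b, 1, by simpa using hbS, one_ne_zero, by simp [hb, divStr, qfac], ?_, by simp⟩
      intro n hn
      have : ¬ n ≤ N := by omega
      simp [hb, divStr, this]
    | succ t ih =>
      obtain ⟨r, g, hr, hg, hr0, hrz, hrt⟩ := ih
      have e : (t + 1) * M + N = M + (t * M + N) := by ring
      have e' : M + (t * M + N) = (t * M + N) + M := by ring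
      refine ⟨qstepStr (c * P ^ t) χ (χ ^ t * ψ) a r, χ ^ (t * M + N) * g, ?_, by positivity, ?_,
        ?_, ?_⟩
      · have := haS.qstepStr hr (c * P ^ t)
        rwa [← mul_assoc, ← pow_succ'] at this
      · simp [TwoParam.qstepStr, hr0, qad_succ, qstep, ha, divStr, qfac]
      · intro n hn
        rw [e] at hn
        rw [TwoParam.qstepStr, mulStr_eq_zero ha0 hrz n hn, mulStr_eq_zero hrz ha0 n (e' ▸ hn)]
        simp
      · rw [e, TwoParam.qstepStr, mulStr_top ha0 hrz, e', mulStr_top hrz ha0, hrt, qad_succ, qstep]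
        simp only [mul_smul_comm, smul_mul_assoc]
        match_scalars
        · ring
        · rw [inv_pow]
          field_simp
          ring
  obtain ⟨r, g, hr, hg, hr0, -, hrt⟩ := key (l + 1)
  -- For `t = l + 1` the string starts at the given Serre relation, that is at zero, so its last
  -- term vanishes too.
  rw [hr.eq_zero (hr0.trans h) _ hQ] at hrt
  have h1 := (smul_eq_zero.mp hrt.symm).resolve_left hg
  simp only [ha, hb, divStr, if_pos le_rfl] at h1
  rw [smul_qad, qad_smul, smul_smul] at h1
  exact (smul_eq_zero.mp h1).resolve_left
    (mul_ne_zero (pow_ne_zero _ (inv_ne_zero (qfac_ne_zero hQM))) (inv_ne_zero (qfac_ne_zero hQN)))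

end DividedStrings

end TwoParam

/-! ### Serre relations at the top of a string, in rank two. -/

namespace TwoParam

section RankTwo

variable {K A : Type*} [Field K] [Ring A] [Algebra K A]

theorem qstep_swap (x y : A) (c d : K) (h : c * d = 1) : qstep x c y = (-c) • qstep y d x := by
  have : c • y * x = c • (y * x) := smul_mul_assoc _ _ _
  simp only [qstep, smul_sub, smul_smul, neg_mul, h]
  module

/-- The Serre relation between `y` and `x`, in terms of `[x, y]`. -/
theorem serre_reduce {x y : A} {a b P : K} (hP : P ≠ 0) (L : ℕ) (h : a * b * P ^ L = 1)
    (hs : qad y a P x (L + 1) = 0) (hL : L ≠ 0) :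
    qad y (a * P ^ (L - 1)) P⁻¹ (qstep x b y) L = 0 := by
  obtain ⟨L, rfl⟩ := Nat.exists_eq_succ_of_ne_zero hL
  have hc : (a * P ^ (L + 1)) * b = 1 := by rw [← h, Nat.succ_eq_add_one]; ring
  have hc0 : -(a * P ^ (L + 1)) ≠ 0 := neg_ne_zero.mpr (left_ne_zero_of_mul_eq_one hc)
  -- With the ratios reversed, the innermost commutator uses `a * P ^ L`, the inverse of `b`, so it
  -- is a multiple of `[x, y]`.
  rw [← qad_reverse _ _ _ hP, qad_succ', qstep_swap _ _ _ _ hc, qad_smul] at hs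
  have e : a * P ^ (L.succ - 1) = a * P ^ (L + 1) * P⁻¹ := by
    simp only [Nat.succ_sub_one]
    field_simp
    ring
  rw [e]
  exact (smul_eq_zero.mp hs).resolve_left hc0

variable {x y : A} {a b Q P : K}

theorem serre_end_one_one (h : a * b * P = 1) (hP : P ≠ 0) (hs : qad y a P x 2 = 0) :
    qstep (qstep x b y) (b * P) y = 0 := by
  have h1 := serre_reduce (L := 1) hP (by rw [← h, pow_one]) hs one_ne_zero
  rw [qad_succ, qad_zero] at h1
  rw [qstep_swap _ _ _ a (by rw [← h]; ring)]
  simp only [Nat.sub_self, pow_zero, mul_one] at h1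
  rw [h1, smul_zero]

/-- The relation of `y` with `x` says that `y` and `[x, y]` skew commute. Carrying this along the
strings of both elements, its term of degree 2 says that the two upper members of the string of `y`
skew commute. -/
theorem serre_end_two_one (h : a * b * P = 1) (hP : P = Q ^ 2) (hQ : Q ≠ 0) (hQ1 : 1 + Q ≠ 0)
    (hs : qad y a P x 2 = 0) (hx : qad x b Q y 3 = 0) :
    qstep (qad x b Q y 2) (b * P) (qad x b Q y 1) = 0 := by
  have hP0 : P ≠ 0 := hP ▸ pow_ne_zero 2 hQ
  have h1 := serre_reduce (L := 1) hP0 (by rw [← h, pow_one]) hs one_ne_zero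
  rw [qad_succ, qad_zero] at h1
  simp only [Nat.sub_self, pow_zero, mul_one] at h1
  have hq : ∀ t, 0 < t → t ≤ 2 → qnum Q t ≠ 0 := by
    intro t h1 h2
    interval_cases t
    · simp
    · simpa using hQ1
  have hA : QString x Q b (divStr x b Q y 2) := divStr_qstring hx hq
  -- The string of `[x, y]` is the string of `y` shifted by one, so its initial ratio is `b * Q`.
  have hB : QString x Q (b * Q) (fun n => qnum Q (n + 1) • divStr x b Q y 2 (n + 1)) := by
    intro n
    have := hA (n + 1)
    simp only
    rw [mul_smul_comm, smul_mul_assoc, ← this, smul_sub, smul_comm (qnum Q (n + 1)) (_ * _),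
      mul_assoc, pow_succ']
  have h0 := (hA.qstepStr hB a).eq_zero (by
    simpa [TwoParam.qstepStr, divStr, qfac, qstep, qad_succ] using h1) 2 hq
  simp only [TwoParam.qstepStr, mulStr_two, divStr, qfac, Finset.prod_range_succ,
    Finset.prod_range_zero, Nat.reduceAdd, Nat.reduceLeDiff, if_true, qnum_one, qnum_two, one_mul,
    inv_one, one_smul, zero_add, qad_zero, if_false, smul_zero, mul_zero, zero_mul, add_zero,
    smul_smul, mul_inv_cancel₀ hQ1, smul_mul_assoc, mul_smul_comm, smul_add] at h0
  have ha : a = (b * P)⁻¹ := eq_inv_of_mul_eq_one_left (by rw [← h]; ring)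
  have hb : b ≠ 0 := by rintro rfl; simp at h
  have key : qstep (qad x b Q y 2) (b * P) (qad x b Q y 1) = (-(1 + Q) * Q) • (0 : A) := by
    rw [← h0, qstep]
    subst hP
    rw [ha]
    match_scalars
    all_goals
      field_simp
      try ring
  rw [key, smul_zero]

/-- Here `y` and `[x, y]` satisfy a relation quadratic in `y`. Its term of degree 1 along the
strings of `x` is a multiple of the wanted relation, quadratic in `[x, y]`. -/
theorem serre_end_one_two (h : a * b * Q = 1) (hP : Q = P ^ 2) (hP0 : P ≠ 0)
    (hs : qad y a P x 3 = 0) (hx : qad x b Q y 2 = 0) :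
    qad (qad x b Q y 1) (b * P) P y 2 = 0 := by
  have h1 := serre_reduce (L := 2) hP0 (by rw [← h, ← hP]) hs two_ne_zero
  simp only [Nat.add_one_sub_one, pow_one] at h1
  have hq : ∀ t, 0 < t → t ≤ 1 → qnum Q t ≠ 0 := by
    intro t h1 h2
    interval_cases t; simp
  have hA : QString x Q b (divStr x b Q y 1) := divStr_qstring hx hq
  have hB : QString x Q (b * Q) (fun n => qnum Q (n + 1) • divStr x b Q y 1 (n + 1)) := by
    intro n
    have := hA (n + 1)
    simp only
    rw [mul_smul_comm, smul_mul_assoc, ← this, smul_sub, smul_comm (qnum Q (n + 1)) (_ * _),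
      mul_assoc, pow_succ']
  have h0 := (hA.qstepStr (hA.qstepStr hB (a * P)) a).eq_zero (by
    simpa [TwoParam.qstepStr, divStr, qfac, qstep, qad_succ, mul_assoc, hP0] using h1) 1 hq
  simp only [TwoParam.qstepStr, mulStr_one, mulStr_zero, divStr, qfac, Finset.prod_range_succ,
    Finset.prod_range_zero, Nat.reduceAdd, Nat.reduceLeDiff, if_true, qnum_one, qnum_two, one_mul,
    inv_one, one_smul, zero_add, qad_zero, if_false, smul_zero, mul_zero, zero_mul, add_zero,
    smul_smul, smul_add] at h0
  have ha : a = (b * Q)⁻¹ := eq_inv_of_mul_eq_one_left (by rw [← h]; ring)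
  have hb : b ≠ 0 := by rintro rfl; simp at h
  have key : qad (qad x b Q y 1) (b * P) P y 2 = (-b * P ^ 2) • (0 : A) := by
    rw [← h0]
    generalize qad x b Q y 1 = Y
    rw [qad_succ, qad_succ, qad_zero]
    simp only [qstep, mul_sub, sub_mul, mul_smul_comm, smul_mul_assoc, smul_sub, mul_assoc]
    subst hP
    rw [ha]
    match_scalars
    all_goals
      field_simp
      try ring
  rw [key, smul_zero]

end RankTwo

end TwoParam

/-! ### The reflection of a multiparameter quantum group. -/

namespace TwoParam

section Reflection

variable {K ι : Type*} [Field K] {p : ι → ι → K} {lam : ι → K} {m : ι → ι → ℕ}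
  {A : Type*} [Ring A] [Algebra K A]

theorem PreQG.qstep_lower_zero (q : PreQG p lam A) (hp : ∀ i j, p i j ≠ 0) {i j : ι} (hij : i ≠ j) :
    qstep (((q.v i)⁻¹ : Aˣ) * q.f i : A) (p i j) (q.e j) = 0 := by
  have h : QComm (p i j) (((q.v i)⁻¹ : Aˣ) : A) (q.e j) :=
    ((q.v_e j i).units_inv (inv_ne_zero (hp _ _))).of_eq (inv_inv _)
  unfold QComm at h
  rw [qstep, ← mul_assoc (q.e j), ← smul_mul_assoc, ← h, mul_assoc, mul_assoc,
    q.e_f_ne j i hij.symm, sub_self]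

/-- The factor `v_i⁻¹` cancels the `v i` produced by `es_f_self`. Skew commutators with `v_i⁻¹ f_i`,
the reflected `e i` up to a scalar, hence run down the strings. -/
theorem PreQG.qstep_lower_succ (q : PreQG p lam A) (hp : ∀ i j, p i j ≠ 0) {i j : ι} (hij : i ≠ j)
    {M : ℕ} (hM : p i j * p j i * p i i ^ M = 1) (k : ℕ) :
    qstep (((q.v i)⁻¹ : Aˣ) * q.f i : A) (p i j * p i i ^ (k + 1)) (q.es i j (k + 1)) =
      (-PreQG.loc p lam i j M k * (p i j * p i i ^ k)) • q.es i j k := by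
  have hv : ∀ k, QComm (p i j * p i i ^ k) (((q.v i)⁻¹ : Aˣ) : A) (q.es i j k) := fun k =>
    ((q.v_es i j i k).units_inv (mul_ne_zero (pow_ne_zero _ (inv_ne_zero (hp _ _)))
      (inv_ne_zero (hp _ _)))).of_eq (by simp)
  have h1 := hv (k + 1)
  have h2 := hv k
  unfold QComm at h1 h2
  have h3 := q.es_f_self hp i j hij M hM k
  rw [qstep, ← mul_assoc (q.es i j (k + 1)), ← smul_mul_assoc, ← h1, mul_assoc, mul_assoc, ← mul_sub,
    ← neg_sub, h3, mul_neg, mul_smul_comm, ← mul_assoc, h2, smul_mul_assoc, mul_assoc, Units.inv_mul,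
    mul_one, smul_smul, neg_mul, neg_smul]

/-- The product of the structure constants met when lowering the upper end of a string. -/
def lowc (p : ι → ι → K) (lam : ι → K) (i j : ι) (M n : ℕ) : K :=
  ∏ t ∈ Finset.range n, (-PreQG.loc p lam i j M (M - (t + 1)) * (p i j * p i i ^ (M - (t + 1))))

theorem PreQG.qad_lower (q : PreQG p lam A) (hp : ∀ i j, p i j ≠ 0) {i j : ι} (hij : i ≠ j)
    {M : ℕ} (hM : p i j * p j i * p i i ^ M = 1) (n : ℕ) (hn : n ≤ M) :
    qad (((q.v i)⁻¹ : Aˣ) * q.f i : A) (p i j * p i i ^ M) (p i i)⁻¹ (q.es i j M) n =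
      lowc p lam i j M n • q.es i j (M - n) := by
  induction n with
  | zero => simp [lowc]
  | succ n ih =>
    have e : M - n = M - (n + 1) + 1 := by omega
    have e' : p i j * p i i ^ M * (p i i)⁻¹ ^ n = p i j * p i i ^ (M - n) := by
      rw [mul_assoc, inv_pow, ← pow_sub₀ _ (hp _ _) (by omega)]
    rw [qad_succ, ih (by omega), qstep_smul, e', e, q.qstep_lower_succ hp hij hM, smul_smul]
    simp only [lowc, Finset.prod_range_succ]

/-- The assumptions under which the reflection at `i` is defined. -/
structure ReflData (p : ι → ι → K) (m : ι → ι → ℕ) (i : ι) : Prop where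
  p_ne : ∀ a b, p a b ≠ 0
  cart : ∀ a b, a ≠ b → p a b * p b a * p a a ^ m a b = 1
  rank_two : ∀ j, i ≠ j → (m i j = 0 ∧ m j i = 0) ∨ (m i j = 1 ∧ m j i = 1) ∨
    (m i j = 2 ∧ m j i = 1 ∧ 1 + p i i ≠ 0) ∨ (m i j = 1 ∧ m j i = 2)
  -- The right side is the bicharacter `p` at the reflected roots `α_j + m i j α_i` and `α_k + m i k
  -- α_i`; it has to be the transposed entry.
  inv : ∀ j k, i ≠ j → i ≠ k → j ≠ k →
    p k j = p j k * p j i ^ m i k * p i k ^ m i j * p i i ^ (m i j * m i k)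
  -- The bound is the length of the `i`-string through the Serre element of `j` and `k`.
  num : ∀ j k, i ≠ j → i ≠ k → j ≠ k → ∀ t, 0 < t → t ≤ (m j k + 1) * m i j + m i k →
    qnum (p i i) t ≠ 0

theorem ReflData.dual {i : ι} (h : ReflData p m i) : ReflData (fun a b => p b a) m i where
  p_ne a b := h.p_ne b a
  cart a b hab := by rw [← h.cart a b hab]; ring
  rank_two := h.rank_two
  inv j k hj hk hjk := by
    rw [h.inv k j hk hj hjk.symm]
    ring
  num := h.num

namespace PreQG

theorem commute_w_w (q : PreQG p lam A) (i j : ι) : Commute (q.w i) (q.w j) := q.w_w i j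

theorem commute_w_v (q : PreQG p lam A) (i j : ι) : Commute (q.w i) (q.v j) := q.w_v i j

variable [DecidableEq ι]

/-- The images of the generators `e`. -/
def reflE (q : PreQG p lam A) (m : ι → ι → ℕ) (i : ι) (c : ι → K) (j : ι) : A :=
  if j = i then c i • (((q.v i)⁻¹ : Aˣ) * q.f i : A) else c j • q.es i j (m i j)

/-- The images of the units `w`. -/
def reflW (q : PreQG p lam A) (m : ι → ι → ℕ) (i : ι) (j : ι) : Aˣ :=
  if j = i then (q.w i)⁻¹ else q.w j * q.w i ^ m i j

variable (q : PreQG p lam A)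

theorem reflE_self (i : ι) (c : ι → K) :
    q.reflE m i c i = c i • (((q.v i)⁻¹ : Aˣ) * q.f i : A) := if_pos rfl

theorem reflE_of_ne {i j : ι} (h : i ≠ j) (c : ι → K) :
    q.reflE m i c j = c j • q.es i j (m i j) := if_neg h.symm

theorem reflW_self (i : ι) : q.reflW m i i = (q.w i)⁻¹ := if_pos rfl

theorem reflW_of_ne {i j : ι} (h : i ≠ j) : q.reflW m i j = q.w j * q.w i ^ m i j := if_neg h.symm

theorem commute_reflW (i j k : ι) : Commute (q.reflW m i j) (q.reflW m i k) := by
  unfold reflW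
  split_ifs
  · exact .refl _
  · exact ((q.commute_w_w i k).mul_right ((q.commute_w_w i i).pow_right _)).inv_left
  · exact ((q.commute_w_w j i).mul_left ((q.commute_w_w i i).pow_left _)).inv_right
  · exact ((q.commute_w_w j k).mul_right ((q.commute_w_w j i).pow_right _)).mul_left
      (((q.commute_w_w i k).mul_right ((q.commute_w_w i i).pow_right _)).pow_left _)

theorem commute_reflW_dual (i j k : ι) : Commute (q.reflW m i j) (q.dual.reflW m i k) := by
  have h : ∀ i j, Commute (q.w i) (q.dual.w j) := q.commute_w_v
  unfold reflW
  split_ifs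
  · exact (h i i).inv_inv
  · exact ((h i k).mul_right ((h i i).pow_right _)).inv_left
  · exact ((h j i).mul_left ((h i i).pow_left _)).inv_right
  · exact ((h j k).mul_right ((h j i).pow_right _)).mul_left
      (((h i k).mul_right ((h i i).pow_right _)).pow_left _)

theorem qcomm_mul_pow {a b c : K} {u u' : Aˣ} {y : A} {n : ℕ} (h : QComm a (u : A) y)
    (h' : QComm b (u' : A) y) (hc : a * b ^ n = c) : QComm c ((u * u' ^ n : Aˣ) : A) y := by
  rw [Units.val_mul, Units.val_pow_eq_pow_val, ← hc]
  exact h.mul_left (h'.pow_left n)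

theorem qcomm_units_inv_mul {a : K} {u u' : Aˣ} {y : A} (h : Commute u u')
    (h' : QComm a (u : A) y) : QComm a (u : A) (((u'⁻¹ : Aˣ) : A) * y) := by
  have h1 : QComm (1 : K) (u : A) ((u'⁻¹ : Aˣ) : A) := by
    apply QComm.of_commute
    rw [← Units.val_mul, ← Units.val_mul, h.inv_right.eq]
  exact (h1.mul_right h').of_eq (one_mul a)

variable {q}

/-- The eigenvalue is the transposed entry `p l j`. If `j` or `l` is `i`, or if `j = l`, this
follows from `cart`; only three distinct nodes require `inv`. -/
theorem reflW_reflE {i : ι} (h : ReflData p m i) (c : ι → K) (j l : ι) :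
    QComm (p l j) (q.reflW m i l : A) (q.reflE m i c j) := by
  have hp := h.p_ne
  have hvf : ∀ l, QComm (p i l)⁻¹ (q.w l : A) (((q.v i)⁻¹ : Aˣ) * q.f i : A) := fun l =>
    qcomm_units_inv_mul (q.w_v l i) (q.w_f i l)
  rcases eq_or_ne i l with rfl | hl <;> rcases eq_or_ne i j with rfl | hj
  · rw [reflW_self, reflE_self]
    exact (((hvf i).units_inv (inv_ne_zero (hp _ _))).of_eq (inv_inv _)).smul_right _
  · rw [reflW_self, reflE_of_ne _ hj]
    refine (((q.w_es i j i (m i j)).units_inv (mul_ne_zero (pow_ne_zero _ (hp _ _)) (hp _ _))).of_eq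
      ?_).smul_right _
    apply inv_eq_of_mul_eq_one_right
    rw [← h.cart i j hj]; ring
  · rw [reflW_of_ne _ hl, reflE_self]
    refine (qcomm_mul_pow (hvf l) (hvf i) ?_).smul_right _
    have := h.cart i l hl
    have h1 := hp i l
    have h2 := hp i i
    rw [inv_pow]
    field_simp
    rw [← this]
    ring
  · rw [reflW_of_ne _ hl, reflE_of_ne _ hj]
    refine (qcomm_mul_pow (q.w_es i j l _) (q.w_es i j i _) ?_).smul_right _
    rcases eq_or_ne j l with rfl | hjl
    · calc _ = p j j * (p i j * p j i * p i i ^ m i j) ^ m i j := by ring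
        _ = _ := by rw [h.cart i j hj]; simp
    · rw [h.inv j l hj hl hjl]
      ring

theorem reflV_reflE {i : ι} (h : ReflData p m i) (c : ι → K) (j l : ι) :
    QComm (p j l)⁻¹ (q.dual.reflW m i l : A) (q.reflE m i c j) := by
  have hp := h.p_ne
  have hvf : ∀ l, QComm (p l i) (q.dual.w l : A) (((q.v i)⁻¹ : Aˣ) * q.f i : A) := fun l =>
    qcomm_units_inv_mul (q.v_v l i) (q.v_f i l)
  rcases eq_or_ne i l with rfl | hl <;> rcases eq_or_ne i j with rfl | hj
  · rw [reflW_self, reflE_self]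
    exact ((hvf i).units_inv (hp _ _)).smul_right _
  · rw [reflW_self, reflE_of_ne _ hj]
    refine (((q.v_es i j i (m i j)).units_inv (mul_ne_zero (pow_ne_zero _ (inv_ne_zero (hp _ _)))
      (inv_ne_zero (hp _ _)))).of_eq ?_).smul_right _
    have := h.cart i j hj
    rw [mul_inv, inv_pow, inv_inv, inv_inv]
    apply eq_inv_of_mul_eq_one_left
    rw [← this]; ring
  · rw [reflW_of_ne _ hl, reflE_self]
    refine (qcomm_mul_pow (hvf l) (hvf i) ?_).smul_right _
    apply eq_inv_of_mul_eq_one_left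
    rw [← h.cart i l hl]; ring
  · rw [reflW_of_ne _ hl, reflE_of_ne _ hj]
    refine (qcomm_mul_pow (q.v_es i j l _) (q.v_es i j i _) ?_).smul_right _
    rcases eq_or_ne j l with rfl | hjl
    · calc _ = (p j j)⁻¹ * ((p i j * p j i * p i i ^ m i j) ^ m i j)⁻¹ := by
            simp only [inv_pow, mul_inv, mul_pow]; ring
        _ = _ := by rw [h.cart i j hj]; simp
    · rw [h.inv l j hl hj hjl.symm]
      simp only [inv_pow, mul_inv, mul_pow]
      ring

/-- For `j = i` the factor `c i * d i = p i i` offsets the cost of gathering the two inverse torus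
elements on the left. For `j ≠ i` it is `es_fs_self`, and `hj` is the normalization that restores
`lam j`. -/
theorem reflE_reflF_self {i : ι} (h : ReflData p m i) {c d : ι → K}
    (hi : c i * d i = p i i) (hj : ∀ j, i ≠ j → c j * d j * kap p lam i j (m i j) = lam j) (j : ι) :
    q.reflE m i c j * q.dual.reflE m i d j - q.dual.reflE m i d j * q.reflE m i c j =
      lam j • ((q.reflW m i j : A) - q.dual.reflW m i j) := by
  have hp := h.p_ne
  rcases eq_or_ne i j with rfl | hij
  · rw [reflE_self, reflE_self, reflW_self, reflW_self]
    change (c i • (((q.v i)⁻¹ : Aˣ) * q.f i : A)) * (d i • (((q.w i)⁻¹ : Aˣ) * q.e i : A)) -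
      (d i • (((q.w i)⁻¹ : Aˣ) * q.e i : A)) * (c i • (((q.v i)⁻¹ : Aˣ) * q.f i : A)) =
      lam i • ((((q.w i)⁻¹ : Aˣ) : A) - ((q.v i)⁻¹ : Aˣ))
    have h1 : (((q.w i)⁻¹ : Aˣ) : A) * q.f i = p i i • (q.f i * ((q.w i)⁻¹ : Aˣ)) :=
      ((q.w_f i i).units_inv (inv_ne_zero (hp _ _))).of_eq (inv_inv _)
    have h2 : (((q.v i)⁻¹ : Aˣ) : A) * q.e i = p i i • (q.e i * ((q.v i)⁻¹ : Aˣ)) :=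
      ((q.v_e i i).units_inv (inv_ne_zero (hp _ _))).of_eq (inv_inv _)
    have h3 : q.f i * (((q.w i)⁻¹ : Aˣ) : A) = (p i i)⁻¹ • ((((q.w i)⁻¹ : Aˣ) : A) * q.f i) := by
      rw [h1, smul_smul, inv_mul_cancel₀ (hp _ _), one_smul]
    have h4 : q.e i * (((q.v i)⁻¹ : Aˣ) : A) = (p i i)⁻¹ • ((((q.v i)⁻¹ : Aˣ) : A) * q.e i) := by
      rw [h2, smul_smul, inv_mul_cancel₀ (hp _ _), one_smul]
    have h5 : (((q.v i)⁻¹ : Aˣ) : A) * ((q.w i)⁻¹ : Aˣ) =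
        (((q.w i)⁻¹ : Aˣ) : A) * ((q.v i)⁻¹ : Aˣ) := by
      rw [← Units.val_mul, ← Units.val_mul, ((q.commute_w_v i i).inv_inv).eq]
    have h6 : q.e i * q.f i = q.f i * q.e i + lam i • ((q.w i : A) - q.v i) := by
      rw [← q.e_f i]; abel
    have h7 : (((q.w i)⁻¹ : Aˣ) : A) * ((q.v i)⁻¹ : Aˣ) * ((q.w i : A) - q.v i) =
        (((q.v i)⁻¹ : Aˣ) : A) - ((q.w i)⁻¹ : Aˣ) := by
      rw [mul_sub, ← h5, mul_assoc, Units.inv_mul, mul_one, h5, mul_assoc, Units.inv_mul, mul_one]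
    calc _ = (c i * d i * (p i i)⁻¹) • ((((q.w i)⁻¹ : Aˣ) : A) * ((q.v i)⁻¹ : Aˣ) *
          (q.f i * q.e i - q.e i * q.f i)) := by
          simp only [smul_mul_assoc, mul_smul_comm]
          rw [mul_assoc _ (q.f i), ← mul_assoc (q.f i), h3, mul_assoc _ (q.e i), ← mul_assoc (q.e i),
            h4]
          simp only [smul_mul_assoc, mul_smul_comm, mul_sub, ← mul_assoc, h5]
          module
      _ = _ := by
          rw [hi, mul_inv_cancel₀ (hp _ _), one_smul, ← neg_sub (q.e i * q.f i), q.e_f i, mul_neg,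
            mul_smul_comm, h7, ← smul_neg, neg_sub]
  · rw [reflE_of_ne _ hij, reflE_of_ne _ hij, reflW_of_ne _ hij, reflW_of_ne _ hij]
    have hm2 : m i j ≤ 2 := by rcases h.rank_two j hij with h | h | h | h <;> omega
    have key := q.es_fs_self hp hij (m i j) (h.cart i j hij) hm2
    rw [dual_es, smul_mul_smul_comm, smul_mul_smul_comm, mul_comm (d j), ← smul_sub, key, smul_smul,
      hj j hij]
    rfl

/-- If one index is `i`, the Serre relation says that `e i` skew commutes with the top of a string,
and `w_i⁻¹` absorbs the scalar. Otherwise `es_fs_comm` applies. -/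
theorem reflE_reflF_of_ne {i : ι} (h : ReflData p m i)
    (hs : ∀ j, i ≠ j → qad (q.e i) (p j i) (p i i) (q.e j) (m i j + 1) = 0)
    (hs' : ∀ j, i ≠ j → qad (q.f i) (p i j) (p i i) (q.f j) (m i j + 1) = 0)
    (c d : ι → K) (j k : ι) (hjk : j ≠ k) :
    q.reflE m i c j * q.dual.reflE m i d k = q.dual.reflE m i d k * q.reflE m i c j := by
  have hp := h.p_ne
  have aux : ∀ {p : ι → ι → K} (q : PreQG p lam A) (_ : ReflData p m i)
      (_ : ∀ j, i ≠ j → qad (q.e i) (p j i) (p i i) (q.e j) (m i j + 1) = 0) (k : ι) (_ : i ≠ k),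
      (((q.w i)⁻¹ : Aˣ) * q.e i : A) * q.es i k (m i k) =
        q.es i k (m i k) * (((q.w i)⁻¹ : Aˣ) * q.e i : A) := by
    intro p q h hs k hk
    have hp := h.p_ne
    have h1 : QComm (p i i ^ m i k * p k i)⁻¹ (((q.w i)⁻¹ : Aˣ) : A) (q.es i k (m i k)) :=
      (q.w_es i k i _).units_inv (mul_ne_zero (pow_ne_zero _ (hp _ _)) (hp _ _))
    have h2 : q.es i k (m i k) * (((q.w i)⁻¹ : Aˣ) : A) =
        (p k i * p i i ^ m i k) • ((((q.w i)⁻¹ : Aˣ) : A) * q.es i k (m i k)) := by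
      rw [h1, smul_smul, mul_comm (p k i), mul_inv_cancel₀
        (mul_ne_zero (pow_ne_zero _ (hp _ _)) (hp _ _)), one_smul]
    have h3 := hs k hk
    change q.es i k (m i k + 1) = 0 at h3
    rw [es_succ, sub_eq_zero] at h3
    rw [← mul_assoc (q.es i k _), h2, mul_assoc, h3]
    simp only [mul_smul_comm, smul_mul_assoc, mul_assoc]
  rcases eq_or_ne i j with rfl | hj <;> rcases eq_or_ne i k with rfl | hk
  · exact absurd rfl hjk
  · rw [reflE_self, reflE_of_ne _ hk]
    have := aux q.dual h.dual hs' k hk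
    rw [smul_mul_smul_comm, smul_mul_smul_comm, mul_comm (c i)]
    exact congrArg _ this
  · rw [reflE_self, reflE_of_ne _ hj]
    have := aux q h hs j hj
    rw [smul_mul_smul_comm, smul_mul_smul_comm, mul_comm (c j)]
    exact congrArg _ this.symm
  · rw [reflE_of_ne _ hj, reflE_of_ne _ hk, smul_mul_smul_comm, smul_mul_smul_comm, mul_comm (c j),
      dual_es, q.es_fs_comm hp hj hk hjk (m i j) (h.cart i j hj)]

/-- For `j = i` the relation says that lowering the top of a string `m i k + 1` times gives zero.
For `k = i` it is a rank two statement about the two upper members of the string. For `j, k ≠ i` it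
is `serre_top`. -/
theorem serre_reflE {i : ι} (h : ReflData p m i)
    (hs : ∀ j k, j ≠ k → qad (q.e j) (p k j) (p j j) (q.e k) (m j k + 1) = 0)
    (c : ι → K) (j k : ι) (hjk : j ≠ k) :
    qad (q.reflE m i c j) (p j k) (p j j) (q.reflE m i c k) (m j k + 1) = 0 := by
  have hp := h.p_ne
  rcases eq_or_ne i j with rfl | hj <;> rcases eq_or_ne i k with rfl | hk
  · exact absurd rfl hjk
  · rw [reflE_self, reflE_of_ne _ hk, smul_qad, qad_smul, ← qad_reverse _ _ _ (hp _ _), qad_succ,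
      q.qad_lower hp hk (h.cart i k hk) _ le_rfl, qstep_smul, Nat.sub_self, es_zero, mul_assoc,
      inv_pow, mul_inv_cancel₀ (pow_ne_zero _ (hp _ _)), mul_one, q.qstep_lower_zero hp hk]
    simp
  · rw [reflE_self, reflE_of_ne _ hj, smul_qad, qad_smul]
    suffices hh : qad (q.es i j (m i j)) (p j i) (p j j) (((q.v i)⁻¹ : Aˣ) * q.f i : A) (m j i + 1)
        = 0 by rw [hh]; simp
    have hc := h.cart i j hj
    have hc' := h.cart j i hj.symm
    -- The ratio `p j i` is the cost of moving `v_i⁻¹` past the top of the string, so the first skew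
    -- commutator becomes an ordinary commutator with `f i`, which gives the member just below the
    -- top.
    have e1 : qstep (q.es i j (m i j)) (p j i) (((q.v i)⁻¹ : Aˣ) * q.f i : A) =
        p j i • ((((q.v i)⁻¹ : Aˣ) : A) *
          (q.es i j (m i j) * q.f i - q.f i * q.es i j (m i j))) := by
      have h1 : QComm (p j i)⁻¹ (((q.v i)⁻¹ : Aˣ) : A) (q.es i j (m i j)) := by
        refine ((q.v_es i j i (m i j)).units_inv (mul_ne_zero (pow_ne_zero _ (inv_ne_zero (hp _ _)))
          (inv_ne_zero (hp _ _)))).of_eq ?_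
        rw [mul_inv, inv_pow, inv_inv, inv_inv]
        apply eq_inv_of_mul_eq_one_left
        rw [← hc]; ring
      have h2 : q.es i j (m i j) * (((q.v i)⁻¹ : Aˣ) : A) =
          p j i • ((((q.v i)⁻¹ : Aˣ) : A) * q.es i j (m i j)) := by
        rw [h1, smul_smul, mul_inv_cancel₀ (hp _ _), one_smul]
      rw [qstep, ← mul_assoc, h2]
      simp only [smul_mul_assoc, mul_sub, mul_assoc, smul_sub]
    rw [qad_succ', e1]
    rcases Nat.eq_zero_or_pos (m i j) with h0 | h0
    · rw [h0, es_zero, q.e_f_ne j i hj.symm]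
      simp
    · obtain ⟨M, hM⟩ := Nat.exists_eq_succ_of_ne_zero h0.ne'
      have e2 : ∃ g : K, p j i • ((((q.v i)⁻¹ : Aˣ) : A) *
          (q.es i j (m i j) * q.f i - q.f i * q.es i j (m i j))) = g • q.es i j M := by
        have h2 : QComm (((p i i)⁻¹ ^ M * (p i j)⁻¹)⁻¹) (((q.v i)⁻¹ : Aˣ) : A) (q.es i j M) :=
          (q.v_es i j i M).units_inv (mul_ne_zero (pow_ne_zero _ (inv_ne_zero (hp _ _)))
            (inv_ne_zero (hp _ _)))
        unfold QComm at h2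
        rw [hM, q.es_f_self hp i j hj (m i j) hc M, mul_smul_comm, ← mul_assoc, h2, smul_mul_assoc,
          mul_assoc, Units.inv_mul, mul_one, smul_smul, smul_smul]
        exact ⟨_, rfl⟩
      obtain ⟨g, hg⟩ := e2
      rw [hg, qad_smul]
      suffices hh : qad (q.es i j (m i j)) (p j i * p j j) (p j j) (q.es i j M) (m j i) = 0 by
        rw [hh, smul_zero]
      have hs1 := hs i j hj
      have hs2 := hs j i hj.symm
      rcases h.rank_two j hj with ⟨h1, -⟩ | ⟨h1, h2⟩ | ⟨h1, h2, h3⟩ | ⟨h1, h2⟩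
      · omega
      · obtain rfl : M = 0 := by omega
        rw [h1] at hc hs1 ⊢
        rw [h2] at hc' hs2 ⊢
        have := serre_end_one_one (x := q.e i) (y := q.e j) (a := p i j) (b := p j i) (P := p j j)
          (by rw [← hc']; ring) (hp _ _) hs2
        simpa [qad_succ, es] using this
      · obtain rfl : M = 1 := by omega
        rw [h1] at hc hs1 ⊢
        rw [h2] at hc' hs2 ⊢
        have := serre_end_two_one (x := q.e i) (y := q.e j) (a := p i j) (b := p j i) (P := p j j)
          (Q := p i i) (by rw [← hc']; ring) (by
            have h4 : p j i * p i j ≠ 0 := mul_ne_zero (hp _ _) (hp _ _)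
            apply mul_left_cancel₀ h4
            rw [← pow_one (p j j), hc', ← hc]; ring) (hp _ _) h3 hs2 hs1
        rw [qad_succ, qad_zero]
        simpa [es] using this
      · obtain rfl : M = 0 := by omega
        rw [h1] at hc hs1 ⊢
        rw [h2] at hc' hs2 ⊢
        exact serre_end_one_two (x := q.e i) (y := q.e j) (a := p i j) (b := p j i) (P := p j j)
          (Q := p i i) (by rw [← hc]; ring) (by
            have h4 : p j i * p i j ≠ 0 := mul_ne_zero (hp _ _) (hp _ _)
            apply mul_left_cancel₀ h4
            rw [hc', ← hc]; ring) (hp _ _) hs2 hs1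
  · rw [reflE_of_ne _ hj, reflE_of_ne _ hk, smul_qad, qad_smul]
    have := serre_top (x := q.e i) (hp j i) (hs i j hj) (hs i k hk) (hs j k hjk)
      (h.num j k hj hk hjk)
    -- The ratio delivered by `serre_top` is the transposed parameter; this is again the invariance
    -- of the bicharacter.
    have e : p k j * p k i ^ m i j * (p j i)⁻¹ ^ m i k = p j k := by
      rw [h.inv j k hj hk hjk]
      have hc : p i j * p j i * p i i ^ m i j = 1 := h.cart i j hj
      have hck : p i k * p k i * p i i ^ m i k = 1 := h.cart i k hk
      have h1 := hp j i
      rw [inv_pow]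
      field_simp
      calc _ = p j k * (p i k * p k i * p i i ^ m i k) ^ m i j := by ring
        _ = _ := by rw [hck]; simp
    rw [e] at this
    change c j ^ _ • c k • qad (qad (q.e i) _ _ (q.e j) _) _ _ (qad (q.e i) _ _ (q.e k) _) _ = 0
    rw [this]
    simp

end PreQG

variable [DecidableEq ι]

/-- The reflection of a multiparameter quantum group. -/
def QG.refl (q : QG p lam m A) {i : ι} (h : ReflData p m i) {c d : ι → K}
    (hi : c i * d i = p i i) (hj : ∀ j, i ≠ j → c j * d j * PreQG.kap p lam i j (m i j) = lam j) :
    QG (fun i j => p j i) lam m A where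
  e := q.toPreQG.reflE m i c
  f := q.toPreQG.dual.reflE m i d
  w := q.toPreQG.reflW m i
  v := q.toPreQG.dual.reflW m i
  w_w j k := q.toPreQG.commute_reflW i j k
  w_v j k := q.toPreQG.commute_reflW_dual i j k
  v_v j k := q.toPreQG.dual.commute_reflW i j k
  w_e j l := PreQG.reflW_reflE h c j l
  w_f j l := PreQG.reflV_reflE (q := q.toPreQG.dual) h.dual d j l
  v_e j l := PreQG.reflV_reflE h c j l
  v_f j l := PreQG.reflW_reflE (q := q.toPreQG.dual) h.dual d j l
  e_f j := PreQG.reflE_reflF_self h hi hj j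
  e_f_ne j k hjk := PreQG.reflE_reflF_of_ne h (fun j => q.serre_e i j) (fun j => q.serre_f i j)
    c d j k hjk
  serre_e j k hjk := PreQG.serre_reflE h q.serre_e c j k hjk
  serre_f j k hjk := PreQG.serre_reflE (q := q.toPreQG.dual) h.dual q.serre_f d j k hjk

end Reflection

end TwoParam

/-! ### Root data of classical type and the structure constants. -/

namespace TwoParam

section RootData

variable {X : ClassicalType} {n : ℕ}

/-- The non-negative integers `- a i j`, for `i ≠ j`. -/
def cartanNat (X : ClassicalType) (n i j : ℕ) : ℕ :=
  match X with
  | .A => if i + 1 = j ∨ j + 1 = i then 1 else 0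
  | .B => if i + 1 = j then 1 else if j + 1 = i then (if i + 1 = n then 2 else 1) else 0
  | .C => if i + 1 = j then (if j + 1 = n then 2 else 1) else if j + 1 = i then 1 else 0
  | .D => if (i + 1 = j ∧ j + 1 < n) ∨ (j + 1 = i ∧ i + 1 < n) ∨ (i + 2 = j ∧ j + 1 = n) ∨
      (j + 2 = i ∧ i + 1 = n) then 1 else 0

theorem cartan_eq_of_ne {i j : Fin n} (h : i ≠ j) : cartan X n i j = -(cartanNat X n i j : ℤ) := by
  obtain ⟨i, hi⟩ := i
  obtain ⟨j, hj⟩ := j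
  have h' : i ≠ j := fun e => h (Fin.ext e)
  cases X <;> simp only [cartanNat, cartan, CartanMatrix.A, CartanMatrix.B, CartanMatrix.C,
    CartanMatrix.D, Matrix.transpose_apply, Matrix.of_apply, Fin.ext_iff] <;> split_ifs <;>
    first | rfl | omega

theorem cartan_self (i : Fin n) : cartan X n i i = 2 := by
  cases X <;> simp [cartan, CartanMatrix.A, CartanMatrix.B, CartanMatrix.C,
    CartanMatrix.D]

theorem cartanNat_pair {i j : ℕ} (hi : i < n) (hj : j < n) :
    (cartanNat X n i j = 0 ∧ cartanNat X n j i = 0) ∨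
    (cartanNat X n i j = 1 ∧ cartanNat X n j i = 1 ∧ sym X n i = sym X n j) ∨
    (cartanNat X n i j = 2 ∧ cartanNat X n j i = 1 ∧ sym X n i = 1 ∧ sym X n j = 2) ∨
    (cartanNat X n i j = 1 ∧ cartanNat X n j i = 2 ∧ sym X n i = 2 ∧ sym X n j = 1) := by
  cases X <;> simp only [cartanNat, sym] <;> split_ifs <;> first | omega | simp

/-- `1` for the two end nodes of type `D`, in this order, and `0` otherwise. -/
def endNat (X : ClassicalType) (n i j : ℕ) : ℕ :=
  match X with
  | .D => if i + 2 = n ∧ j + 1 = n then 1 else 0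
  | _ => 0

theorem pairExp_self {i : ℕ} (hi : i < n) (hn : 2 ≤ n) :
    pairExp X n i i = ((sym X n i : ℤ), -(sym X n i : ℤ)) := by
  cases X <;> simp only [pairExp, rootCoord, sym,
    apply_ite Prod.fst, apply_ite Prod.snd, Prod.ext_iff] <;> constructor <;> split_ifs <;>
    first | omega | simp_all

/-- One formula for all types: below the diagonal a power of `s_i`, above it an inverse power of
`r_j`, with a correction by `rs` at the two end nodes of type `D`. With it, later arguments seldom
have to distinguish types. -/
theorem pairExp_of_lt (hD : X = .D → 3 ≤ n) {i j : ℕ} (hj : j < n) (h : i < j) :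
    pairExp X n j i =
      ((endNat X n i j : ℤ), ((sym X n i * cartanNat X n i j + endNat X n i j : ℕ) : ℤ)) ∧
    pairExp X n i j =
      (-((sym X n j * cartanNat X n j i + endNat X n i j : ℕ) : ℤ), -(endNat X n i j : ℤ)) := by
  have hD' : X = .D → 3 ≤ n := hD
  cases X <;> simp only [pairExp, rootCoord, sym, cartanNat, endNat, Prod.ext_iff,
    apply_ite Prod.fst, apply_ite Prod.snd] <;>
    simp only [reduceCtorEq, true_imp_iff, false_imp_iff] at hD' <;>
    refine ⟨⟨?_, ?_⟩, ?_, ?_⟩ <;> split_ifs <;> omega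

variable {K : Type*} [Field K] {r s : K}

theorem pair_self (hn : 2 ≤ n) (i : Fin n) :
    pair X n r s i i = r ^ sym X n i * (s ^ sym X n i)⁻¹ := by
  rw [pair, pairExp_self i.2 hn, zpow_neg, zpow_natCast, zpow_natCast]

theorem pair_lower (hD : X = .D → 3 ≤ n) {i j : Fin n} (h : i < j) :
    pair X n r s j i = (s ^ sym X n i) ^ cartanNat X n i j * (r * s) ^ endNat X n i j := by
  rw [pair, (pairExp_of_lt hD j.2 h).1, zpow_natCast, zpow_natCast]
  ring

theorem pair_upper (hD : X = .D → 3 ≤ n) {i j : Fin n} (h : i < j) :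
    pair X n r s i j = ((r ^ sym X n j) ^ cartanNat X n j i * (r * s) ^ endNat X n i j)⁻¹ := by
  rw [pair, (pairExp_of_lt hD j.2 h).2, zpow_neg, zpow_natCast, zpow_neg, zpow_natCast, ← mul_inv]
  congr 1
  ring

theorem pair_ne_zero (hr : r ≠ 0) (hs : s ≠ 0) (i j : Fin n) : pair X n r s i j ≠ 0 :=
  mul_ne_zero (zpow_ne_zero _ hr) (zpow_ne_zero _ hs)

theorem sym_mul_cartanNat {i j : ℕ} (hi : i < n) (hj : j < n) :
    sym X n i * cartanNat X n i j = sym X n j * cartanNat X n j i := by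
  rcases cartanNat_pair (X := X) hi hj with h | h | h | h <;> simp [h]

theorem endNat_eq_zero {i j : ℕ} (h : cartanNat X n i j ≠ 0) : endNat X n i j = 0 := by
  cases X <;> simp only [cartanNat, endNat] at * <;> split_ifs at * <;> omega

theorem commCoeff_eq (i j : Fin n) : commCoeff X n r s i j = (r * s) ^ endNat X n i j := by
  cases X <;> simp only [commCoeff, endNat] <;> (try split_ifs) <;> simp

theorem pair_cartan (hr : r ≠ 0) (hs : s ≠ 0) (hn : 2 ≤ n) (hD : X = .D → 3 ≤ n) {i j : Fin n}
    (h : i ≠ j) : pair X n r s i j * pair X n r s j i * pair X n r s i i ^ cartanNat X n i j = 1 := by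
  have e : (r ^ sym X n j) ^ cartanNat X n j i = (r ^ sym X n i) ^ cartanNat X n i j := by
    rw [← pow_mul, ← pow_mul, sym_mul_cartanNat j.2 i.2]
  have e' : (s ^ sym X n j) ^ cartanNat X n j i = (s ^ sym X n i) ^ cartanNat X n i j := by
    rw [← pow_mul, ← pow_mul, sym_mul_cartanNat j.2 i.2]
  have h1 := pow_ne_zero (endNat X n i j) (mul_ne_zero hr hs)
  have h2 := pow_ne_zero (endNat X n j i) (mul_ne_zero hr hs)
  have h3 := pow_ne_zero (cartanNat X n i j) (pow_ne_zero (sym X n i) hr)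
  have h4 := pow_ne_zero (cartanNat X n i j) (pow_ne_zero (sym X n i) hs)
  rw [pair_self hn, mul_pow, inv_pow]
  rcases lt_or_gt_of_ne h with h | h
  · rw [pair_lower hD h, pair_upper hD h, e]
    generalize (r ^ sym X n i) ^ cartanNat X n i j = x at *
    generalize (s ^ sym X n i) ^ cartanNat X n i j = y at *
    generalize (r * s) ^ endNat X n i j = z at *
    field_simp
  · rw [pair_lower hD h, pair_upper hD h, e']
    generalize (r ^ sym X n i) ^ cartanNat X n i j = x at *
    generalize (s ^ sym X n i) ^ cartanNat X n i j = y at *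
    generalize (r * s) ^ endNat X n j i = z at *
    field_simp

/-- Since `d_i a_ij = d_j a_ji`, inverting and exchanging `r` and `s` interchanges the formulas
above and below the diagonal. So the associated quantum group is the one with transposed parameters.
-/
theorem pair_swap (hr : r ≠ 0) (hs : s ≠ 0) (hn : 2 ≤ n) (hD : X = .D → 3 ≤ n) (i j : Fin n) :
    pair X n s⁻¹ r⁻¹ i j = pair X n r s j i := by
  have hr' := inv_ne_zero hr
  have hs' := inv_ne_zero hs
  have hrs : s⁻¹ * r⁻¹ = (r * s)⁻¹ := by rw [mul_inv, mul_comm]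
  rcases lt_trichotomy i j with h | rfl | h
  · rw [pair_upper hD h, pair_lower hD h, hrs]
    simp only [mul_pow, inv_pow, mul_inv, inv_inv]
    rw [← pow_mul, ← pow_mul, sym_mul_cartanNat j.2 i.2]
  · rw [pair_self hn, pair_self hn]
    simp only [inv_pow, inv_inv]
    ring
  · rw [pair_upper hD h, pair_lower hD h, hrs]
    simp only [mul_pow, inv_pow, mul_inv]
    rw [← pow_mul, ← pow_mul, sym_mul_cartanNat j.2 i.2]

theorem map_pair {σ : K →+* K} (r s : K) (i j : Fin n) :
    σ (pair X n r s i j) = pair X n (σ r) (σ s) i j := by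
  simp [pair, map_zpow₀]

/-- The constants `1 / (r_i - s_i)`. -/
def commScale (X : ClassicalType) (n : ℕ) (r s : K) (i : Fin n) : K :=
  (r ^ sym X n i - s ^ sym X n i)⁻¹

end RootData

end TwoParam

/-! ### Serre polynomials as iterated skew commutators. -/

namespace TwoParam

section Serre

variable {K A : Type*} [Field K] [Ring A] [Algebra K A]

/-- The coefficients are, up to sign, the elementary symmetric functions of the ratios `v ^ M, u v ^
(M - 1), …, u ^ M`. -/
theorem serre_eq_qad (M : ℕ) (hM : M = 1 ∨ M = 2) (u v : K) (hv : v ≠ 0) (x y : A) :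
    serre (-(M : ℤ)) u v x y = qad x (v ^ M) (u * v⁻¹) y (M + 1) := by
  rcases hM with rfl | rfl
  · simp only [serre, qad_succ, qstep, qad_zero, mul_sub, sub_mul, mul_smul_comm, smul_mul_assoc,
      mul_assoc, pow_two, Nat.cast_one]
    norm_num
    match_scalars <;> field_simp
    ring
  · simp only [serre, qad_succ, qstep, qad_zero, mul_sub, sub_mul, mul_smul_comm, smul_mul_assoc,
      mul_assoc, pow_succ, pow_zero, one_mul, Nat.cast_ofNat]
    norm_num
    match_scalars <;> field_simp <;> ring

/-- Reversing the words inverts the ratios; the scalar is, up to sign, the product of the original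
ratios. -/
theorem serreRev_eq_qad (M : ℕ) (hM : M = 1 ∨ M = 2) (u v : K) (hu : u ≠ 0) (hv : v ≠ 0) (x y : A) :
    serreRev (-(M : ℤ)) u v x y =
      (-(-1) ^ M * (u * v) ^ (2 * M - 1)) • qad x (u⁻¹ ^ M) (u * v⁻¹) y (M + 1) := by
  rcases hM with rfl | rfl
  · simp only [serreRev, qad_succ, qstep, qad_zero, mul_sub, sub_mul, mul_smul_comm, smul_mul_assoc,
      mul_assoc, pow_two, Nat.cast_one]
    norm_num
    match_scalars <;> field_simp
    ring
  · simp only [serreRev, qad_succ, qstep, qad_zero, mul_sub, sub_mul, mul_smul_comm, smul_mul_assoc,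
      mul_assoc, pow_succ, pow_zero, one_mul, Nat.cast_ofNat]
    norm_num
    match_scalars <;> field_simp <;> ring

end Serre

end TwoParam

/-! ### Presentation and universal property of `U_{r,s}(𝔤)`. -/

namespace TwoParam

/-- The standing assumptions on the root datum and on the parameters. -/
structure Admissible {K : Type*} [Field K] (X : ClassicalType) (n : ℕ) (r s : K) : Prop where
  r_ne : r ≠ 0
  s_ne : s ≠ 0
  sq_ne : r ^ 2 ≠ s ^ 2
  two_le : 2 ≤ n
  three_le : X = .D → 3 ≤ n

section Relations

variable {K : Type*} [Field K] {X : ClassicalType} {n : ℕ} {r s : K}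

theorem Admissible.swap (h : Admissible X n r s) : Admissible X n s⁻¹ r⁻¹ where
  r_ne := inv_ne_zero h.s_ne
  s_ne := inv_ne_zero h.r_ne
  sq_ne e := h.sq_ne (by rw [inv_pow, inv_pow] at e; exact (inv_injective e).symm)
  two_le := h.two_le
  three_le := h.three_le

theorem Admissible.ne (h : Admissible X n r s) : r ≠ s := fun e => h.sq_ne (by rw [e])

theorem Admissible.add_ne (h : Admissible X n r s) : r + s ≠ 0 := fun e =>
  h.sq_ne (by rw [eq_neg_of_add_eq_zero_left e, neg_sq])

theorem sym_eq (X : ClassicalType) (n i : ℕ) : sym X n i = 1 ∨ sym X n i = 2 := by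
  cases X <;> simp only [sym] <;> (try split_ifs) <;> simp

theorem Admissible.sub_ne (h : Admissible X n r s) (i : ℕ) :
    r ^ sym X n i - s ^ sym X n i ≠ 0 := by
  rw [sub_ne_zero]
  rcases sym_eq X n i with e | e <;> rw [e]
  · simpa using h.ne
  · exact h.sq_ne

theorem Admissible.pair_ne (h : Admissible X n r s) (i j : Fin n) : pair X n r s i j ≠ 0 :=
  pair_ne_zero h.r_ne h.s_ne i j

theorem Admissible.commScale_ne (h : Admissible X n r s) (i : Fin n) : commScale X n r s i ≠ 0 :=
  inv_ne_zero (h.sub_ne i)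

theorem cartanNat_cases (i j : ℕ) (h : cartanNat X n i j ≠ 0) :
    cartanNat X n i j = 1 ∨ cartanNat X n i j = 2 := by
  cases X <;> simp only [cartanNat] at * <;> split_ifs at * <;> simp at *

theorem cartanNat_symm {i j : ℕ} (hi : i < n) (hj : j < n) (h : cartanNat X n i j ≠ 0) :
    cartanNat X n j i ≠ 0 := by
  rcases cartanNat_pair (X := X) hi hj with h | h | h | h <;> omega

theorem cartan_ne_zero_iff {i j : Fin n} (h : i ≠ j) :
    cartan X n i j ≠ 0 ↔ cartanNat X n i j ≠ 0 := by
  rw [cartan_eq_of_ne h]; simp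

theorem pair_lower_of_ne_zero (hD : X = .D → 3 ≤ n) {i j : Fin n} (h : i < j)
    (hm : cartanNat X n i j ≠ 0) : pair X n r s j i = (s ^ sym X n i) ^ cartanNat X n i j := by
  rw [pair_lower hD h, endNat_eq_zero hm, pow_zero, mul_one]

theorem pair_upper_of_ne_zero (hD : X = .D → 3 ≤ n) {i j : Fin n} (h : i < j)
    (hm : cartanNat X n i j ≠ 0) :
    pair X n r s i j = ((r ^ sym X n j) ^ cartanNat X n j i)⁻¹ := by
  rw [pair_upper hD h, endNat_eq_zero hm, pow_zero, mul_one]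

variable {A : Type*} [Ring A] [Algebra K A]

/-- The symmetry allows either end of the list of ratios to come first. In `serre_upper` the first
ratio must be a power of `r_j⁻¹` to match the structure constant. -/
theorem serre_comm (a : ℤ) (u v : K) (x y : A) : serre a u v x y = serre a v u x y := by
  unfold serre
  split_ifs <;> ring_nf

theorem serreRev_comm (a : ℤ) (u v : K) (x y : A) : serreRev a u v x y = serreRev a v u x y := by
  unfold serreRev
  split_ifs <;> ring_nf

theorem serre_lower (H : Admissible X n r s) {i j : Fin n} (h : i < j)
    (hm : cartanNat X n i j ≠ 0) (x y : A) :
    serre (cartan X n i j) (r ^ sym X n i) (s ^ sym X n i) x y =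
      qad x (pair X n r s j i) (pair X n r s i i) y (cartanNat X n i j + 1) := by
  rw [cartan_eq_of_ne h.ne, serre_eq_qad _ (cartanNat_cases _ _ hm) _ _ (pow_ne_zero _ H.s_ne),
    pair_lower_of_ne_zero H.three_le h hm, pair_self H.two_le]

theorem serre_upper (H : Admissible X n r s) {i j : Fin n} (h : i < j)
    (hm : cartanNat X n i j ≠ 0) (x y : A) :
    serre (cartan X n j i) (r ^ sym X n j)⁻¹ (s ^ sym X n j)⁻¹ x y =
      qad x (pair X n r s i j) (pair X n r s j j) y (cartanNat X n j i + 1) := by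
  rw [cartan_eq_of_ne h.ne', serre_comm, serre_eq_qad _
    (cartanNat_cases _ _ (cartanNat_symm i.2 j.2 hm)) _ _ (inv_ne_zero (pow_ne_zero _ H.r_ne)),
    pair_upper_of_ne_zero H.three_le h hm, pair_self H.two_le, inv_pow, inv_inv,
    mul_comm (s ^ sym X n j)⁻¹]

theorem serreRev_lower (H : Admissible X n r s) {i j : Fin n} (h : i < j)
    (hm : cartanNat X n i j ≠ 0) : ∃ a : K, a ≠ 0 ∧ ∀ x y : A,
    serreRev (cartan X n i j) (r ^ sym X n i) (s ^ sym X n i) x y =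
      a • qad x (pair X n r s i j) (pair X n r s i i) y (cartanNat X n i j + 1) := by
  have h1 := pow_ne_zero (sym X n i) H.r_ne
  have h2 := pow_ne_zero (sym X n i) H.s_ne
  refine ⟨-(-1) ^ cartanNat X n i j *
    (r ^ sym X n i * s ^ sym X n i) ^ (2 * cartanNat X n i j - 1), ?_, fun x y => ?_⟩
  rotate_left
  · rw [cartan_eq_of_ne h.ne, serreRev_eq_qad _ (cartanNat_cases _ _ hm) _ _ h1 h2,
      pair_upper_of_ne_zero H.three_le h hm, pair_self H.two_le, inv_pow, ← pow_mul, ← pow_mul,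
      sym_mul_cartanNat j.2 i.2]
  · exact mul_ne_zero (neg_ne_zero.2 (pow_ne_zero _ (by norm_num))) (pow_ne_zero _ (mul_ne_zero h1 h2))

theorem serreRev_upper (H : Admissible X n r s) {i j : Fin n} (h : i < j)
    (hm : cartanNat X n i j ≠ 0) : ∃ a : K, a ≠ 0 ∧ ∀ x y : A,
    serreRev (cartan X n j i) (r ^ sym X n j)⁻¹ (s ^ sym X n j)⁻¹ x y =
      a • qad x (pair X n r s j i) (pair X n r s j j) y (cartanNat X n j i + 1) := by
  have h1 := inv_ne_zero (pow_ne_zero (sym X n j) H.r_ne)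
  have h2 := inv_ne_zero (pow_ne_zero (sym X n j) H.s_ne)
  refine ⟨-(-1) ^ cartanNat X n j i *
    ((s ^ sym X n j)⁻¹ * (r ^ sym X n j)⁻¹) ^ (2 * cartanNat X n j i - 1), ?_, fun x y => ?_⟩
  rotate_left
  · rw [cartan_eq_of_ne h.ne', serreRev_comm, serreRev_eq_qad _
      (cartanNat_cases _ _ (cartanNat_symm i.2 j.2 hm)) _ _ h2 h1,
      pair_lower_of_ne_zero H.three_le h hm, pair_self H.two_le, inv_inv, inv_inv, ← pow_mul,
      ← pow_mul, sym_mul_cartanNat j.2 i.2, mul_comm _ (r ^ sym X n j)]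
  · exact mul_ne_zero (neg_ne_zero.2 (pow_ne_zero _ (by norm_num))) (pow_ne_zero _ (mul_ne_zero h2 h1))

theorem commCoeff_eq_pair (H : Admissible X n r s) {i j : Fin n} (h : i < j)
    (hm : cartanNat X n i j = 0) : commCoeff X n r s i j = pair X n r s j i := by
  rw [pair_lower H.three_le h, hm, commCoeff_eq, pow_zero, one_mul]

theorem commCoeff_eq_pair_inv (H : Admissible X n r s) {i j : Fin n} (h : i < j)
    (hm : cartanNat X n i j = 0) : commCoeff X n r s i j = (pair X n r s i j)⁻¹ := by
  have : cartanNat X n j i = 0 := by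
    by_contra h'
    exact cartanNat_symm j.2 i.2 h' hm
  rw [pair_upper H.three_le h, this, commCoeff_eq, pow_zero, one_mul, inv_inv]

theorem qad_one (x : A) (c Q : K) (y : A) : qad x c Q y 1 = x * y - c • (y * x) := by
  simp [qad_succ, qstep]

end Relations

section Presentation

variable {K : Type*} [Field K] {X : ClassicalType} {n : ℕ} {r s : K}

/-- The projection of the free algebra. -/
noncomputable def U.mk : FreeAlgebra K (Gen n) →ₐ[K] U X n r s :=
  RingQuot.mkAlgHom K (Rel X n r s)

theorem U.mk_rel {x y : FreeAlgebra K (Gen n)} (h : Rel X n r s x y) :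
    (U.mk x : U X n r s) = U.mk y := RingQuot.mkAlgHom_rel K h

theorem U.mk_ι (g : Gen n) : (U.mk (FreeAlgebra.ι K g) : U X n r s) = gen g := rfl

section

variable (i : Fin n)

theorem U.mk_e : (U.mk (FreeAlgebra.ι K (.e i)) : U X n r s) = TwoParam.e i := rfl
theorem U.mk_f : (U.mk (FreeAlgebra.ι K (.f i)) : U X n r s) = TwoParam.f i := rfl
theorem U.mk_w : (U.mk (FreeAlgebra.ι K (.w i)) : U X n r s) = w i := rfl
theorem U.mk_wInv : (U.mk (FreeAlgebra.ι K (.wInv i)) : U X n r s) = wInv i := rfl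
theorem U.mk_w' : (U.mk (FreeAlgebra.ι K (.w' i)) : U X n r s) = w' i := rfl
theorem U.mk_w'Inv : (U.mk (FreeAlgebra.ι K (.w'Inv i)) : U X n r s) = w'Inv i := rfl

end

theorem U.torus_comm {a b : Gen n} (ha : a.IsTorus) (hb : b.IsTorus) :
    (gen a * gen b : U X n r s) = gen b * gen a := by
  simpa [U.mk_ι] using U.mk_rel (Rel.torus_comm (X := X) (r := r) (s := s) a b ha hb)

theorem U.w_mul_wInv (i : Fin n) : (w i * wInv i : U X n r s) = 1 := by
  simpa [U.mk_w, U.mk_wInv, U.mk_w', U.mk_w'Inv] using U.mk_rel (Rel.w_inv (X := X) (r := r) (s := s) i)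

theorem U.w'_mul_w'Inv (i : Fin n) : (w' i * w'Inv i : U X n r s) = 1 := by
  simpa [U.mk_w, U.mk_wInv, U.mk_w', U.mk_w'Inv] using U.mk_rel (Rel.w'_inv (X := X) (r := r) (s := s) i)

/-- `ω_i` as a unit. -/
noncomputable def U.wUnit (i : Fin n) : (U X n r s)ˣ where
  val := w i
  inv := wInv i
  val_inv := U.w_mul_wInv i
  inv_val := by rw [← U.w_mul_wInv i]; exact U.torus_comm trivial trivial

/-- `ω_i'` as a unit. -/
noncomputable def U.w'Unit (i : Fin n) : (U X n r s)ˣ where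
  val := w' i
  inv := w'Inv i
  val_inv := U.w'_mul_w'Inv i
  inv_val := by rw [← U.w'_mul_w'Inv i]; exact U.torus_comm trivial trivial

section

variable (i : Fin n)

@[simp] theorem U.coe_wUnit : ((U.wUnit i : (U X n r s)ˣ) : U X n r s) = w i := rfl
@[simp] theorem U.coe_wUnit_inv : (((U.wUnit i)⁻¹ : (U X n r s)ˣ) : U X n r s) = wInv i := rfl
@[simp] theorem U.coe_w'Unit : ((U.w'Unit i : (U X n r s)ˣ) : U X n r s) = w' i := rfl
@[simp] theorem U.coe_w'Unit_inv : (((U.w'Unit i)⁻¹ : (U X n r s)ˣ) : U X n r s) = w'Inv i := rfl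

end

theorem qcomm_of_conj {A : Type*} [Ring A] [Algebra K A] {c : K} {u : Aˣ} {y : A}
    (h : (u : A) * y * ((u⁻¹ : Aˣ) : A) = c • y) : QComm c (u : A) y := by
  rw [QComm, ← smul_mul_assoc, ← h, mul_assoc, Units.inv_mul, mul_one]

theorem QComm.conj {A : Type*} [Ring A] [Algebra K A] {c : K} {u : Aˣ} {y : A}
    (h : QComm c (u : A) y) : (u : A) * y * ((u⁻¹ : Aˣ) : A) = c • y := by
  rw [h, smul_mul_assoc, mul_assoc, Units.mul_inv, mul_one]

/-- The generators of `U_{r,s}(𝔤)` satisfy the relations of a multiparameter quantum group. -/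
noncomputable def U.qg (H : Admissible X n r s) :
    QG (pair X n r s) (commScale X n r s) (fun i j : Fin n => cartanNat X n i j) (U X n r s) where
  e := TwoParam.e
  f := TwoParam.f
  w := U.wUnit
  v := U.w'Unit
  w_w i j := Units.ext (U.torus_comm trivial trivial)
  w_v i j := Units.ext (U.torus_comm trivial trivial)
  v_v i j := Units.ext (U.torus_comm trivial trivial)
  w_e i j := qcomm_of_conj
    (by simpa [U.mk_e, U.mk_f, U.mk_w, U.mk_wInv, U.mk_w', U.mk_w'Inv, commScale] using U.mk_rel (Rel.w_e (X := X) (r := r) (s := s) i j))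
  w_f i j := qcomm_of_conj
    (by simpa [U.mk_e, U.mk_f, U.mk_w, U.mk_wInv, U.mk_w', U.mk_w'Inv, commScale] using U.mk_rel (Rel.w_f (X := X) (r := r) (s := s) i j))
  v_e i j := qcomm_of_conj
    (by simpa [U.mk_e, U.mk_f, U.mk_w, U.mk_wInv, U.mk_w', U.mk_w'Inv, commScale] using U.mk_rel (Rel.w'_e (X := X) (r := r) (s := s) i j))
  v_f i j := qcomm_of_conj
    (by simpa [U.mk_e, U.mk_f, U.mk_w, U.mk_wInv, U.mk_w', U.mk_w'Inv, commScale] using U.mk_rel (Rel.w'_f (X := X) (r := r) (s := s) i j))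
  e_f i := by simpa [U.mk_e, U.mk_f, U.mk_w, U.mk_wInv, U.mk_w', U.mk_w'Inv, commScale] using U.mk_rel (Rel.e_f (X := X) (r := r) (s := s) i i)
  e_f_ne i j h := by
    have := U.mk_rel (Rel.e_f (X := X) (r := r) (s := s) i j)
    rw [if_neg h] at this
    simpa [U.mk_e, U.mk_f, sub_eq_zero] using this
  serre_e i j h := by
    rcases lt_or_gt_of_ne h with h' | h'
    · by_cases hm : cartanNat X n i j = 0
      · have := U.mk_rel (Rel.e_comm (X := X) (r := r) (s := s) i j h'
          (by rw [cartan_eq_of_ne h, hm]; rfl))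
        rw [commCoeff_eq_pair H h' hm] at this
        rw [hm, qad_one, sub_eq_zero]
        simpa [U.mk_e, U.mk_f, U.mk_w, U.mk_wInv, U.mk_w', U.mk_w'Inv, commScale] using this
      · have := U.mk_rel (Rel.e_serre (X := X) (r := r) (s := s) i j h'
          ((cartan_ne_zero_iff h).2 hm))
        rw [serre_lower H h' hm, map_qad] at this
        simpa [U.mk_e, U.mk_f, U.mk_w, U.mk_wInv, U.mk_w', U.mk_w'Inv, commScale] using this
    · by_cases hm : cartanNat X n j i = 0
      · have hm' : cartanNat X n i j = 0 := by
          by_contra h''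
          exact cartanNat_symm i.2 j.2 h'' hm
        have := U.mk_rel (Rel.e_comm (X := X) (r := r) (s := s) j i h'
          (by rw [cartan_eq_of_ne h.symm, hm]; rfl))
        rw [commCoeff_eq_pair_inv H h' hm] at this
        rw [hm', qad_one, sub_eq_zero]
        have this : (TwoParam.e j * TwoParam.e i : U X n r s) =
          (pair X n r s j i)⁻¹ • (TwoParam.e i * TwoParam.e j) := by simpa [U.mk_e, U.mk_f, U.mk_w, U.mk_wInv, U.mk_w', U.mk_w'Inv, commScale] using this
        rw [this, smul_smul, mul_inv_cancel₀ (H.pair_ne _ _), one_smul]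
      · have := U.mk_rel (Rel.e_serre' (X := X) (r := r) (s := s) j i h'
          ((cartan_ne_zero_iff h.symm).2 hm))
        rw [serre_upper H h' hm, map_qad] at this
        simpa [U.mk_e, U.mk_f, U.mk_w, U.mk_wInv, U.mk_w', U.mk_w'Inv, commScale] using this
  serre_f i j h := by
    rcases lt_or_gt_of_ne h with h' | h'
    · by_cases hm : cartanNat X n i j = 0
      · have := U.mk_rel (Rel.f_comm (X := X) (r := r) (s := s) i j h'
          (by rw [cartan_eq_of_ne h, hm]; rfl))
        rw [commCoeff_eq_pair_inv H h' hm] at this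
        rw [hm, qad_one, sub_eq_zero]
        have this : (TwoParam.f j * TwoParam.f i : U X n r s) =
          (pair X n r s i j)⁻¹ • (TwoParam.f i * TwoParam.f j) := by simpa [U.mk_e, U.mk_f, U.mk_w, U.mk_wInv, U.mk_w', U.mk_w'Inv, commScale] using this
        rw [this, smul_smul, mul_inv_cancel₀ (H.pair_ne _ _), one_smul]
      · have := U.mk_rel (Rel.f_serre (X := X) (r := r) (s := s) i j h'
          ((cartan_ne_zero_iff h).2 hm))
        obtain ⟨a, ha, hs⟩ := serreRev_lower (A := FreeAlgebra K (Gen n)) H h' hm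
        rw [hs, map_smul, map_qad, map_zero, smul_eq_zero_iff_right ha] at this
        simpa [U.mk_e, U.mk_f, U.mk_w, U.mk_wInv, U.mk_w', U.mk_w'Inv, commScale] using this
    · by_cases hm : cartanNat X n j i = 0
      · have hm' : cartanNat X n i j = 0 := by
          by_contra h''
          exact cartanNat_symm i.2 j.2 h'' hm
        have := U.mk_rel (Rel.f_comm (X := X) (r := r) (s := s) j i h'
          (by rw [cartan_eq_of_ne h.symm, hm]; rfl))
        rw [commCoeff_eq_pair H h' hm] at this
        rw [hm', qad_one, sub_eq_zero]
        simpa [U.mk_e, U.mk_f, U.mk_w, U.mk_wInv, U.mk_w', U.mk_w'Inv, commScale] using this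
      · have := U.mk_rel (Rel.f_serre' (X := X) (r := r) (s := s) j i h'
          ((cartan_ne_zero_iff h.symm).2 hm))
        obtain ⟨a, ha, hs⟩ := serreRev_upper (A := FreeAlgebra K (Gen n)) H h' hm
        rw [hs, map_smul, map_qad, map_zero, smul_eq_zero_iff_right ha] at this
        simpa [U.mk_e, U.mk_f, U.mk_w, U.mk_wInv, U.mk_w', U.mk_w'Inv, commScale] using this

variable {A : Type*} [Ring A] [Algebra K A]

/-- The images of the generators in an algebra with a quantum group structure. -/
def PreQG.genMap {p : Fin n → Fin n → K} {lam : Fin n → K} (q : PreQG p lam A) : Gen n → A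
  | .e i => q.e i
  | .f i => q.f i
  | .w i => q.w i
  | .wInv i => ((q.w i)⁻¹ : Aˣ)
  | .w' i => q.v i
  | .w'Inv i => ((q.v i)⁻¹ : Aˣ)

theorem PreQG.genMap_torus_comm {p : Fin n → Fin n → K} {lam : Fin n → K} (q : PreQG p lam A)
    {a b : Gen n} (ha : a.IsTorus) (hb : b.IsTorus) :
    q.genMap a * q.genMap b = q.genMap b * q.genMap a := by
  have h1 : ∀ i j, Commute (q.w i) (q.w j) := q.w_w
  have h2 : ∀ i j, Commute (q.w i) (q.v j) := q.w_v
  have h3 : ∀ i j, Commute (q.v i) (q.v j) := q.v_v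
  cases a <;> cases b <;> simp only [Gen.IsTorus] at ha hb <;>
    simp only [PreQG.genMap, ← Units.val_mul, Units.val_inj]
  all_goals first
    | exact h1 _ _ | exact h2 _ _ | exact (h2 _ _).symm | exact h3 _ _
    | exact (h1 _ _).inv_right | exact (h2 _ _).inv_right | exact (h2 _ _).symm.inv_right
    | exact (h3 _ _).inv_right
    | exact (h1 _ _).inv_left | exact (h2 _ _).inv_left | exact (h2 _ _).symm.inv_left
    | exact (h3 _ _).inv_left
    | exact (h1 _ _).inv_left.inv_right | exact (h2 _ _).inv_left.inv_right
    | exact (h2 _ _).symm.inv_left.inv_right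
    | exact (h3 _ _).inv_left.inv_right

theorem QG.lift_rel (H : Admissible X n r s)
    (q : QG (pair X n r s) (commScale X n r s) (fun i j : Fin n => cartanNat X n i j) A)
    {x y : FreeAlgebra K (Gen n)} (h : Rel X n r s x y) :
    FreeAlgebra.lift K q.genMap x = FreeAlgebra.lift K q.genMap y := by
  cases h with
  | torus_comm a b ha hb => simpa using q.genMap_torus_comm ha hb
  | w_inv i => simp [PreQG.genMap]
  | w'_inv i => simp [PreQG.genMap]
  | w_e i j => simpa [PreQG.genMap] using (q.w_e i j).conj
  | w_f i j => simpa [PreQG.genMap] using (q.w_f i j).conj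
  | w'_e i j => simpa [PreQG.genMap] using (q.v_e i j).conj
  | w'_f i j => simpa [PreQG.genMap] using (q.v_f i j).conj
  | e_f i j =>
    split_ifs with h
    · subst h
      simpa [PreQG.genMap, commScale] using q.e_f i
    · simpa [PreQG.genMap, sub_eq_zero] using q.e_f_ne i j h
  | e_comm i j h ha =>
    have hm : cartanNat X n i j = 0 := by
      by_contra h'; exact (cartan_ne_zero_iff h.ne).2 h' ha
    have := q.serre_e i j h.ne
    simp only [hm, zero_add, qad_one, sub_eq_zero] at this
    rw [commCoeff_eq_pair H h hm]
    simpa [PreQG.genMap] using this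
  | f_comm i j h ha =>
    have hm : cartanNat X n i j = 0 := by
      by_contra h'; exact (cartan_ne_zero_iff h.ne).2 h' ha
    have hm' : cartanNat X n j i = 0 := by
      by_contra h''
      exact cartanNat_symm j.2 i.2 h'' hm
    have := q.serre_f j i h.ne'
    simp only [hm', zero_add, qad_one, sub_eq_zero] at this
    rw [commCoeff_eq_pair H h hm]
    simpa [PreQG.genMap] using this
  | e_serre i j h ha =>
    rw [serre_lower H h ((cartan_ne_zero_iff h.ne).1 ha), map_qad]
    simpa [PreQG.genMap] using q.serre_e i j h.ne
  | e_serre' i j h ha =>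
    rw [serre_upper H h ((cartan_ne_zero_iff h.ne).1 ha), map_qad]
    simpa [PreQG.genMap] using q.serre_e j i h.ne'
  | f_serre i j h ha =>
    obtain ⟨a, -, hs⟩ := serreRev_lower (A := FreeAlgebra K (Gen n)) H h
      ((cartan_ne_zero_iff h.ne).1 ha)
    have := q.serre_f i j h.ne
    simp [hs, map_qad, PreQG.genMap, this]
  | f_serre' i j h ha =>
    obtain ⟨a, -, hs⟩ := serreRev_upper (A := FreeAlgebra K (Gen n)) H h
      ((cartan_ne_zero_iff h.ne).1 ha)
    have := q.serre_f j i h.ne'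
    simp [hs, map_qad, PreQG.genMap, this]

/-- The universal property of `U_{r,s}(𝔤)`. -/
noncomputable def U.lift (H : Admissible X n r s)
    (q : QG (pair X n r s) (commScale X n r s) (fun i j : Fin n => cartanNat X n i j) A) :
    U X n r s →ₐ[K] A :=
  RingQuot.liftAlgHom K ⟨FreeAlgebra.lift K q.genMap, fun _ _ h => q.lift_rel H h⟩

theorem U.lift_gen (H : Admissible X n r s)
    (q : QG (pair X n r s) (commScale X n r s) (fun i j : Fin n => cartanNat X n i j) A)
    (g : Gen n) : U.lift H q (gen g) = q.genMap g := by
  rw [U.lift, gen]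
  exact (RingQuot.liftAlgHom_mkAlgHom_apply K _ _ _).trans (by simp)

section

variable (H : Admissible X n r s)
  (q : QG (pair X n r s) (commScale X n r s) (fun i j : Fin n => cartanNat X n i j) A) (i : Fin n)

@[simp] theorem U.lift_e : U.lift H q (TwoParam.e i) = q.e i := U.lift_gen H q _
@[simp] theorem U.lift_f : U.lift H q (TwoParam.f i) = q.f i := U.lift_gen H q _
@[simp] theorem U.lift_w : U.lift H q (TwoParam.w i) = q.w i := U.lift_gen H q _
@[simp] theorem U.lift_w' : U.lift H q (TwoParam.w' i) = q.v i := U.lift_gen H q _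

end

/-- Ring homomorphisms from `U_{r,s}(𝔤)` agree if they agree on scalars and on the generators. -/
theorem U.ringHom_ext {B : Type*} [Ring B] {φ ψ : U X n r s →+* B}
    (hc : ∀ c : K, φ (algebraMap K _ c) = ψ (algebraMap K _ c))
    (he : ∀ i, φ (TwoParam.e i) = ψ (TwoParam.e i)) (hf : ∀ i, φ (TwoParam.f i) = ψ (TwoParam.f i))
    (hw : ∀ i, φ (w i) = ψ (w i)) (hw' : ∀ i, φ (w' i) = ψ (w' i)) : φ = ψ := by
  have inv : ∀ a b : U X n r s, a * b = 1 → b * a = 1 → φ a = ψ a → φ b = ψ b := by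
    intro a b hab hba h
    calc φ b = φ b * (ψ a * ψ b) := by rw [← map_mul, hab, map_one, mul_one]
      _ = ψ b := by rw [← mul_assoc, ← h, ← map_mul, hba, map_one, one_mul]
  have hgen : ∀ g : Gen n, φ (gen g) = ψ (gen g) := by
    intro g
    cases g with
    | e i => exact he i
    | f i => exact hf i
    | w i => exact hw i
    | w' i => exact hw' i
    | wInv i => exact inv (w i) (wInv i) (U.wUnit i).val_inv (U.wUnit i).inv_val (hw i)
    | w'Inv i => exact inv (w' i) (w'Inv i) (U.w'Unit i).val_inv (U.w'Unit i).inv_val (hw' i)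
  ext x
  obtain ⟨x, rfl⟩ : ∃ y, U.mk y = x := RingQuot.mkAlgHom_surjective K _ x
  induction x using FreeAlgebra.induction with
  | grade0 c => simpa using hc c
  | grade1 g => exact hgen g
  | mul a b ha hb => rw [map_mul, map_mul, ha, hb, map_mul]
  | add a b ha hb => rw [map_add, map_add, ha, hb, map_add]

theorem U.algHom_ext {φ ψ : U X n r s →ₐ[K] A}
    (he : ∀ i, φ (TwoParam.e i) = ψ (TwoParam.e i)) (hf : ∀ i, φ (TwoParam.f i) = ψ (TwoParam.f i))
    (hw : ∀ i, φ (w i) = ψ (w i)) (hw' : ∀ i, φ (w' i) = ψ (w' i)) : φ = ψ := by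
  have : (φ : U X n r s →+* A) = ψ :=
    U.ringHom_ext (fun c => by simp) he hf hw hw'
  ext x
  exact congrArg (fun χ : U X n r s →+* A => χ x) this

end Presentation

/-! ### Semilinear homomorphisms, by twisting the scalar action. -/

section Semilinear

variable {K : Type*} [Field K] {A : Type*} [Ring A] [Algebra K A]

/-- The ring `A`, with scalars acting through the field endomorphism `σ`. -/
@[nolint unusedArguments]
def Twist (_σ : K →+* K) (A : Type*) : Type _ := A

instance (σ : K →+* K) : Ring (Twist σ A) := inferInstanceAs (Ring A)

instance (σ : K →+* K) : Algebra K (Twist σ A) := Algebra.compHom A σ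

theorem qad_twist (σ : K →+* K) (x : A) (c Q : K) (y : A) (n : ℕ) :
    (qad (A := Twist σ A) x c Q y n : A) = qad x (σ c) (σ Q) y n := by
  induction n with
  | zero => rfl
  | succ n ih =>
    rw [qad_succ (A := A), ← ih, ← map_pow, ← map_mul]
    rfl

/-- Restriction of scalars along an endomorphism of the field. -/
def QG.twist {ι : Type*} (σ : K →+* K) {p p' : ι → ι → K} {lam lam' : ι → K} {m : ι → ι → ℕ}
    (hp : ∀ i j, σ (p i j) = p' i j) (hl : ∀ i, σ (lam i) = lam' i) (q : QG p' lam' m A) :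
    QG p lam m (Twist σ A) where
  e := q.e
  f := q.f
  w := q.w
  v := q.v
  w_w := q.w_w
  w_v := q.w_v
  v_v := q.v_v
  w_e := fun i j => (q.w_e i j).trans (by rw [← hp]; rfl)
  w_f := fun i j => (q.w_f i j).trans (by rw [← hp, ← map_inv₀]; rfl)
  v_e := fun i j => (q.v_e i j).trans (by rw [← hp, ← map_inv₀]; rfl)
  v_f := fun i j => (q.v_f i j).trans (by rw [← hp]; rfl)
  e_f := fun i => (q.e_f i).trans (by rw [← hl]; rfl)
  e_f_ne := q.e_f_ne
  serre_e := fun i j h => (qad_twist σ _ _ _ _ _).trans (by rw [hp, hp]; exact q.serre_e i j h)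
  serre_f := fun i j h => (qad_twist σ _ _ _ _ _).trans (by rw [hp, hp]; exact q.serre_f i j h)

/-- The universal property of `U_{r,s}(𝔤)`, for semilinear ring homomorphisms. -/
theorem U.exists_semilift {X : ClassicalType} {n : ℕ} {r s : K} (H : Admissible X n r s)
    (σ : K →+* K) {p' : Fin n → Fin n → K} {lam' : Fin n → K}
    (hp : ∀ i j, σ (pair X n r s i j) = p' i j) (hl : ∀ i, σ (commScale X n r s i) = lam' i)
    (q : QG p' lam' (fun i j : Fin n => cartanNat X n i j) A) :
    ∃ φ : U X n r s →+* A, (∀ c, φ (algebraMap K _ c) = algebraMap K A (σ c)) ∧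
      (∀ i, φ (TwoParam.e i) = q.e i) ∧ (∀ i, φ (TwoParam.f i) = q.f i) ∧
      (∀ i, φ (w i) = q.w i) ∧ (∀ i, φ (w' i) = q.v i) :=
  let φ : U X n r s →+* Twist σ A := (U.lift H (q.twist σ hp hl)).toRingHom
  ⟨φ,
    fun c => AlgHom.commutes (U.lift H (q.twist σ hp hl)) c, fun i => U.lift_e H (q.twist σ hp hl) i,
    fun i => U.lift_f H (q.twist σ hp hl) i, fun i => U.lift_w H (q.twist σ hp hl) i,
    fun i => U.lift_w' H (q.twist σ hp hl) i⟩

end Semilinear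

end TwoParam

/-! ### Bijectivity of reflections, from their squares in the opposite algebra. -/

namespace TwoParam

open MulOpposite

section Square

variable {K ι : Type*} [Field K] {p : ι → ι → K} {lam : ι → K} {m : ι → ι → ℕ}
  {A : Type*} [Ring A] [Algebra K A]

theorem qad_op_eq (x : A) (c Q : K) (hc : c ≠ 0) (hQ : Q ≠ 0) (y : A) (n : ℕ) :
    qad (op x) c Q (op y) n =
      op ((∏ t ∈ Finset.range n, (-(c * Q ^ t))) • qad x c⁻¹ Q⁻¹ y n) := by
  induction n with
  | zero => simp
  | succ n ih =>
    rw [qad_succ, ih, qstep_op _ _ (mul_ne_zero hc (pow_ne_zero _ hQ)), qstep_smul, smul_smul,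
      qad_succ, mul_inv, inv_pow, Finset.prod_range_succ, mul_comm (∏ t ∈ _, _)]

/-- The scalar by which the square of the anti-automorphism attached to a reflection acts. -/
def sqScale (p : ι → ι → K) (lam : ι → K) (m : ι → ι → ℕ) (i : ι) (c : ι → K) (j : ι) : K :=
  c j * (c i ^ m i j * c j * (∏ t ∈ Finset.range (m i j), (-(p j i * p i i ^ t))) *
    lowc p lam i j (m i j) (m i j))

/-- Once `p i j` and `d i` are eliminated by means of `cart` and `hi`, the product is the square of
`c j * d j * kap / lam j`, which is 1 by the normalization `hj`. -/
theorem sqScale_mul {i : ι} (h : ReflData p m i) {c d : ι → K} (hl : ∀ j, lam j ≠ 0)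
    (hi : c i * d i = p i i) (hj : ∀ j, i ≠ j → c j * d j * PreQG.kap p lam i j (m i j) = lam j)
    {j : ι} (hij : i ≠ j) :
    sqScale p lam m i c j * sqScale (fun a b => p b a) lam m i d j = 1 := by
  have hci : c i ≠ 0 := left_ne_zero_of_mul (hi.trans_ne (h.p_ne i i))
  have hm : m i j = 0 ∨ m i j = 1 ∨ m i j = 2 := by
    rcases h.rank_two j hij with h | h | h | h <;> omega
  have hd : d i = p i i * (c i)⁻¹ := by rw [← hi]; field_simp
  have ha : p i j = (p j i * p i i ^ m i j)⁻¹ := by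
    apply eq_inv_of_mul_eq_one_left; rw [← h.cart i j hij]; ring
  have hk : c j * d j * ((lam i * (1 - p i i)) ^ m i j *
      (∏ t ∈ Finset.range (m i j), qnum (p i i) (t + 1)) ^ 2 *
      ∏ t ∈ Finset.range (m i j), (p i i)⁻¹ ^ (t + 1)) = 1 := by
    apply mul_left_cancel₀ (hl j)
    conv_rhs => rw [mul_one, ← hj j hij, PreQG.kap]
    ring
  have hQ := h.p_ne i i
  have hb := h.p_ne j i
  simp only [sqScale, lowc, PreQG.loc, ha, hd]
  clear ha hd hi hj h
  generalize p i i = Q at *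
  generalize p j i = b at *
  generalize c i = ci at *
  generalize c j = cj at *
  generalize d j = dj at *
  generalize lam i = l at *
  generalize m i j = M at *
  rcases hm with rfl | rfl | rfl <;>
    simp only [Finset.prod_range_succ, Finset.prod_range_zero, qnum_zero, qnum_succ, pow_zero,
      zero_add, one_mul, mul_one, pow_one, tsub_self, one_pow, Nat.reduceAdd,
      Nat.reduceSub] at hk ⊢
  · linear_combination (cj * dj + 1) * hk
  · refine Eq.trans (b := (cj * dj * (l * (1 - Q) * Q⁻¹)) ^ 2) ?_ (by rw [hk, one_pow])
    field_simp
  · refine Eq.trans (b := (cj * dj * ((l * (1 - Q)) ^ 2 * (1 + Q) ^ 2 * (Q⁻¹ * Q⁻¹ ^ 2))) ^ 2) ?_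
      (by rw [hk, one_pow])
    field_simp
    ring

variable [DecidableEq ι]

/-- Applying the anti-endomorphism to the top of a string turns raising by `e i` into lowering by
`v_i⁻¹ f_i`. Starting again from the top, `m i j` steps lead back to `e j`. -/
theorem smul_qad_op_reflE (q : PreQG p lam A) {i : ι} (h : ReflData p m i) (c : ι → K) {j : ι}
    (hij : i ≠ j) :
    c j • qad (op (q.reflE m i c i)) (p j i) (p i i) (op (q.reflE m i c j)) (m i j) =
      op (sqScale p lam m i c j • q.e j) := by
  have hp := h.p_ne
  have hc := h.cart i j hij
  have e : (p j i)⁻¹ = p i j * p i i ^ m i j := by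
    apply inv_eq_of_mul_eq_one_right; rw [← hc]; ring
  rw [qad_op_eq _ _ _ (hp _ _) (hp _ _), q.reflE_self, q.reflE_of_ne hij, smul_qad, qad_smul, e,
    q.qad_lower hp hij hc _ le_rfl, Nat.sub_self, q.es_zero, ← op_smul]
  simp only [smul_smul, sqScale]
  congr 2
  ring

end Square

section Rescaling

variable {K : Type*} [Field K] {X : ClassicalType} {n : ℕ} {r s : K}

@[simp] theorem U.lift_wInv {A : Type*} [Ring A] [Algebra K A] (H : Admissible X n r s)
    (q : QG (pair X n r s) (commScale X n r s) (fun i j : Fin n => cartanNat X n i j) A)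
    (i : Fin n) : U.lift H q (wInv i) = ((q.w i)⁻¹ : Aˣ) := U.lift_gen H q _

@[simp] theorem U.lift_w'Inv {A : Type*} [Ring A] [Algebra K A] (H : Admissible X n r s)
    (q : QG (pair X n r s) (commScale X n r s) (fun i j : Fin n => cartanNat X n i j) A)
    (i : Fin n) : U.lift H q (w'Inv i) = ((q.v i)⁻¹ : Aˣ) := U.lift_gen H q _

/-- The rescaling endomorphisms. -/
noncomputable def U.scale (H : Admissible X n r s) (c d : Fin n → K) (h : ∀ i, c i * d i = 1) :
    U X n r s →ₐ[K] U X n r s :=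
  U.lift H ((U.qg H).rescale c d (by simp [h]))

theorem U.scale_comp (H : Admissible X n r s) {c d : Fin n → K} (h : ∀ i, c i * d i = 1) :
    (U.scale H c d h).comp (U.scale H d c (fun i => by rw [mul_comm, h])) = AlgHom.id K _ := by
  apply U.algHom_ext <;> intro i <;> simp [U.scale, QG.rescale, U.qg, smul_smul, h, mul_comm (d i)]

theorem U.scale_bijective (H : Admissible X n r s) {c d : Fin n → K} (h : ∀ i, c i * d i = 1) :
    Function.Bijective (U.scale H c d h) := by
  refine Function.bijective_iff_has_inverse.2 ⟨U.scale H d c (fun i => by rw [mul_comm, h]),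
    fun x => ?_, fun x => ?_⟩
  · exact DFunLike.congr_fun (U.scale_comp H (fun i => by rw [mul_comm, h])) x
  · exact DFunLike.congr_fun (U.scale_comp H h) x

end Rescaling

section ReflectionMap

variable {K : Type*} [Field K] {X : ClassicalType} {n : ℕ} {r s : K}

/-- The structure given by a reflection, on the opposite algebra. -/
noncomputable def U.reflQG (H : Admissible X n r s) {i : Fin n}
    (h : ReflData (pair X n r s) (fun i j : Fin n => cartanNat X n i j) i) {c d : Fin n → K}
    (hi : c i * d i = pair X n r s i i)
    (hj : ∀ j, i ≠ j → c j * d j *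
      PreQG.kap (pair X n r s) (commScale X n r s) i j (cartanNat X n i j) = commScale X n r s j) :
    QG (pair X n r s) (commScale X n r s) (fun i j : Fin n => cartanNat X n i j) (U X n r s)ᵐᵒᵖ :=
  ((U.qg H).refl h hi hj).op (fun a b => h.p_ne b a) (fun a b hab => by
    rw [mul_comm (pair X n r s b a)]; exact h.cart a b hab)

theorem anti_square_bijective {A : Type*} [Ring A] [Algebra K A] (P : A →ₐ[K] Aᵐᵒᵖ)
    (h : Function.Bijective (fun x => unop (P (unop (P x))))) :
    Function.Bijective (fun x => unop (P x)) :=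
  ⟨Function.Injective.of_comp (f := fun x => unop (P x)) h.1,
    Function.Surjective.of_comp (f := fun x => unop (P x)) h.2⟩

/-- No formula for the inverse is needed: the square of this anti-endomorphism fixes `e_i`, `f_i`
and the torus, and rescales the other generators, so it is an automorphism. -/
theorem U.reflQG_bijective (H : Admissible X n r s) {i : Fin n}
    (h : ReflData (pair X n r s) (fun i j : Fin n => cartanNat X n i j) i) {c d : Fin n → K}
    (hi : c i * d i = pair X n r s i i)
    (hj : ∀ j, i ≠ j → c j * d j *
      PreQG.kap (pair X n r s) (commScale X n r s) i j (cartanNat X n i j) = commScale X n r s j) :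
    Function.Bijective (fun x => unop (U.lift H (U.reflQG H h hi hj) x)) := by
  set P := U.lift H (U.reflQG H h hi hj) with hP
  let p := pair X n r s
  let lam := commScale X n r s
  let m := fun i j : Fin n => cartanNat X n i j
  let q := U.qg H
  have hPe : ∀ j, P (q.e j) = op (q.toPreQG.reflE m i c j) := fun j => U.lift_e H _ j
  have hPf : ∀ j, P (q.f j) = op (q.toPreQG.dual.reflE m i d j) := fun j => U.lift_f H _ j
  have hPw : ∀ j, P (q.w j) = op (q.toPreQG.dual.reflW m i j : U X n r s) := fun j => U.lift_w H _ j
  have hPv : ∀ j, P (q.v j) = op (q.toPreQG.reflW m i j : U X n r s) := fun j => U.lift_w' H _ j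
  have hPwi : ∀ j, P ((q.w j)⁻¹ : (U X n r s)ˣ) =
      op (((q.toPreQG.dual.reflW m i j)⁻¹ : (U X n r s)ˣ) : U X n r s) := fun j => U.lift_wInv H _ j
  have hPvi : ∀ j, P ((q.v j)⁻¹ : (U X n r s)ˣ) =
      op (((q.toPreQG.reflW m i j)⁻¹ : (U X n r s)ˣ) : U X n r s) := fun j => U.lift_w'Inv H _ j
  let c' : Fin n → K := fun j => if i = j then 1 else sqScale p lam m i c j
  let d' : Fin n → K := fun j => if i = j then 1 else sqScale (fun a b => p b a) lam m i d j
  have hcd : ∀ j, c' j * d' j = 1 := fun j => by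
    by_cases hij : i = j
    · simp [c', d', hij]
    · simp only [c', d', if_neg hij]
      exact sqScale_mul h H.commScale_ne hi hj hij
  let P2 : U X n r s →ₐ[K] U X n r s :=
    ((AlgEquiv.opOp K (U X n r s)).symm : _ →ₐ[K] _).comp ((AlgHom.op P).comp P)
  have hP2 : ∀ x, P2 x = unop (P (unop (P x))) := fun x => rfl
  have key : P2 = U.scale H c' d' hcd := by
    apply U.algHom_ext <;> intro j <;> rw [hP2]
    · change unop (P (unop (P (q.e j)))) = _
      rw [U.scale, U.lift_e]
      change _ = c' j • q.e j
      rcases eq_or_ne i j with rfl | hij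
      · rw [hPe, unop_op, PreQG.reflE_self, map_smul, map_mul, hPvi, hPf, PreQG.reflE_self,
          PreQG.reflW_self, inv_inv, ← op_mul, ← op_smul, unop_op, smul_mul_assoc, smul_smul, hi]
        simp only [c', if_pos]
        have h1 := ((q.w_e i i).units_inv (h.p_ne _ _))
        unfold QComm at h1
        change pair X n r s i i • ((((q.w i)⁻¹ : (U X n r s)ˣ) : U X n r s) * q.e i * q.w i) = _
        rw [h1, smul_mul_assoc, smul_smul, mul_inv_cancel₀ (h.p_ne _ _), one_smul, one_smul,
          mul_assoc, Units.inv_mul, mul_one]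
      · rw [hPe, unop_op, PreQG.reflE_of_ne _ hij, map_smul, PreQG.es, map_qad, hPe, hPe,
          smul_qad_op_reflE _ h c hij, unop_op]
        simp only [c', if_neg hij]
        rfl
    · change unop (P (unop (P (q.f j)))) = _
      rw [U.scale, U.lift_f]
      change _ = d' j • q.f j
      rcases eq_or_ne i j with rfl | hij
      · rw [hPf, unop_op, PreQG.reflE_self, map_smul, map_mul]
        change unop (d i • (P ((q.w i)⁻¹ : (U X n r s)ˣ) * P (q.e i))) = _
        rw [hPwi, hPe, PreQG.reflE_self,
          PreQG.reflW_self, inv_inv, ← op_mul, ← op_smul, unop_op, smul_mul_assoc, smul_smul,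
          mul_comm (d i), hi]
        simp only [d', if_pos]
        have h1 := ((q.v_f i i).units_inv (h.p_ne _ _))
        unfold QComm at h1
        change pair X n r s i i • ((((q.v i)⁻¹ : (U X n r s)ˣ) : U X n r s) * q.f i * q.v i) = _
        rw [h1, smul_mul_assoc, smul_smul, mul_inv_cancel₀ (h.p_ne _ _), one_smul, one_smul,
          mul_assoc, Units.inv_mul, mul_one]
      · rw [hPf, unop_op, PreQG.reflE_of_ne _ hij, map_smul, PreQG.es, map_qad]
        change unop (d j • qad (P (q.f i)) _ _ (P (q.f j)) _) = _
        rw [hPf, hPf]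
        have := smul_qad_op_reflE q.toPreQG.dual h.dual d hij
        rw [this, unop_op]
        simp only [d', if_neg hij]
        rfl
    · change unop (P (unop (P (q.w j)))) = _
      rw [U.scale, U.lift_w, hPw, unop_op]
      change _ = (q.w j : U X n r s)
      rcases eq_or_ne i j with rfl | hij
      · rw [PreQG.reflW_self]
        change unop (P ((q.v i)⁻¹ : (U X n r s)ˣ)) = _
        rw [hPvi, PreQG.reflW_self, inv_inv, unop_op]
      · rw [PreQG.reflW_of_ne _ hij, Units.val_mul, Units.val_pow_eq_pow_val, map_mul, map_pow]
        change unop (P (q.v j) * P (q.v i) ^ m i j) = _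
        rw [hPv, hPv, unop_mul, unop_pow, unop_op, unop_op, PreQG.reflW_self,
          PreQG.reflW_of_ne _ hij, ← Units.val_pow_eq_pow_val, ← Units.val_mul]
        congr 1
        rw [← mul_assoc, inv_pow, (((q.commute_w_w i j).pow_left (m i j)).inv_left).eq, mul_assoc,
          inv_mul_cancel, mul_one]
    · change unop (P (unop (P (q.v j)))) = _
      rw [U.scale, U.lift_w', hPv, unop_op]
      change _ = (q.v j : U X n r s)
      rcases eq_or_ne i j with rfl | hij
      · rw [PreQG.reflW_self]
        rw [hPwi, PreQG.reflW_self, inv_inv, unop_op]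
        rfl
      · rw [PreQG.reflW_of_ne _ hij, Units.val_mul, Units.val_pow_eq_pow_val, map_mul, map_pow]
        rw [hPw, hPw, unop_mul, unop_pow, unop_op, unop_op, PreQG.reflW_self,
          PreQG.reflW_of_ne _ hij, ← Units.val_pow_eq_pow_val, ← Units.val_mul]
        congr 1
        change (q.v i)⁻¹ ^ m i j * (q.v j * q.v i ^ m i j) = q.v j
        have hc : Commute (q.v i) (q.v j) := q.v_v i j
        rw [← mul_assoc, inv_pow, ((hc.pow_left (m i j)).inv_left).eq, mul_assoc,
          inv_mul_cancel, mul_one]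
  apply anti_square_bijective
  have := U.scale_bijective H hcd
  rw [← key] at this
  exact this

end ReflectionMap

end TwoParam

/-! ### The associated quantum group and semilinear reflections. -/

namespace TwoParam

open MulOpposite

section Cast

variable {K ι : Type*} [Field K] {p p' : ι → ι → K} {lam : ι → K} {m : ι → ι → ℕ}
  {A : Type*} [Ring A] [Algebra K A]

/-- Replacement of the parameters by equal ones. -/
def QG.cast (q : QG p lam m A) (h : p = p') : QG p' lam m A := h ▸ q

variable (q : QG p lam m A) (h : p = p') (i : ι)

@[simp] theorem QG.cast_e : (q.cast h).e i = q.e i := by subst h; rfl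
@[simp] theorem QG.cast_f : (q.cast h).f i = q.f i := by subst h; rfl
@[simp] theorem QG.cast_w : (q.cast h).w i = q.w i := by subst h; rfl
@[simp] theorem QG.cast_v : (q.cast h).v i = q.v i := by subst h; rfl

end Cast

section Identification

variable {K : Type*} [Field K] {X : ClassicalType} {n : ℕ} {r s : K}

/-- The factor `r_i s_i` accounts for the constant in `Θ (f i)` and for one power of `r_i s_i` in
the images of the `f`'s. -/
theorem commScale_swap (H : Admissible X n r s) (i : Fin n) :
    commScale X n s⁻¹ r⁻¹ i = r ^ sym X n i * s ^ sym X n i * commScale X n r s i := by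
  have h1 := pow_ne_zero (sym X n i) H.r_ne
  have h2 := pow_ne_zero (sym X n i) H.s_ne
  have h3 := H.sub_ne i
  have h4 := H.swap.sub_ne i
  simp only [commScale, inv_pow] at *
  field_simp

theorem Admissible.mul_sym_ne (H : Admissible X n r s) (i : ℕ) :
    r ^ sym X n i * s ^ sym X n i ≠ 0 :=
  mul_ne_zero (pow_ne_zero _ H.r_ne) (pow_ne_zero _ H.s_ne)

theorem pair_swap_eq (H : Admissible X n r s) :
    (fun i j => pair X n s⁻¹ r⁻¹ j i) = pair X n r s := by
  funext i j
  exact pair_swap H.r_ne H.s_ne H.two_le H.three_le j i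

theorem pair_swap_eq' (H : Admissible X n r s) :
    (fun i j => pair X n r s j i) = pair X n s⁻¹ r⁻¹ := by
  funext i j
  exact (pair_swap H.r_ne H.s_ne H.two_le H.three_le i j).symm

/-- The homomorphism from `U_{r,s}(𝔤)` to its associated quantum group. -/
noncomputable def U.theta (H : Admissible X n r s) : U X n r s →ₐ[K] U X n s⁻¹ r⁻¹ :=
  U.lift H (((U.qg H.swap).dual.cast (pair_swap_eq H)).rescale (fun _ => 1)
    (fun i => (r ^ sym X n i * s ^ sym X n i)⁻¹) (fun i => by
      rw [commScale_swap H, one_mul, inv_mul_cancel_left₀ (H.mul_sym_ne i)]))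

/-- The inverse of the homomorphism `U.theta`. -/
noncomputable def U.thetaInv (H : Admissible X n r s) : U X n s⁻¹ r⁻¹ →ₐ[K] U X n r s :=
  U.lift H.swap (((U.qg H).dual.cast (pair_swap_eq' H)).rescale
    (fun i => r ^ sym X n i * s ^ sym X n i) (fun _ => 1) (fun i => by
      rw [commScale_swap H, mul_one]))

section

variable (H : Admissible X n r s) (i : Fin n)

@[simp] theorem U.theta_e : U.theta H (e i) = f i := by
  simp [U.theta, QG.rescale, QG.dual, PreQG.dual, U.qg]

@[simp] theorem U.theta_f :
    U.theta H (f i) = (r ^ sym X n i * s ^ sym X n i)⁻¹ • e i := by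
  simp [U.theta, QG.rescale, QG.dual, PreQG.dual, U.qg]

@[simp] theorem U.theta_w : U.theta H (w i) = w' i := by
  simp [U.theta, QG.rescale, QG.dual, PreQG.dual, U.qg]

@[simp] theorem U.theta_w' : U.theta H (w' i) = w i := by
  simp [U.theta, QG.rescale, QG.dual, PreQG.dual, U.qg]

@[simp] theorem U.thetaInv_e :
    U.thetaInv H (e i) = (r ^ sym X n i * s ^ sym X n i) • f i := by
  simp [U.thetaInv, QG.rescale, QG.dual, PreQG.dual, U.qg]

@[simp] theorem U.thetaInv_f : U.thetaInv H (f i) = e i := by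
  simp [U.thetaInv, QG.rescale, QG.dual, PreQG.dual, U.qg]

@[simp] theorem U.thetaInv_w : U.thetaInv H (w i) = w' i := by
  simp [U.thetaInv, QG.rescale, QG.dual, PreQG.dual, U.qg]

@[simp] theorem U.thetaInv_w' : U.thetaInv H (w' i) = w i := by
  simp [U.thetaInv, QG.rescale, QG.dual, PreQG.dual, U.qg]

end

/-- The identification of `U_{r,s}(𝔤)` with its associated quantum group. -/
noncomputable def U.assoc (H : Admissible X n r s) : U X n r s ≃ₐ[K] U X n s⁻¹ r⁻¹ :=
  AlgEquiv.ofAlgHom (U.theta H) (U.thetaInv H)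
    (by apply U.algHom_ext <;> intro i <;> simp [smul_smul, mul_inv_cancel₀ (H.mul_sym_ne i), -mul_inv_rev])
    (by apply U.algHom_ext <;> intro i <;> simp [smul_smul, inv_mul_cancel₀ (H.mul_sym_ne i), -mul_inv_rev])

theorem U.assoc_isAssocIdentification (H : Admissible X n r s) :
    IsAssocIdentification (U.assoc H) := fun i =>
  ⟨U.theta_e H i, U.theta_f H i, U.theta_w H i, U.theta_w' H i⟩

end Identification

section SemilinearReflection

variable {K : Type*} [Field K] {X : ClassicalType} {n : ℕ} {r s : K}

theorem IsSwap.map_pair {σ : K ≃+* K} (hσ : IsSwap r s σ) (H : Admissible X n r s) (i j : Fin n) :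
    (σ : K →+* K) (pair X n r s i j) = pair X n r s j i := by
  rw [TwoParam.map_pair, ← pair_swap H.r_ne H.s_ne H.two_le H.three_le]
  exact congrArg₂ (fun a b => pair X n a b i j) hσ.1 hσ.2

theorem IsSwap.map_commScale {σ : K ≃+* K} (hσ : IsSwap r s σ) (H : Admissible X n r s)
    (i : Fin n) :
    (σ : K →+* K) (commScale X n r s i) =
      r ^ sym X n i * s ^ sym X n i * commScale X n r s i := by
  rw [← commScale_swap H]
  simp [commScale, hσ.1, hσ.2]

theorem IsSwap.symm {σ : K ≃+* K} (hσ : IsSwap r s σ) : IsSwap r s σ.symm := by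
  constructor
  · rw [RingEquiv.symm_apply_eq, map_inv₀, hσ.2, inv_inv]
  · rw [RingEquiv.symm_apply_eq, map_inv₀, hσ.1, inv_inv]

/-- The semilinear anti-automorphism which fixes the `e_i` and exchanges `ω_i` with `ω_i'`. -/
theorem U.exists_bar (H : Admissible X n r s) {σ : K ≃+* K} (hσ : IsSwap r s σ) :
    ∃ τ : U X n r s →+* (U X n r s)ᵐᵒᵖ,
      (∀ c, τ (algebraMap K _ c) = algebraMap K _ (σ c)) ∧ (∀ i, τ (e i) = op (e i)) ∧
      (∀ i, τ (f i) = op ((r ^ sym X n i * s ^ sym X n i) • f i)) ∧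
      (∀ i, τ (w i) = op (w' i)) ∧ (∀ i, τ (w' i) = op (w i)) := by
  -- The opposite algebra and `σ` both transpose the parameters, so they match. The rescaling of `f
  -- i` compensates `σ` acting on `1 / (r_i - s_i)`.
  obtain ⟨τ, h1, h2, h3, h4, h5⟩ := U.exists_semilift H (σ : K →+* K) (hσ.map_pair H)
    (hσ.map_commScale H)
    (((U.qg H).op H.pair_ne (fun i j h => pair_cartan H.r_ne H.s_ne H.two_le H.three_le h)).rescale
      (fun _ => 1) (fun i => r ^ sym X n i * s ^ sym X n i) (fun i => by rw [one_mul]))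
  exact ⟨τ, h1, fun i => (h2 i).trans (one_smul _ _), h3, h4, h5⟩

/-- The inverse is the corresponding map for `σ.symm`; on `f i` the two factors cancel because a
swap inverts `r_i s_i`. -/
theorem U.bar_bijective (H : Admissible X n r s) {σ : K ≃+* K} (hσ : IsSwap r s σ)
    {τ : U X n r s →+* (U X n r s)ᵐᵒᵖ}
    (h1 : ∀ c, τ (algebraMap K _ c) = algebraMap K _ (σ c)) (h2 : ∀ i, τ (e i) = op (e i))
    (h3 : ∀ i, τ (f i) = op ((r ^ sym X n i * s ^ sym X n i) • f i))
    (h4 : ∀ i, τ (w i) = op (w' i)) (h5 : ∀ i, τ (w' i) = op (w i)) :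
    Function.Bijective (fun x => unop (τ x)) := by
  obtain ⟨τ', g1, g2, g3, g4, g5⟩ := U.exists_bar H hσ.symm
  have aux : ∀ {σ₁ σ₂ : K ≃+* K} {τ₁ τ₂ : U X n r s →+* (U X n r s)ᵐᵒᵖ}, IsSwap r s σ₂ →
      (∀ c, σ₂ (σ₁ c) = c) →
      (∀ c, τ₁ (algebraMap K _ c) = algebraMap K _ (σ₁ c)) → (∀ i, τ₁ (e i) = op (e i)) →
      (∀ i, τ₁ (f i) = op ((r ^ sym X n i * s ^ sym X n i) • f i)) →
      (∀ i, τ₁ (w i) = op (w' i)) → (∀ i, τ₁ (w' i) = op (w i)) →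
      (∀ c, τ₂ (algebraMap K _ c) = algebraMap K _ (σ₂ c)) → (∀ i, τ₂ (e i) = op (e i)) →
      (∀ i, τ₂ (f i) = op ((r ^ sym X n i * s ^ sym X n i) • f i)) →
      (∀ i, τ₂ (w i) = op (w' i)) → (∀ i, τ₂ (w' i) = op (w i)) →
      ∀ x, unop (τ₂ (unop (τ₁ x))) = x := by
    intro σ₁ σ₂ τ₁ τ₂ hσ₂ hσ₁ a1 a2 a3 a4 a5 b1 b2 b3 b4 b5 x
    let φ : U X n r s →+* U X n r s :=
      ((RingEquiv.opOp (U X n r s)).symm : _ →+* _).comp ((RingHom.op τ₂).comp τ₁)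
    have hφ : ∀ x, φ x = unop (τ₂ (unop (τ₁ x))) := fun x => rfl
    have : φ = RingHom.id _ := by
      apply U.ringHom_ext
      · intro c
        rw [hφ, a1]
        change unop (τ₂ (algebraMap K _ (σ₁ c))) = _
        rw [b1, hσ₁]
        rfl
      · intro i; rw [hφ, a2, unop_op, b2]; rfl
      · intro i
        rw [hφ, a3, unop_op, Algebra.smul_def, map_mul, b1, b3]
        change (r ^ sym X n i * s ^ sym X n i) • f i *
          algebraMap K _ (σ₂ (r ^ sym X n i * s ^ sym X n i)) = f i
        rw [← Algebra.commutes, ← Algebra.smul_def, smul_smul, map_mul, map_pow, map_pow, hσ₂.1,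
          hσ₂.2]
        have h1 := pow_ne_zero (sym X n i) H.r_ne
        have h2 := pow_ne_zero (sym X n i) H.s_ne
        have : s⁻¹ ^ sym X n i * r⁻¹ ^ sym X n i * (r ^ sym X n i * s ^ sym X n i) = 1 := by
          rw [inv_pow, inv_pow]; field_simp
        rw [this, one_smul]
      · intro i; rw [hφ, a4, unop_op, b5]; rfl
      · intro i; rw [hφ, a5, unop_op, b4]; rfl
    rw [← hφ, this]
    rfl
  exact Function.bijective_iff_has_inverse.2 ⟨fun x => unop (τ' x),
    fun x => aux hσ.symm (fun c => σ.symm_apply_apply c) h1 h2 h3 h4 h5 g1 g2 g3 g4 g5 x,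
    fun x => aux hσ (fun c => σ.apply_symm_apply c) g1 g2 g3 g4 g5 h1 h2 h3 h4 h5 x⟩

/-- The semilinear reflections. -/
theorem U.exists_reflection (H : Admissible X n r s) {σ : K ≃+* K} (hσ : IsSwap r s σ) {i : Fin n}
    (h : ReflData (pair X n r s) (fun i j : Fin n => cartanNat X n i j) i) {c d : Fin n → K}
    (hi : c i * d i = pair X n r s i i)
    (hj : ∀ j, i ≠ j → c j * d j *
      PreQG.kap (pair X n r s) (commScale X n r s) i j (cartanNat X n i j) = commScale X n r s j) :
    ∃ T : U X n r s ≃+* U X n r s, (∀ a, T (algebraMap K _ a) = algebraMap K _ (σ a)) ∧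
      (∀ j, T (e j) = ((U.qg H).refl h hi hj).e j) ∧
      (∀ j, T (f j) = (r ^ sym X n j * s ^ sym X n j) • ((U.qg H).refl h hi hj).f j) ∧
      (∀ j, T (w j) = ((U.qg H).refl h hi hj).w j) ∧
      (∀ j, T (w' j) = ((U.qg H).refl h hi hj).v j) := by
  obtain ⟨τ, h1, h2, h3, h4, h5⟩ := U.exists_bar H hσ
  let P := U.lift H (U.reflQG H h hi hj)
  -- The composite of the semilinear anti-automorphism `τ` with the linear anti-automorphism given
  -- by the reflection is a semilinear automorphism.
  let φ : U X n r s →+* U X n r s := ((RingEquiv.opOp (U X n r s)).symm : _ →+* _).comp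
    ((RingHom.op (P : U X n r s →+* (U X n r s)ᵐᵒᵖ)).comp τ)
  have hφ : ∀ x, φ x = unop (P (unop (τ x))) := fun x => rfl
  have hbij : Function.Bijective φ :=
    (U.reflQG_bijective H h hi hj).comp (U.bar_bijective H hσ h1 h2 h3 h4 h5)
  refine ⟨RingEquiv.ofBijective φ hbij, fun a => ?_, fun j => ?_, fun j => ?_, fun j => ?_,
    fun j => ?_⟩
  · change φ _ = _
    rw [hφ, h1]
    change unop (P (algebraMap K _ (σ a))) = _
    rw [AlgHom.commutes]
    rfl
  · change φ _ = _
    rw [hφ, h2, unop_op, U.lift_e]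
    rfl
  · change φ _ = _
    rw [hφ, h3, unop_op, map_smul, U.lift_f]
    rfl
  · change φ _ = _
    rw [hφ, h4, unop_op, U.lift_w']
    rfl
  · change φ _ = _
    rw [hφ, h5, unop_op, U.lift_w]
    rfl

end SemilinearReflection

end TwoParam

/-! ### The prescribed values are those of a reflection. -/

namespace TwoParam

section DividedPowers

variable {K A : Type*} [Field K] [Ring A] [Algebra K A]

theorem angleFact_zero (u v : K) : angleFact u v 0 = 1 := by simp [angleFact]

theorem angleFact_one {u v : K} (h : u ≠ v) : angleFact u v 1 = 1 := by
  have : v⁻¹ - u⁻¹ ≠ 0 := sub_ne_zero.2 (fun e => h (inv_injective e).symm)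
  simp [angleFact, angleInt, div_self this]

theorem angleFact_two {u v : K} (h : u ≠ v) : angleFact u v 2 = v⁻¹ + u⁻¹ := by
  have : v⁻¹ - u⁻¹ ≠ 0 := sub_ne_zero.2 (fun e => h (inv_injective e).symm)
  simp only [angleFact, angleInt, Finset.prod_range_succ, Finset.prod_range_zero, zero_add, pow_one,
    one_mul, Nat.reduceAdd, div_self this]
  rw [div_eq_iff this]
  ring

/-- A quantum binomial expansion; the scalar is the coefficient of `x ^ M * y`, the term with `ν =
M`. For `M = 2` the half-integral powers only make sense with `u = r` and `v = s`. -/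
theorem sum_halfCoeff_eq_qad (r s u v : K) (M : ℕ) (hM : M ≤ 2) (hu : u ≠ 0) (hv : v ≠ 0)
    (huv : u ≠ v) (h2 : M = 2 → u = r ∧ v = s ∧ r + s ≠ 0) {p : K} (hp : p ≠ 0) (x y : A) :
    ∑ ν ∈ Finset.range (M + 1), ((-1) ^ ν * halfCoeff r s (-(M : ℤ)) ν * p⁻¹ ^ ν) •
        (divPow u v x ν * y * divPow u v x (M - ν)) =
      ((-1) ^ M * halfCoeff r s (-(M : ℤ)) M * p⁻¹ ^ M * (angleFact u v M)⁻¹) •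
        qad x p (u * v⁻¹) y M := by
  obtain rfl | rfl | rfl : M = 0 ∨ M = 1 ∨ M = 2 := by omega
  · simp [halfCoeff, divPow, angleFact_zero]
  · simp [Finset.sum_range_succ, halfCoeff, divPow, angleFact_zero, angleFact_one huv, qad_succ,
      qstep, smul_sub, smul_smul, inv_mul_cancel₀ hp]
    abel
  · obtain ⟨rfl, rfl, hs⟩ := h2 rfl
    simp only [Finset.sum_range_succ, Finset.sum_range_zero, divPow, angleFact_zero,
      angleFact_one huv, angleFact_two huv, qad_succ, qstep, qad_zero]
    norm_num [halfCoeff, angleFact_zero]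
    simp only [mul_sub, sub_mul, mul_smul_comm, smul_mul_assoc, mul_assoc, pow_two]
    match_scalars <;> field_simp <;> ring

theorem sum_halfCoeff'_eq_qad (r s u v : K) (M : ℕ) (hM : M ≤ 2) (hu : u ≠ 0) (hv : v ≠ 0)
    (huv : u ≠ v) (h2 : M = 2 → u = r ∧ v = s ∧ r + s ≠ 0) {p : K} (x y : A) :
    ∑ ν ∈ Finset.range (M + 1), ((-1) ^ ν * halfCoeff' r s (-(M : ℤ)) ν * p ^ ν) •
        (divPow u v x (M - ν) * y * divPow u v x ν) =
      (angleFact u v M)⁻¹ • qad x p (u * v⁻¹) y M := by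
  obtain rfl | rfl | rfl : M = 0 ∨ M = 1 ∨ M = 2 := by omega
  · simp [halfCoeff', divPow, angleFact_zero]
  · simp [Finset.sum_range_succ, halfCoeff', divPow, angleFact_zero, angleFact_one huv, qad_succ,
      qstep]
    abel
  · obtain ⟨rfl, rfl, hs⟩ := h2 rfl
    simp only [Finset.sum_range_succ, Finset.sum_range_zero, divPow, angleFact_zero,
      angleFact_one huv, angleFact_two huv, qad_succ, qstep, qad_zero]
    norm_num [halfCoeff', angleFact_zero]
    simp only [mul_sub, sub_mul, mul_smul_comm, smul_mul_assoc, mul_assoc, pow_two]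
    match_scalars <;> field_simp <;> ring

end DividedPowers

section Constants

variable {K : Type*} [Field K] {X : ClassicalType} {n : ℕ} {r s : K}

/-- The structure constant in the coefficients of the Lusztig symmetries whose leading term is the
one with the highest power of `e_i` on the right. -/
def lusztigPair (X : ClassicalType) (n : ℕ) (r s : K) (i j : Fin n) : K :=
  if X.isB then pair X n r s i j else pair X n r s j i

/-- The leading coefficient of the other Lusztig symmetries. -/
def lusztigLead (X : ClassicalType) (n : ℕ) (r s : K) (i j : Fin n) : K :=
  (-1) ^ cartanNat X n i j * halfCoeff r s (-(cartanNat X n i j : ℤ)) (cartanNat X n i j) *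
    (lusztigPair X n r s i j)⁻¹ ^ cartanNat X n i j

/-- The scalars by which `T_i(e_j)` differs from the iterated skew commutator. -/
def lusztigScaleE (X : ClassicalType) (n : ℕ) (r s : K) (i j : Fin n) : K :=
  if j = i then -1 else (if X.isB then 1 else lusztigLead X n r s i j) *
    (angleFact (r ^ sym X n i) (s ^ sym X n i) (cartanNat X n i j))⁻¹

/-- The scalars by which `T_i(f_j)` differs from the iterated skew commutator, up to `r_j s_j`. -/
def lusztigScaleF (X : ClassicalType) (n : ℕ) (r s : K) (i j : Fin n) : K :=
  if j = i then -pair X n r s i i else (r ^ sym X n j * s ^ sym X n j) ^ (deltaExp X n i j - 1) *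
    ((if X.isB then lusztigLead X n r s i j else 1) *
      (angleFact (r ^ sym X n i) (s ^ sym X n i) (cartanNat X n i j))⁻¹)

theorem cartanNat_le_two (i j : ℕ) : cartanNat X n i j ≤ 2 := by
  by_cases h : cartanNat X n i j = 0
  · omega
  · rcases cartanNat_cases i j h with h | h <;> omega

theorem sym_of_cartanNat_two {i j : ℕ} (hi : i < n) (hj : j < n) (h : cartanNat X n i j = 2) :
    sym X n i = 1 ∧ sym X n j = 2 := by
  rcases cartanNat_pair (X := X) hi hj with h | h | h | h <;> omega

/-- The extra factor `r_j s_j` is present exactly when the constant in the coefficients is a power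
of `s_i` rather than `r_i⁻¹`. Type `B` reverses both conventions and so falls under the same two
cases. -/
theorem deltaExp_lusztigPair (H : Admissible X n r s) {i j : Fin n} (hij : i ≠ j)
    (hm : cartanNat X n i j ≠ 0) :
    (deltaExp X n i j = 2 ∧ lusztigPair X n r s i j = (s ^ sym X n i) ^ cartanNat X n i j ∧
      ((cartanNat X n i j = 1 ∧ sym X n j = sym X n i) ∨
        (cartanNat X n i j = 2 ∧ sym X n i = 1 ∧ sym X n j = 2))) ∨
    (deltaExp X n i j = 1 ∧ cartanNat X n i j = 1 ∧ lusztigPair X n r s i j = (r ^ sym X n i)⁻¹) := by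
  have hc := (cartan_ne_zero_iff hij).2 hm
  have hm' := cartanNat_symm i.2 j.2 hm
  have er : (r ^ sym X n j) ^ cartanNat X n j i = (r ^ sym X n i) ^ cartanNat X n i j := by
    rw [← pow_mul, ← pow_mul, sym_mul_cartanNat j.2 i.2]
  have es : (s ^ sym X n j) ^ cartanNat X n j i = (s ^ sym X n i) ^ cartanNat X n i j := by
    rw [← pow_mul, ← pow_mul, sym_mul_cartanNat j.2 i.2]
  have cases_pair := cartanNat_pair (X := X) i.2 j.2
  -- Along an edge `i < j`, the entry `-2` can only be `a_ji` in type `B` and only `a_ij` in the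
  -- other types.
  have dir : ∀ i j : ℕ, i < j → j < n → cartanNat X n i j ≠ 0 →
      (X.isB = false → (cartanNat X n i j = 2 ∨ cartanNat X n j i = 1)) ∧
      (X.isB = true → cartanNat X n i j = 1) ∧ (X.isB = false → cartanNat X n j i = 1)
      ∧ (X.isB = true → cartanNat X n j i = 2 ∨ sym X n i = sym X n j) := by
    intro i j hij hj h
    cases X <;> simp [ClassicalType.isB, cartanNat, sym] at * <;> grind
  rcases lt_or_gt_of_ne hij with h | h
  · obtain ⟨d1, d2, d3, d4⟩ := dir i j h j.2 hm
    cases hB : X.isB with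
    | true =>
      refine .inr ⟨?_, d2 hB, ?_⟩
      · simp [deltaExp, hB, h.not_gt]
      · simp only [lusztigPair, hB, if_true]
        rw [pair_upper_of_ne_zero H.three_le h hm, er, d2 hB, pow_one]
    | false =>
      refine .inl ⟨?_, ?_, ?_⟩
      · simp [deltaExp, hB, h, hc]
      · simp only [lusztigPair, hB]
        exact pair_lower_of_ne_zero H.three_le h hm
      · have := d3 hB
        omega
  · obtain ⟨d1, d2, d3, d4⟩ := dir j i h i.2 hm'
    cases hB : X.isB with
    | true =>
      refine .inl ⟨?_, ?_, ?_⟩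
      · simp [deltaExp, hB, h, hc]
      · simp only [lusztigPair, hB, if_true]
        rw [pair_lower_of_ne_zero H.three_le h hm', es]
      · have := d2 hB
        have := d4 hB
        omega
    | false =>
      refine .inr ⟨?_, ?_, ?_⟩
      · simp [deltaExp, hB, h.not_gt]
      · exact d3 hB
      · simp only [lusztigPair, hB]
        have := pair_upper_of_ne_zero (r := r) (s := s) H.three_le h hm'
        rw [d3 hB, pow_one] at this
        exact this

theorem lusztigScale_self (i : Fin n) :
    lusztigScaleE X n r s i i * lusztigScaleF X n r s i i = pair X n r s i i := by
  simp [lusztigScaleE, lusztigScaleF]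

theorem commScale_mul_one_sub (H : Admissible X n r s) (i : Fin n) :
    commScale X n r s i * (1 - pair X n r s i i) = -(s ^ sym X n i)⁻¹ := by
  have h1 := pow_ne_zero (sym X n i) H.s_ne
  have h2 := H.sub_ne i
  rw [commScale, pair_self H.two_le]
  field_simp
  ring

/-- The scalars chosen in the definition of the symmetries, including the exponents `δ`, satisfy
exactly the normalization that `QG.refl` demands. -/
theorem lusztigScale_mul (H : Admissible X n r s) {i j : Fin n} (hij : i ≠ j) :
    lusztigScaleE X n r s i j * lusztigScaleF X n r s i j *
      PreQG.kap (pair X n r s) (commScale X n r s) i j (cartanNat X n i j) =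
        commScale X n r s j := by
  have e : lusztigScaleE X n r s i j * lusztigScaleF X n r s i j =
      (r ^ sym X n j * s ^ sym X n j) ^ (deltaExp X n i j - 1) * lusztigLead X n r s i j *
        (angleFact (r ^ sym X n i) (s ^ sym X n i) (cartanNat X n i j))⁻¹ ^ 2 := by
    simp only [lusztigScaleE, lusztigScaleF, if_neg hij.symm]
    split_ifs <;> ring
  rw [e, PreQG.kap, commScale_mul_one_sub H, pair_self H.two_le, lusztigLead]
  have hne : r ^ sym X n i ≠ s ^ sym X n i := sub_ne_zero.1 (H.sub_ne i)
  by_cases hm : cartanNat X n i j = 0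
  · have hd : deltaExp X n i j = 1 := by
      have : cartan X n i j = 0 := by rw [cartan_eq_of_ne hij, hm]; rfl
      simp [deltaExp, this]
    simp [hm, hd, angleFact_zero, halfCoeff]
  · have h1 := pow_ne_zero (sym X n i) H.r_ne
    have h2 := pow_ne_zero (sym X n i) H.s_ne
    rcases deltaExp_lusztigPair H hij hm with ⟨h3, h4, ⟨h5, h6⟩ | ⟨h5, h6, h7⟩⟩ | ⟨h3, h5, h4⟩
    · rw [h3, h4, h5, h6, Nat.cast_one, angleFact_one hne]
      simp only [halfCoeff, Finset.prod_range_one]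
      norm_num
      field_simp
    · rw [h6] at h1 h2 hne
      rw [h3, h4, h5, h6, h7, Nat.cast_two, angleFact_two hne]
      have := H.add_ne
      have hr := H.r_ne
      have hs := H.s_ne
      simp only [halfCoeff, Finset.prod_range_succ, Finset.prod_range_zero, qnum_one, zero_add]
      norm_num
      field_simp
      try ring
    · rw [h3, h4, h5, Nat.cast_one, angleFact_one hne]
      simp only [halfCoeff, Finset.prod_range_one]
      norm_num
      field_simp

end Constants

section Values

variable {K : Type*} [Field K] {X : ClassicalType} {n : ℕ} {r s : K}

theorem lusztigE_eq (H : Admissible X n r s) (i j : Fin n) :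
    (lusztigE i j : U X n r s) = (U.qg H).toPreQG.reflE (fun i j : Fin n => cartanNat X n i j) i
      (lusztigScaleE X n r s i) j := by
  rcases eq_or_ne i j with rfl | hij
  · rw [PreQG.reflE_self]
    simp [lusztigE, lusztigScaleE, U.qg]
  · rw [PreQG.reflE_of_ne _ hij, PreQG.es]
    have hne : r ^ sym X n i ≠ s ^ sym X n i := sub_ne_zero.1 (H.sub_ne i)
    have h2 : cartanNat X n i j = 2 → r ^ sym X n i = r ∧ s ^ sym X n i = s ∧ r + s ≠ 0 := by
      intro h
      rw [(sym_of_cartanNat_two i.2 j.2 h).1, pow_one, pow_one]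
      exact ⟨rfl, rfl, H.add_ne⟩
    simp only [lusztigE, if_neg hij.symm, cartan_eq_of_ne hij, neg_neg, Int.toNat_natCast,
      lusztigScaleE]
    split_ifs with hB
    · rw [sum_halfCoeff'_eq_qad _ _ _ _ _ (cartanNat_le_two _ _) (pow_ne_zero _ H.r_ne)
        (pow_ne_zero _ H.s_ne) hne h2, one_mul, ← pair_self H.two_le]
      rfl
    · rw [sum_halfCoeff_eq_qad _ _ _ _ _ (cartanNat_le_two _ _) (pow_ne_zero _ H.r_ne)
        (pow_ne_zero _ H.s_ne) hne h2 (H.pair_ne _ _), ← pair_self H.two_le]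
      simp only [lusztigLead, lusztigPair, hB]
      rfl

theorem lusztigF_eq (H : Admissible X n r s) (i j : Fin n) :
    (lusztigF i j : U X n r s) = (r ^ sym X n j * s ^ sym X n j) •
      (U.qg H).toPreQG.dual.reflE (fun i j : Fin n => cartanNat X n i j) i
        (lusztigScaleF X n r s i) j := by
  rcases eq_or_ne i j with rfl | hij
  · rw [PreQG.reflE_self]
    have h1 : QComm (pair X n r s i i)⁻¹ (wInv i : U X n r s) (e i) :=
      ((U.qg H).w_e i i).units_inv (H.pair_ne _ _)
    unfold QComm at h1
    simp only [lusztigF, lusztigScaleF, if_true]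
    change _ = _ • (-pair X n r s i i) • (wInv i * e i)
    rw [h1, smul_smul (-pair X n r s i i), neg_mul, mul_inv_cancel₀ (H.pair_ne _ _), neg_smul,
      one_smul, smul_neg]
  · rw [PreQG.reflE_of_ne _ hij, PreQG.es]
    have hne : r ^ sym X n i ≠ s ^ sym X n i := sub_ne_zero.1 (H.sub_ne i)
    have h2 : cartanNat X n i j = 2 → r ^ sym X n i = r ∧ s ^ sym X n i = s ∧ r + s ≠ 0 := by
      intro h
      rw [(sym_of_cartanNat_two i.2 j.2 h).1, pow_one, pow_one]
      exact ⟨rfl, rfl, H.add_ne⟩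
    -- One factor `r_j s_j` comes from the anti-automorphism `τ`; the remaining `δ - 1` belong to
    -- the reflection.
    have hd : deltaExp X n i j = deltaExp X n i j - 1 + 1 := by
      unfold deltaExp; split_ifs <;> rfl
    simp only [lusztigF, if_neg hij.symm, cartan_eq_of_ne hij, neg_neg, Int.toNat_natCast,
      lusztigScaleF]
    rw [hd, Nat.add_sub_cancel, pow_succ']
    split_ifs with hB
    · rw [sum_halfCoeff_eq_qad _ _ _ _ _ (cartanNat_le_two _ _) (pow_ne_zero _ H.r_ne)
        (pow_ne_zero _ H.s_ne) hne h2 (H.pair_ne _ _), ← pair_self H.two_le]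
      simp only [lusztigLead, lusztigPair, hB, if_true, mul_smul]
      rfl
    · rw [sum_halfCoeff'_eq_qad _ _ _ _ _ (cartanNat_le_two _ _) (pow_ne_zero _ H.r_ne)
        (pow_ne_zero _ H.s_ne) hne h2, ← pair_self H.two_le, one_mul, smul_smul, smul_smul, mul_assoc]
      rfl

theorem mul_wPow_eq (H : Admissible X n r s) (i j : Fin n) :
    (w j * wPow i (-cartan X n i j) : U X n r s) =
      ((U.qg H).toPreQG.reflW (fun i j : Fin n => cartanNat X n i j) i j : U X n r s) := by
  rcases eq_or_ne i j with rfl | hij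
  · rw [PreQG.reflW_self, cartan_self]
    -- The exponent is `-2 = Int.negSucc 1`, so the power is by definition `wInv i ^ 2`.
    change w i * wInv i ^ 2 = wInv i
    rw [pow_two, ← mul_assoc, U.w_mul_wInv, one_mul]
  · rw [PreQG.reflW_of_ne _ hij, cartan_eq_of_ne hij, neg_neg, Units.val_mul,
      Units.val_pow_eq_pow_val]
    rfl

theorem mul_w'Pow_eq (H : Admissible X n r s) (i j : Fin n) :
    (w' j * w'Pow i (-cartan X n i j) : U X n r s) =
      ((U.qg H).toPreQG.dual.reflW (fun i j : Fin n => cartanNat X n i j) i j : U X n r s) := by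
  rcases eq_or_ne i j with rfl | hij
  · rw [PreQG.reflW_self, cartan_self]
    change w' i * w'Inv i ^ 2 = w'Inv i
    rw [pow_two, ← mul_assoc, U.w'_mul_w'Inv, one_mul]
  · rw [PreQG.reflW_of_ne _ hij, cartan_eq_of_ne hij, neg_neg, Units.val_mul,
      Units.val_pow_eq_pow_val]
    rfl

/-- The Lusztig symmetries, before the identification with the associated quantum group. -/
theorem U.exists_lusztig (H : Admissible X n r s) {σ : K ≃+* K} (hσ : IsSwap r s σ) {i : Fin n}
    (h : ReflData (pair X n r s) (fun i j : Fin n => cartanNat X n i j) i) :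
    ∃ T : U X n r s ≃+* U X n r s, (∀ a, T (algebraMap K _ a) = algebraMap K _ (σ a)) ∧
      (∀ j, T (e j) = lusztigE i j) ∧ (∀ j, T (f j) = lusztigF i j) ∧
      (∀ j, T (w j) = w j * wPow i (-cartan X n i j)) ∧
      (∀ j, T (w' j) = w' j * w'Pow i (-cartan X n i j)) := by
  obtain ⟨T, h1, h2, h3, h4, h5⟩ := U.exists_reflection H hσ h (lusztigScale_self i)
    (fun j hij => lusztigScale_mul H hij)
  refine ⟨T, h1, fun j => ?_, fun j => ?_, fun j => ?_, fun j => ?_⟩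
  · rw [h2, lusztigE_eq H]; rfl
  · rw [h3, lusztigF_eq H]; rfl
  · rw [h4, mul_wPow_eq H]; rfl
  · rw [h5, mul_w'Pow_eq H]; rfl

/-- A symmetry of `U_{r,s}(𝔤)` with the values of the Lusztig symmetry, followed by the
identification with the associated quantum group. -/
theorem isLusztigSymmetry_comp (Θ : U X n r s ≃ₐ[K] U X n s⁻¹ r⁻¹) {σ : K ≃+* K} {i : Fin n}
    {T : U X n r s ≃+* U X n r s} (h1 : ∀ a, T (algebraMap K _ a) = algebraMap K _ (σ a))
    (h2 : ∀ j, T (e j) = lusztigE i j) (h3 : ∀ j, T (f j) = lusztigF i j)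
    (h4 : ∀ j, T (w j) = w j * wPow i (-cartan X n i j))
    (h5 : ∀ j, T (w' j) = w' j * w'Pow i (-cartan X n i j)) :
    IsLusztigSymmetry Θ σ i ((Θ : U X n r s →+* U X n s⁻¹ r⁻¹).comp (T : U X n r s →+* U X n r s)) where
  map_scalar c := by
    change Θ (T _) = _
    rw [h1, AlgEquiv.commutes]
  map_w j := congrArg Θ (h4 j)
  map_w' j := congrArg Θ (h5 j)
  map_e j := congrArg Θ (h2 j)
  map_f j := congrArg Θ (h3 j)

end Values

end TwoParam

/-! ### When the conditions for a reflection hold. -/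

namespace TwoParam

section ReflectionData

variable {K : Type*} [Field K] {X : ClassicalType} {n : ℕ} {r s : K}

theorem Admissible.rank_two (H : Admissible X n r s) (i j : Fin n) :
    (cartanNat X n i j = 0 ∧ cartanNat X n j i = 0) ∨
    (cartanNat X n i j = 1 ∧ cartanNat X n j i = 1) ∨
    (cartanNat X n i j = 2 ∧ cartanNat X n j i = 1 ∧ 1 + pair X n r s i i ≠ 0) ∨
    (cartanNat X n i j = 1 ∧ cartanNat X n j i = 2) := by
  rcases cartanNat_pair (X := X) i.2 j.2 with h | h | h | h
  · exact .inl h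
  · exact .inr (.inl ⟨h.1, h.2.1⟩)
  · refine .inr (.inr (.inl ⟨h.1, h.2.1, ?_⟩))
    rw [pair_self H.two_le, h.2.2.1, pow_one, pow_one]
    intro h'
    apply H.add_ne
    have := H.s_ne
    field_simp at h'
    rw [add_comm, h', mul_zero]
  · exact .inr (.inr (.inr ⟨h.1, h.2.1⟩))

theorem Admissible.pair_cartan (H : Admissible X n r s) (i j : Fin n) (h : i ≠ j) :
    pair X n r s i j * pair X n r s j i * pair X n r s i i ^ cartanNat X n i j = 1 :=
  TwoParam.pair_cartan H.r_ne H.s_ne H.two_le H.three_le h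

/-- Both `inv` and `num` concern three distinct nodes, hence are empty here; this is why rank two
puts no condition on `rs`. -/
theorem reflData_rank_two (H : Admissible X 2 r s) (i : Fin 2) :
    ReflData (pair X 2 r s) (fun i j : Fin 2 => cartanNat X 2 i j) i where
  p_ne := H.pair_ne
  cart := H.pair_cartan
  rank_two j _ := H.rank_two i j
  inv j k hij hik hjk := by omega
  num j k hij hik hjk := by omega

theorem pair_of_mul_eq_one (H : Admissible X n r s) (hrs : r * s = 1) {i j : Fin n} (h : i ≠ j) :
    pair X n r s i j = (r ^ (sym X n i * cartanNat X n i j))⁻¹ := by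
  have hs : s = r⁻¹ := eq_inv_of_mul_eq_one_right hrs
  rcases lt_or_gt_of_ne h with h | h
  · rw [pair_upper H.three_le h, hrs, one_pow, mul_one, ← pow_mul, sym_mul_cartanNat j.2 i.2]
  · rw [pair_lower H.three_le h, hrs, one_pow, mul_one, ← pow_mul, sym_mul_cartanNat j.2 i.2, hs,
      inv_pow]

theorem pair_self_of_mul_eq_one (H : Admissible X n r s) (hrs : r * s = 1) (i : Fin n) :
    pair X n r s i i = r ^ (2 * sym X n i) := by
  have hs : s⁻¹ = r := (eq_inv_of_mul_eq_one_left hrs).symm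
  rw [pair_self H.two_le, ← inv_pow, hs, ← pow_add, two_mul]

/-- With `p i i = (r / s) ^ d_i`, these bounds ask that `(r / s) ^ t ≠ 1` for `t ≤ 2` in general,
and also for `t = 3, 4` in types `B` and `C`. -/
theorem string_length_le (hD : X = .D → 3 ≤ n) {i j k : ℕ} (hi : i < n) (hj : j < n) (hk : k < n)
    (hik : i ≠ k) (hjk : j ≠ k) :
    (sym X n i = 1 ∧ (cartanNat X n j k + 1) * cartanNat X n i j + cartanNat X n i k ≤ 2) ∨
    ((X = .B ∨ X = .C) ∧ sym X n i = 1 ∧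
      (cartanNat X n j k + 1) * cartanNat X n i j + cartanNat X n i k ≤ 4) ∨
    ((X = .B ∨ X = .C) ∧ sym X n i = 2 ∧
      (cartanNat X n j k + 1) * cartanNat X n i j + cartanNat X n i k ≤ 2) := by
  cases X <;> simp only [cartanNat, sym, reduceCtorEq, or_true, true_and, or_self,
    false_and, or_false] <;> split_ifs <;> omega

theorem qnum_ne_zero {Q : K} {t : ℕ} (h : Q ^ t ≠ 1) : qnum Q t ≠ 0 := fun e => h (by
  have := qnum_mul Q t
  rw [e] at this
  rw [zero_mul] at this
  exact (sub_eq_zero.1 this.symm).symm)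

/-- If `rs = 1`, then `p i j = r ^ (d_i a_ij)` is a symmetric form in the exponent, invariant under
reflections. -/
theorem reflData_of_mul_eq_one (H : Admissible X n r s) (hrs : r * s = 1)
    (hBC : X = .B ∨ X = .C → r ^ 3 ≠ s ^ 3 ∧ r ^ 4 ≠ s ^ 4) (i : Fin n) :
    ReflData (pair X n r s) (fun i j : Fin n => cartanNat X n i j) i where
  p_ne := H.pair_ne
  cart := H.pair_cartan
  rank_two j _ := H.rank_two i j
  inv j k hij hik hjk := by
    have hr := H.r_ne
    rw [pair_of_mul_eq_one H hrs hjk.symm, pair_of_mul_eq_one H hrs hjk,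
      pair_of_mul_eq_one H hrs hij.symm, pair_of_mul_eq_one H hrs hik,
      pair_self_of_mul_eq_one H hrs, sym_mul_cartanNat k.2 j.2, sym_mul_cartanNat j.2 i.2,
      mul_assoc, mul_assoc]
    convert (mul_one _).symm using 2
    simp only [inv_pow, ← pow_mul]
    field_simp
    ring
  num j k hij hik hjk t h0 ht := by
    have hpow : ∀ k : ℕ, r ^ k ≠ s ^ k → r ^ (2 * k) ≠ 1 := by
      intro k hk e
      apply hk
      calc r ^ k = r ^ k * (r * s) ^ k := by rw [hrs, one_pow, mul_one]
        _ = r ^ (2 * k) * s ^ k := by rw [mul_pow]; ring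
        _ = s ^ k := by rw [e, one_mul]
    have h1 := hpow 1 (by simpa using H.ne)
    have h2 := hpow 2 H.sq_ne
    apply qnum_ne_zero
    rw [pair_self_of_mul_eq_one H hrs, ← pow_mul]
    rcases string_length_le (X := X) H.three_le i.2 j.2 k.2 (Fin.val_ne_of_ne hik)
      (Fin.val_ne_of_ne hjk) with ⟨h3, h4⟩ | ⟨hX, h3, h4⟩ | ⟨hX, h3, h4⟩
    · rw [h3]
      obtain rfl | rfl : t = 1 ∨ t = 2 := by omega
      · exact h1
      · exact h2
    · rw [h3]
      have h5 := hpow 3 (hBC hX).1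
      have h6 := hpow 4 (hBC hX).2
      obtain rfl | rfl | rfl | rfl : t = 1 ∨ t = 2 ∨ t = 3 ∨ t = 4 := by omega
      · exact h1
      · exact h2
      · exact h5
      · exact h6
    · rw [h3]
      have h6 := hpow 4 (hBC hX).2
      obtain rfl | rfl : t = 1 ∨ t = 2 := by omega
      · exact h2
      · exact h6

end ReflectionData

end TwoParam

/-! ### A Verma-type module, and the non-vanishing of the generators `e_k`. -/

namespace TwoParam

section SerreCommute

variable {K ι : Type*} [Field K] {p : ι → ι → K} {lam : ι → K} {A : Type*} [Ring A] [Algebra K A]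

/-- Even before Serre relations are imposed, their left sides commute with every `f k`: for `k = i`
the constant `loc` vanishes, for `k = j` the product in `e_fs` contains a zero factor, and otherwise
nothing interacts. -/
theorem PreQG.serre_f_commute [DecidableEq ι] (q : PreQG p lam A) (hp : ∀ i j, p i j ≠ 0) {i j : ι}
    (hij : i ≠ j) {M : ℕ} (hM : p i j * p j i * p i i ^ M = 1) (k : ι) :
    q.es i j (M + 1) * q.f k = q.f k * q.es i j (M + 1) := by
  rcases eq_or_ne k i with rfl | hki
  · have := q.es_f_self hp k j hij M hM M
    rw [PreQG.loc, inv_pow, mul_inv_cancel₀ (pow_ne_zero _ (hp _ _)), sub_self, mul_zero,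
      zero_smul, sub_eq_zero] at this
    exact this
  · rcases eq_or_ne k j with rfl | hkj
    · have := q.dual.e_fs (fun i j => hp j i) hij M (by rw [← hM]; ring) M
      rw [Finset.prod_range_succ, sub_self, mul_zero, mul_zero, zero_smul, sub_eq_zero,
        dual_fs] at this
      exact this.symm
    · exact q.es_f_ne i j k hki.symm hkj.symm _

end SerreCommute

section Verma

variable {K ι : Type*} [Field K]

/-- Left multiplication by a letter on the free module on words. -/
noncomputable def wordF (a : ι) : Module.End K (List ι →₀ K) :=
  Finsupp.lmapDomain K K (List.cons a)

/-- The diagonal operators on words. -/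
noncomputable def wordDiag (χ : List ι → K) : Module.End K (List ι →₀ K) :=
  Finsupp.linearCombination K (fun l => Finsupp.single l (χ l))

@[simp] theorem wordF_single (a : ι) (l : List ι) (c : K) :
    wordF a (Finsupp.single l c) = Finsupp.single (a :: l) c := by
  simp [wordF]

@[simp] theorem wordDiag_single (χ : List ι → K) (l : List ι) (c : K) :
    wordDiag χ (Finsupp.single l c) = Finsupp.single l (χ l * c) := by
  simp [wordDiag, mul_comm]

theorem word_ext {φ ψ : Module.End K (List ι →₀ K)}
    (h : ∀ l, φ (Finsupp.single l 1) = ψ (Finsupp.single l 1)) : φ = ψ :=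
  Finsupp.lhom_ext' fun l => LinearMap.ext_ring (h l)

theorem wordDiag_mul (χ χ' : List ι → K) : wordDiag χ * wordDiag χ' = wordDiag (χ * χ') :=
  word_ext fun l => by simp

theorem wordDiag_one : (wordDiag (fun _ => 1) : Module.End K (List ι →₀ K)) = 1 :=
  word_ext fun l => by simp

theorem wordDiag_apply (χ : List ι → K) (x : List ι →₀ K) (l : List ι) :
    wordDiag χ x l = χ l * x l := by
  classical
  induction x using Finsupp.induction_linear with
  | zero => simp
  | add x y hx hy => simp [hx, hy, mul_add]
  | single l' c =>
    rw [wordDiag_single, Finsupp.single_apply, Finsupp.single_apply]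
    split_ifs with h
    · rw [h]
    · simp

theorem wordF_apply_nil (a : ι) (x : List ι →₀ K) : wordF a x [] = 0 :=
  Finsupp.mapDomain_of_notMem_range _ _ (by simp)

/-- A diagonal operator with non-zero entries, as a unit. -/
noncomputable def wordUnit (χ : List ι → K) (h : ∀ l, χ l ≠ 0) : (Module.End K (List ι →₀ K))ˣ where
  val := wordDiag χ
  inv := wordDiag (fun l => (χ l)⁻¹)
  val_inv := by
    rw [wordDiag_mul, ← wordDiag_one]
    exact congrArg _ (funext fun l => mul_inv_cancel₀ (h l))
  inv_val := by
    rw [wordDiag_mul, ← wordDiag_one]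
    exact congrArg _ (funext fun l => inv_mul_cancel₀ (h l))

/-- The character of words with given values on letters. -/
def wordChar (c : K) (g : ι → K) (l : List ι) : K := c * (l.map g).prod

theorem wordChar_cons (c : K) (g : ι → K) (a : ι) (l : List ι) :
    wordChar c g (a :: l) = g a * wordChar c g l := by
  simp only [wordChar, List.map_cons, List.prod_cons]
  ring

theorem wordChar_ne_zero {c : K} {g : ι → K} (hc : c ≠ 0) (hg : ∀ a, g a ≠ 0) (l : List ι) :
    wordChar c g l ≠ 0 := by
  refine mul_ne_zero hc (List.prod_ne_zero ?_)
  simp [hg]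

theorem wordDiag_wordF (c : K) (g : ι → K) (a : ι) :
    QComm (g a) (wordDiag (wordChar c g)) (wordF a : Module.End K (List ι →₀ K)) := by
  refine word_ext fun l => ?_
  simp [wordChar_cons]

theorem wordDiag_comm (χ χ' : List ι → K) : wordDiag χ * wordDiag χ' = wordDiag χ' * wordDiag χ := by
  rw [wordDiag_mul, wordDiag_mul, mul_comm]

variable [DecidableEq ι] (p : ι → ι → K) (lam : ι → K)

/-- The eigenvalue on a word of `ω_i`. -/
def wordW (i : ι) : List ι → K := wordChar 1 (fun a => (p a i)⁻¹)

/-- The eigenvalue on a word of `ω_i'`. -/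
def wordV (i : ι) : List ι → K := wordChar 2 (fun a => p i a)

/-- The action of `e_i` on a word. -/
noncomputable def wordEAux (i : ι) : List ι → (List ι →₀ K)
  | [] => 0
  | a :: l => wordF a (wordEAux i l) +
      Finsupp.single l (if i = a then lam i * (wordW p i l - wordV p i l) else 0)

/-- The skew derivation by which `e_i` acts on the Verma module. -/
noncomputable def wordE (i : ι) : Module.End K (List ι →₀ K) :=
  Finsupp.linearCombination K (wordEAux p lam i)

theorem wordE_single (i : ι) (l : List ι) :
    wordE p lam i (Finsupp.single l 1) = wordEAux p lam i l := by
  simp [wordE]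

theorem wordDiag_wordE (c : K) (g : ι → K) (hg : ∀ a, g a ≠ 0) (i : ι) :
    QComm (g i)⁻¹ (wordDiag (wordChar c g)) (wordE p lam i) := by
  refine word_ext fun l => ?_
  have h : wordDiag (wordChar c g) (wordEAux p lam i l) =
      ((g i)⁻¹ * wordChar c g l) • wordEAux p lam i l := by
    induction l with
    | nil => simp [wordEAux]
    | cons a l ih =>
      have h1 := DFunLike.congr_fun (wordDiag_wordF c g a) (wordEAux p lam i l)
      change wordDiag (wordChar c g) (wordF a (wordEAux p lam i l)) =
        g a • wordF a (wordDiag (wordChar c g) (wordEAux p lam i l)) at h1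
      simp only [wordEAux, map_add, smul_add, h1, ih, map_smul, wordDiag_single, wordChar_cons,
        smul_smul, Finsupp.smul_single, smul_eq_mul]
      congr 2
      · ring_nf
      · split_ifs with h
        · subst h
          rw [inv_mul_cancel_left₀ (hg i)]
        · simp
  change wordDiag _ (wordE p lam i _) = (g i)⁻¹ • wordE p lam i (wordDiag _ _)
  rw [wordE_single, h, wordDiag_single, mul_one, ← smul_eq_mul, smul_assoc,
    show Finsupp.single l (wordChar c g l) = wordChar c g l • Finsupp.single l (1 : K) by simp,
    map_smul, wordE_single]

theorem wordE_wordF (i a : ι) :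
    wordE p lam i * wordF a - wordF a * wordE p lam i =
      if i = a then lam i • (wordDiag (wordW p i) - wordDiag (wordV p i)) else 0 := by
  refine word_ext fun l => ?_
  change wordE p lam i (wordF a _) - wordF a (wordE p lam i _) = _
  rw [wordF_single, wordE_single, wordE_single, wordEAux, add_sub_cancel_left]
  split_ifs
  · rw [LinearMap.smul_apply, LinearMap.sub_apply, wordDiag_single, wordDiag_single, mul_one,
      mul_one, ← Finsupp.single_sub, Finsupp.smul_single, smul_eq_mul]
  · simp

variable {p}

/-- The Verma module, for the free algebra on the `f_i`. -/
noncomputable def wordPreQG (h2 : (2 : K) ≠ 0) (hp : ∀ i j, p i j ≠ 0) :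
    PreQG p lam (Module.End K (List ι →₀ K)) where
  e := wordE p lam
  f := wordF
  w i := wordUnit (wordW p i) (wordChar_ne_zero one_ne_zero fun _ => inv_ne_zero (hp _ _))
  v i := wordUnit (wordV p i) (wordChar_ne_zero h2 fun _ => hp _ _)
  w_w _ _ := Units.ext (wordDiag_comm _ _)
  w_v _ _ := Units.ext (wordDiag_comm _ _)
  v_v _ _ := Units.ext (wordDiag_comm _ _)
  w_e i j := (wordDiag_wordE p lam 1 (fun a => (p a j)⁻¹) (fun _ => inv_ne_zero (hp _ _)) i).of_eq
    (inv_inv _)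
  w_f i j := wordDiag_wordF 1 (fun a => (p a j)⁻¹) i
  v_e i j := wordDiag_wordE p lam 2 (fun a => p j a) (fun _ => hp _ _) i
  v_f i j := wordDiag_wordF 2 (fun a => p j a) i
  e_f i := (wordE_wordF p lam i i).trans (if_pos rfl)
  e_f_ne i j h := sub_eq_zero.1 ((wordE_wordF p lam i j).trans (if_neg h))

variable (p)

/-- The composites of the `e_i`. -/
noncomputable def wordEs : List ι → Module.End K (List ι →₀ K)
  | [] => 1
  | a :: t => wordEs t * wordE p lam a

/-- The vectors which cannot be moved to the highest weight space. -/
noncomputable def wordRadical : Submodule K (List ι →₀ K) :=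
  ⨅ t : List ι, LinearMap.ker ((Finsupp.lapply []).comp (wordEs p lam t))

theorem mem_wordRadical {x : List ι →₀ K} :
    x ∈ wordRadical p lam ↔ ∀ t, wordEs p lam t x [] = 0 := by
  simp [wordRadical, Submodule.mem_iInf]

theorem wordE_mem {x : List ι →₀ K} (hx : x ∈ wordRadical p lam) (a : ι) :
    wordE p lam a x ∈ wordRadical p lam :=
  (mem_wordRadical p lam).2 fun t => (mem_wordRadical p lam).1 hx (a :: t)

theorem wordDiag_mem {x : List ι →₀ K} (hx : x ∈ wordRadical p lam) (c : K) (g : ι → K)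
    (hg : ∀ a, g a ≠ 0) : wordDiag (wordChar c g) x ∈ wordRadical p lam := by
  refine (mem_wordRadical p lam).2 fun t => ?_
  induction t generalizing x with
  | nil =>
    have := (mem_wordRadical p lam).1 hx []
    simp only [wordEs, Module.End.one_apply] at this ⊢
    rw [wordDiag_apply, this, mul_zero]
  | cons a t ih =>
    have h := DFunLike.congr_fun ((wordDiag_wordE p lam c g hg a).symm (inv_ne_zero (hg a))) x
    change wordE p lam a (wordDiag (wordChar c g) x) =
      (g a)⁻¹⁻¹ • wordDiag (wordChar c g) (wordE p lam a x) at h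
    change wordEs p lam t (wordE p lam a (wordDiag (wordChar c g) x)) [] = 0
    rw [h, map_smul, Finsupp.smul_apply, ih (wordE_mem p lam hx a), smul_zero]

variable {p}

theorem wordW_mem (hp : ∀ i j, p i j ≠ 0) {x : List ι →₀ K} (hx : x ∈ wordRadical p lam) (i : ι) :
    wordDiag (wordW p i) x ∈ wordRadical p lam :=
  wordDiag_mem p lam hx _ _ fun _ => inv_ne_zero (hp _ _)

theorem wordV_mem (hp : ∀ i j, p i j ≠ 0) {x : List ι →₀ K} (hx : x ∈ wordRadical p lam) (i : ι) :
    wordDiag (wordV p i) x ∈ wordRadical p lam :=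
  wordDiag_mem p lam hx _ _ fun _ => hp _ _

/-- Moving an `e` past `f a` leaves only diagonal operators, which preserve the radical, and a word
starting with a letter has no component at the empty word. -/
theorem wordF_mem (hp : ∀ i j, p i j ≠ 0) {x : List ι →₀ K} (hx : x ∈ wordRadical p lam) (a : ι) :
    wordF a x ∈ wordRadical p lam := by
  refine (mem_wordRadical p lam).2 fun t => ?_
  induction t generalizing x with
  | nil => exact wordF_apply_nil a x
  | cons b t ih =>
    have h := DFunLike.congr_fun (wordE_wordF p lam b a) x
    change wordE p lam b (wordF a x) - wordF a (wordE p lam b x) = _ at h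
    change wordEs p lam t (wordE p lam b (wordF a x)) [] = 0
    rw [sub_eq_iff_eq_add.1 h, map_add, Finsupp.add_apply, ih (wordE_mem p lam hx b), add_zero]
    split_ifs
    · have h1 := (mem_wordRadical p lam).1 (wordW_mem lam hp hx b) t
      have h2 := (mem_wordRadical p lam).1 (wordV_mem lam hp hx b) t
      rw [LinearMap.smul_apply, LinearMap.sub_apply, map_smul, map_sub, Finsupp.smul_apply,
        Finsupp.sub_apply, h1, h2, sub_zero, smul_zero]
    · simp

end Verma

section Quotient

variable {K : Type*} [Field K] {M : Type*} [AddCommGroup M] [Module K M]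

theorem qad_intertwine {M' : Type*} [AddCommGroup M'] [Module K M'] (π : M →ₗ[K] M')
    {x y : Module.End K M} {x' y' : Module.End K M'} (hx : ∀ v, π (x v) = x' (π v))
    (hy : ∀ v, π (y v) = y' (π v)) (c Q : K) (n : ℕ) (v : M) :
    π (qad x c Q y n v) = qad x' c Q y' n (π v) := by
  induction n generalizing v with
  | zero => exact hy v
  | succ n ih =>
    simp only [qad_succ, qstep, LinearMap.sub_apply, LinearMap.smul_apply, Module.End.mul_apply,
      map_sub, map_smul, hx, ih]

/-- A unit of the endomorphism ring, on a quotient. -/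
def quotUnit (N : Submodule K M) (u : (Module.End K M)ˣ) (h : N ≤ N.comap (u : Module.End K M))
    (h' : N ≤ N.comap ((u⁻¹ : (Module.End K M)ˣ) : Module.End K M)) : (Module.End K (M ⧸ N))ˣ where
  val := N.mapQ N u h
  inv := N.mapQ N ((u⁻¹ : (Module.End K M)ˣ) : Module.End K M) h'
  val_inv := N.linearMap_qext (LinearMap.ext fun x =>
    congrArg N.mkQ (DFunLike.congr_fun u.mul_inv x))
  inv_val := N.linearMap_qext (LinearMap.ext fun x =>
    congrArg N.mkQ (DFunLike.congr_fun u.inv_mul x))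

/-- The structure on a quotient module, when the quantum Serre relations hold there. -/
def PreQG.quotient {ι : Type*} {p : ι → ι → K} {lam : ι → K} {m : ι → ι → ℕ}
    (q : PreQG p lam (Module.End K M)) (N : Submodule K M)
    (he : ∀ i, N ≤ N.comap (q.e i)) (hf : ∀ i, N ≤ N.comap (q.f i))
    (hw : ∀ i, N ≤ N.comap (q.w i : Module.End K M))
    (hw' : ∀ i, N ≤ N.comap (((q.w i)⁻¹ : (Module.End K M)ˣ) : Module.End K M))
    (hv : ∀ i, N ≤ N.comap (q.v i : Module.End K M))
    (hv' : ∀ i, N ≤ N.comap (((q.v i)⁻¹ : (Module.End K M)ˣ) : Module.End K M))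
    (hse : ∀ i j, i ≠ j → ∀ x, qad (q.e i) (p j i) (p i i) (q.e j) (m i j + 1) x ∈ N)
    (hsf : ∀ i j, i ≠ j → ∀ x, qad (q.f i) (p i j) (p i i) (q.f j) (m i j + 1) x ∈ N) :
    QG p lam m (Module.End K (M ⧸ N)) where
  e i := N.mapQ N (q.e i) (he i)
  f i := N.mapQ N (q.f i) (hf i)
  w i := quotUnit N (q.w i) (hw i) (hw' i)
  v i := quotUnit N (q.v i) (hv i) (hv' i)
  w_w i j := Units.ext (N.linearMap_qext (LinearMap.ext fun x =>
    congrArg N.mkQ (DFunLike.congr_fun (congrArg Units.val (q.w_w i j)) x)))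
  w_v i j := Units.ext (N.linearMap_qext (LinearMap.ext fun x =>
    congrArg N.mkQ (DFunLike.congr_fun (congrArg Units.val (q.w_v i j)) x)))
  v_v i j := Units.ext (N.linearMap_qext (LinearMap.ext fun x =>
    congrArg N.mkQ (DFunLike.congr_fun (congrArg Units.val (q.v_v i j)) x)))
  w_e i j := N.linearMap_qext (LinearMap.ext fun x =>
    congrArg N.mkQ (DFunLike.congr_fun (q.w_e i j) x))
  w_f i j := N.linearMap_qext (LinearMap.ext fun x =>
    congrArg N.mkQ (DFunLike.congr_fun (q.w_f i j) x))
  v_e i j := N.linearMap_qext (LinearMap.ext fun x =>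
    congrArg N.mkQ (DFunLike.congr_fun (q.v_e i j) x))
  v_f i j := N.linearMap_qext (LinearMap.ext fun x =>
    congrArg N.mkQ (DFunLike.congr_fun (q.v_f i j) x))
  e_f i := N.linearMap_qext (LinearMap.ext fun x =>
    congrArg N.mkQ (DFunLike.congr_fun (q.e_f i) x))
  e_f_ne i j h := N.linearMap_qext (LinearMap.ext fun x =>
    congrArg N.mkQ (DFunLike.congr_fun (q.e_f_ne i j h) x))
  serre_e i j h := N.linearMap_qext (LinearMap.ext fun x =>
    (qad_intertwine N.mkQ (fun _ => rfl) (fun _ => rfl) _ _ _ x).symm.trans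
      ((Submodule.Quotient.mk_eq_zero N).2 (hse i j h x)))
  serre_f i j h := N.linearMap_qext (LinearMap.ext fun x =>
    (qad_intertwine N.mkQ (fun _ => rfl) (fun _ => rfl) _ _ _ x).symm.trans
      ((Submodule.Quotient.mk_eq_zero N).2 (hsf i j h x)))

end Quotient

section NonZero

variable {K ι : Type*} [Field K] [DecidableEq ι] {p : ι → ι → K} {lam : ι → K} {m : ι → ι → ℕ}

/-- The Serre element kills the empty word and commutes with all `f`'s, which generate the module
from that word. -/
theorem wordE_serre (h2 : (2 : K) ≠ 0) (hp : ∀ i j, p i j ≠ 0) {i j : ι} (hij : i ≠ j) {k : ℕ}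
    (hk : p i j * p j i * p i i ^ k = 1) :
    qad (wordE p lam i) (p j i) (p i i) (wordE p lam j) (k + 1) = 0 := by
  have hc := (wordPreQG lam h2 hp).serre_f_commute hp hij hk
  refine word_ext fun l => ?_
  induction l with
  | nil =>
    have h0 : ∀ i, wordE p lam i (Finsupp.single [] 1) = 0 := fun i => by
      rw [wordE_single, wordEAux]
    have : ∀ n, qad (wordE p lam i) (p j i) (p i i) (wordE p lam j) n (Finsupp.single [] 1) = 0 := by
      intro n
      induction n with
      | zero => exact h0 j
      | succ n ih =>
        simp only [qad_succ, qstep, LinearMap.sub_apply, LinearMap.smul_apply,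
          Module.End.mul_apply, ih, h0, map_zero, smul_zero, sub_zero]
    exact this _
  | cons a l ih =>
    rw [← wordF_single]
    have := DFunLike.congr_fun (hc a) (Finsupp.single l 1)
    change qad (wordE p lam i) (p j i) (p i i) (wordE p lam j) (k + 1) (wordF a _) =
      wordF a (qad (wordE p lam i) (p j i) (p i i) (wordE p lam j) (k + 1) _) at this
    rw [this, ih]
    simp

/-- The Serre element in the `f`'s need not vanish on words, but it commutes with all `e`'s and
never produces the empty word. Its image therefore lies in the radical. -/
theorem wordF_serre_mem (h2 : (2 : K) ≠ 0) (hp : ∀ i j, p i j ≠ 0) {i j : ι} (hij : i ≠ j) {k : ℕ}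
    (hk : p i j * p j i * p i i ^ k = 1) (x : List ι →₀ K) :
    qad (wordF i) (p i j) (p i i) (wordF j) (k + 1) x ∈ wordRadical p lam := by
  have hc := (wordPreQG lam h2 hp).dual.serre_f_commute (fun i j => hp j i) hij
    (by rw [← hk]; ring)
  have h0 : ∀ n (x : List ι →₀ K), qad (wordF i) (p i j) (p i i) (wordF j) n x [] = 0 := by
    intro n
    induction n with
    | zero => exact wordF_apply_nil j
    | succ n ih =>
      intro x
      simp only [qad_succ, qstep, LinearMap.sub_apply, LinearMap.smul_apply, Module.End.mul_apply,
        Finsupp.sub_apply, Finsupp.smul_apply, wordF_apply_nil, ih, smul_zero, sub_zero]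
  refine (mem_wordRadical p lam).2 fun t => ?_
  induction t generalizing x with
  | nil => exact h0 (k + 1) x
  | cons a t ih =>
    have := DFunLike.congr_fun (hc a) x
    change qad (wordF i) (p i j) (p i i) (wordF j) (k + 1) (wordE p lam a x) =
      wordE p lam a (qad (wordF i) (p i j) (p i i) (wordF j) (k + 1) x) at this
    change wordEs p lam t (wordE p lam a _) [] = 0
    rw [← this]
    exact ih _

/-- A multiparameter quantum group acts on a module in such a way that no `e_k` acts by zero. -/
theorem exists_qg_e_ne_zero (h2 : (2 : K) ≠ 0) (hp : ∀ i j, p i j ≠ 0) (hl : ∀ i, lam i ≠ 0)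
    (hm : ∀ i j, i ≠ j → p i j * p j i * p i i ^ m i j = 1) :
    ∃ q : QG p lam m (Module.End K ((List ι →₀ K) ⧸ wordRadical p lam)), ∀ k, q.e k ≠ 0 := by
  have inv_char : ∀ (c : K) (g : ι → K),
      (fun l => (wordChar c g l)⁻¹) = wordChar c⁻¹ (fun a => (g a)⁻¹) := by
    intro c g
    funext l
    induction l with
    | nil => simp [wordChar]
    | cons a l ih => rw [wordChar_cons, mul_inv, ih, wordChar_cons]
  have hw' : ∀ i, wordRadical p lam ≤ (wordRadical p lam).comap
      (wordDiag (fun l => (wordW p i l)⁻¹)) := fun i x hx => by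
    rw [wordW, inv_char]
    exact wordDiag_mem p lam hx _ _ fun a => inv_ne_zero (inv_ne_zero (hp _ _))
  have hv' : ∀ i, wordRadical p lam ≤ (wordRadical p lam).comap
      (wordDiag (fun l => (wordV p i l)⁻¹)) := fun i x hx => by
    rw [wordV, inv_char]
    exact wordDiag_mem p lam hx _ _ fun a => inv_ne_zero (hp _ _)
  refine ⟨(wordPreQG lam h2 hp).quotient (wordRadical p lam) (fun i x hx => wordE_mem p lam hx i)
    (fun i x hx => wordF_mem lam hp hx i) (fun i x hx => wordW_mem lam hp hx i) hw'
    (fun i x hx => wordV_mem lam hp hx i) hv' (fun i j hij x => ?_)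
    (fun i j hij x => wordF_serre_mem h2 hp hij (hm i j hij) x), fun k hk => ?_⟩
  · change qad (wordE p lam i) (p j i) (p i i) (wordE p lam j) (m i j + 1) x ∈ _
    rw [wordE_serre h2 hp hij (hm i j hij)]
    exact Submodule.zero_mem _
  · have h : wordE p lam k (Finsupp.single [k] 1) ∈ wordRadical p lam :=
      (Submodule.Quotient.mk_eq_zero _).1
        (DFunLike.congr_fun hk (Submodule.Quotient.mk (Finsupp.single [k] 1)))
    -- On the word `[k]`, `e_k` gives `lam k * (1 - 2)` times the empty word. The highest weights of
    -- `w` and `v` were taken as 1 and 2 so that they are distinct and invertible.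
    have h' := (mem_wordRadical p lam).1 h []
    rw [wordE_single] at h'
    simp [wordEs, wordEAux, wordW, wordV, wordChar, hl] at h'
    norm_num at h'

end NonZero

section NonZero

variable {K : Type*} [Field K] [CharZero K] {X : ClassicalType} {n : ℕ} {r s : K}

theorem U.e_ne_zero (H : Admissible X n r s) (k : Fin n) : (e k : U X n r s) ≠ 0 := by
  obtain ⟨q, hq⟩ := exists_qg_e_ne_zero (m := fun i j : Fin n => cartanNat X n i j) two_ne_zero
    H.pair_ne H.commScale_ne H.pair_cartan
  intro h
  apply hq k
  rw [← U.lift_e H q, h, map_zero]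

end NonZero

end TwoParam

/-! ### Necessity of `rs = 1`. -/

namespace TwoParam

section Necessity

variable {K : Type*} [Field K] [CharZero K] {X : ClassicalType} {n : ℕ} {r s : K}

/-- As `a_ik = 0`, the symmetry sends `e k` to its copy. Transporting `ω_j e_k = p_kj e_k ω_j` gives
the scalar `σ (p_kj) = p_jk`, while the image `ω_j ω_i ^ m` of `ω_j` acts by the left side. The
scalars agree because `e k` is non-zero and the torus element invertible. -/
theorem IsLusztigSymmetry.pair_eq (H : Admissible X n r s) {Θ : U X n r s ≃ₐ[K] U X n s⁻¹ r⁻¹}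
    {σ : K ≃+* K} (hσ : IsSwap r s σ) {i : Fin n} {T : U X n r s →+* U X n s⁻¹ r⁻¹}
    (hT : IsLusztigSymmetry Θ σ i T) {j k : Fin n} (hij : i ≠ j) (hik : i ≠ k)
    (h : cartanNat X n i k = 0) :
    pair X n r s k j * pair X n r s k i ^ cartanNat X n i j = pair X n r s j k := by
  have hTe : T (e k) = Θ (e k) := by
    rw [hT.map_e, lusztigE_eq H, PreQG.reflE_of_ne _ hik]
    have hl : lusztigScaleE X n r s i k = 1 := by
      simp [lusztigScaleE, hik.symm, lusztigLead, h, halfCoeff, angleFact_zero]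
    simp only [hl, h, one_smul]
    rfl
  set W := (U.qg H).toPreQG.reflW (fun i j : Fin n => cartanNat X n i j) i j with hW
  have hTw : T (w j) = Θ (W : U X n r s) := by rw [hT.map_w, mul_wPow_eq H]
  have h1 : (w j * e k : U X n r s) = pair X n r s k j • (e k * w j) := (U.qg H).w_e k j
  have h2 : (W : U X n r s) * e k = pair X n r s j k • (e k * (W : U X n r s)) := by
    apply Θ.injective
    have := congrArg T h1
    rw [Algebra.smul_def, map_mul, map_mul, map_mul, hT.map_scalar, hTe, hTw] at this
    rw [map_mul, this, map_smul, map_mul, Algebra.smul_def]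
    congr 2
    exact hσ.map_pair H k j
  have h3 : (W : U X n r s) * e k = (pair X n r s k j * pair X n r s k i ^ cartanNat X n i j) •
      (e k * (W : U X n r s)) := by
    rw [hW, PreQG.reflW_of_ne _ hij]
    exact PreQG.qcomm_mul_pow ((U.qg H).w_e k j) ((U.qg H).w_e k i) rfl
  have h4 : e k * (W : U X n r s) ≠ 0 := by
    intro h0
    apply U.e_ne_zero H k
    calc e k = e k * (W : U X n r s) * ((W⁻¹ : (U X n r s)ˣ) : U X n r s) := by
          rw [mul_assoc, Units.mul_inv, mul_one]
      _ = 0 := by rw [h0, zero_mul]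
  by_contra hne
  apply h4
  have h5 := h3.symm.trans h2
  rw [← sub_eq_zero, ← sub_smul] at h5
  exact (smul_eq_zero_iff_right (sub_ne_zero.2 hne)).1 h5

theorem mul_eq_one_of_hasLusztigSymmetries (H : Admissible X n r s) (hn : 2 < n)
    {Θ : U X n r s ≃ₐ[K] U X n s⁻¹ r⁻¹} (hX : X = .B ∨ X = .D ∧ n = 3 → r * s ≠ -1)
    (h : HasLusztigSymmetries Θ) : r * s = 1 := by
  obtain ⟨σ, hσ, hT⟩ := h
  have hr := H.r_ne
  have hs := H.s_ne
  have of_sq : (X = .B ∨ X = .D ∧ n = 3) → (r * s) ^ 2 = 1 → r * s = 1 := fun h h2 =>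
    (sq_eq_sq_iff_eq_or_eq_neg.1 (h2.trans (one_pow 2).symm)).resolve_right (hX h)
  -- In `D_3` the last node is joined to the first, so the two orthogonal end nodes are used
  -- instead; they only yield `(rs)² = 1`.
  by_cases hD : X = .D ∧ n = 3
  · obtain ⟨rfl, rfl⟩ := hD
    obtain ⟨T, hT⟩ := hT 1
    have := hT.pair_eq H hσ (j := 0) (k := 2) (by decide) (by decide) (by simp [cartanNat])
    apply of_sq (.inr ⟨rfl, rfl⟩)
    simp [pair, pairExp, rootCoord, cartanNat] at this
    field_simp at this
    linear_combination this
  -- Take `i` last, `k` first and `j` second. The constant between `k` and `i` is 1, so the identity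
  -- reduces to symmetry between the first two nodes, that is `r ^ d * s ^ d = 1`. In type `B` one
  -- has `d = 2`, hence the assumption `rs ≠ -1`.
  · obtain ⟨T, hT⟩ := hT ⟨n - 1, by omega⟩
    have h0 : cartanNat X n (n - 1) 0 = 0 := by
      have h3 : X = .D → n ≠ 3 := fun h h' => hD ⟨h, h'⟩
      cases X <;> simp only [cartanNat, reduceCtorEq, true_imp_iff, false_or, false_and] at h3 ⊢ <;>
        split_ifs <;> omega
    have hlt : (⟨0, by omega⟩ : Fin n) < ⟨n - 1, by omega⟩ := Fin.mk_lt_mk.2 (by omega)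
    have h01 : (⟨0, by omega⟩ : Fin n) < ⟨1, by omega⟩ := Fin.mk_lt_mk.2 (by omega)
    have h0' : cartanNat X n 0 (n - 1) = 0 := by
      by_contra h'
      exact cartanNat_symm (X := X) (n := n) (by omega) (by omega) h' h0
    have hend : endNat X n 0 (n - 1) = 0 := by
      cases X <;> simp [endNat]
      omega
    have h1 := hT.pair_eq H hσ (j := ⟨1, by omega⟩) (k := ⟨0, by omega⟩)
      (by simp [Fin.ext_iff]; omega) hlt.ne' h0
    have hc : cartanNat X n 0 1 = 1 ∧ cartanNat X n 1 0 = 1 := by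
      cases X <;> simp [cartanNat] <;> grind
    rw [pair_upper H.three_le hlt, pair_upper_of_ne_zero H.three_le h01 (by simp [hc]),
      pair_lower_of_ne_zero H.three_le h01 (by simp [hc])] at h1
    simp only [h0, hend, hc, pow_zero, mul_one, inv_one, one_pow, pow_one] at h1
    have h2 : (r ^ sym X n 1) * (s ^ sym X n 0) = 1 := by
      rw [← h1, mul_inv_cancel₀ (pow_ne_zero _ hr)]
    cases X with
    | B =>
      apply of_sq (.inl rfl)
      simp only [sym, if_pos (show 1 + 1 < n by omega), if_pos (show 0 + 1 < n by omega)] at h2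
      rw [mul_pow, h2]
    | A => simpa [sym] using h2
    | C =>
      simp only [sym, if_pos (show 1 + 1 < n by omega), if_pos (show 0 + 1 < n by omega)] at h2
      simpa using h2
    | D => simpa [sym] using h2

end Necessity

end TwoParam

/-! ### The Drinfel'd–Jimbo quantum group as a quotient of `U_{q,q⁻¹}(𝔤)`. -/

namespace TwoParam

section OneParameter

variable {K : Type*} [Field K] {X : ClassicalType} {n : ℕ} {r s : K}

theorem pow_sym_of_mul_eq_one (hrs : r * s = 1) (k : ℕ) : s ^ k = (r ^ k)⁻¹ := by
  rw [eq_inv_of_mul_eq_one_right hrs, inv_pow]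

theorem pair_eq_zpow (H : Admissible X n r s) (hrs : r * s = 1) (i j : Fin n) :
    pair X n r s i j = (r ^ sym X n i) ^ cartan X n i j := by
  rcases eq_or_ne i j with rfl | h
  · rw [pair_self_of_mul_eq_one H hrs, cartan_self, mul_comm, pow_mul, zpow_ofNat]
  · rw [pair_of_mul_eq_one H hrs h, cartan_eq_of_ne h, zpow_neg, zpow_natCast, pow_mul]

theorem pair_symm (H : Admissible X n r s) (hrs : r * s = 1) (i j : Fin n) :
    pair X n r s i j = pair X n r s j i := by
  rcases eq_or_ne i j with rfl | h
  · rfl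
  · rw [pair_of_mul_eq_one H hrs h, pair_of_mul_eq_one H hrs h.symm, sym_mul_cartanNat i.2 j.2]

theorem serre_of_mul_eq_one (H : Admissible X n r s) (hrs : r * s = 1) {A : Type*} [Ring A]
    [Algebra K A] {i j : Fin n} (h : i ≠ j) (hm : cartanNat X n i j ≠ 0) (x y : A) :
    serre (cartan X n i j) (r ^ sym X n i) (r ^ sym X n i)⁻¹ x y =
      qad x (pair X n r s i j) (pair X n r s i i) y (cartanNat X n i j + 1) := by
  rw [cartan_eq_of_ne h, serre_eq_qad _ (cartanNat_cases _ _ hm) _ _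
    (inv_ne_zero (pow_ne_zero _ H.r_ne)), pair_of_mul_eq_one H hrs h,
    pair_self_of_mul_eq_one H hrs, inv_inv, inv_pow, ← pow_mul, ← pow_add, two_mul]

namespace Uq

/-- The projection of the free algebra. -/
noncomputable def mk : FreeAlgebra K (DJGen n) →ₐ[K] Uq X n r :=
  RingQuot.mkAlgHom K (DJRel X n r)

theorem mk_rel {x y : FreeAlgebra K (DJGen n)} (h : DJRel X n r x y) :
    (mk x : Uq X n r) = mk y := RingQuot.mkAlgHom_rel K h

section

variable (i : Fin n)

theorem mk_E : (mk (FreeAlgebra.ι K (.E i)) : Uq X n r) = E i := rfl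
theorem mk_F : (mk (FreeAlgebra.ι K (.F i)) : Uq X n r) = F i := rfl
theorem mk_k : (mk (FreeAlgebra.ι K (.k i)) : Uq X n r) = k i := rfl
theorem mk_kInv : (mk (FreeAlgebra.ι K (.kInv i)) : Uq X n r) = kInv i := rfl

/-- `K_i` as a unit. -/
noncomputable def kUnit : (Uq X n r)ˣ where
  val := k i
  inv := kInv i
  val_inv := by simpa [mk_k, mk_kInv] using mk_rel (DJRel.k_inv (X := X) (q := r) i)
  inv_val := by simpa [mk_k, mk_kInv] using mk_rel (DJRel.inv_k (X := X) (q := r) i)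

@[simp] theorem coe_kUnit : ((kUnit i : (Uq X n r)ˣ) : Uq X n r) = k i := rfl
@[simp] theorem coe_kUnit_inv : (((kUnit i)⁻¹ : (Uq X n r)ˣ) : Uq X n r) = kInv i := rfl

end

theorem kUnit_comm (i j : Fin n) : Commute (kUnit i : (Uq X n r)ˣ) (kUnit j) :=
  Units.ext (by simpa [mk_k] using mk_rel (DJRel.k_comm (X := X) (q := r) i j))

theorem k_E (H : Admissible X n r s) (hrs : r * s = 1) (i j : Fin n) :
    QComm (pair X n r s i j) ((kUnit j : (Uq X n r)ˣ) : Uq X n r) (E i) := by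
  apply qcomm_of_conj
  rw [pair_symm H hrs, pair_eq_zpow H hrs]
  simpa [mk_E, mk_k, mk_kInv] using mk_rel (DJRel.k_E (X := X) (q := r) j i)

theorem k_F (H : Admissible X n r s) (hrs : r * s = 1) (i j : Fin n) :
    QComm (pair X n r s i j)⁻¹ ((kUnit j : (Uq X n r)ˣ) : Uq X n r) (F i) := by
  apply qcomm_of_conj
  rw [pair_symm H hrs, pair_eq_zpow H hrs, ← zpow_neg]
  simpa [mk_F, mk_k, mk_kInv] using mk_rel (DJRel.k_F (X := X) (q := r) j i)

/-- The generators of `U_q(𝔤)` satisfy the relations of a multiparameter quantum group. -/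
noncomputable def qg (H : Admissible X n r s) (hrs : r * s = 1) :
    QG (pair X n r s) (commScale X n r s) (fun i j : Fin n => cartanNat X n i j) (Uq X n r) where
  e := E
  f := F
  w := kUnit
  v i := (kUnit i)⁻¹
  w_w i j := kUnit_comm i j
  w_v i j := (kUnit_comm i j).inv_right
  v_v i j := (kUnit_comm i j).inv_inv
  w_e i j := k_E H hrs i j
  w_f i j := k_F H hrs i j
  v_e i j := ((k_E H hrs i j).units_inv (H.pair_ne _ _)).of_eq (by rw [pair_symm H hrs])
  v_f i j := ((k_F H hrs i j).units_inv (inv_ne_zero (H.pair_ne _ _))).of_eq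
    (by rw [inv_inv, pair_symm H hrs])
  e_f i := by
    have := mk_rel (DJRel.E_F (X := X) (q := r) i i)
    rw [commScale, pow_sym_of_mul_eq_one hrs]
    simpa [mk_E, mk_F, mk_k, mk_kInv] using this
  e_f_ne i j h := by
    have := mk_rel (DJRel.E_F (X := X) (q := r) i j)
    rw [if_neg h] at this
    simpa [mk_E, mk_F, sub_eq_zero] using this
  serre_e i j h := by
    by_cases hm : cartanNat X n i j = 0
    · have := mk_rel (DJRel.E_comm (X := X) (q := r) i j (by rw [cartan_eq_of_ne h, hm]; rfl))
      rw [hm, qad_one, pair_symm H hrs, pair_of_mul_eq_one H hrs h, hm, mul_zero, pow_zero, inv_one,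
        one_smul, sub_eq_zero]
      simpa [mk_E] using this
    · have := mk_rel (DJRel.E_serre (X := X) (q := r) i j h ((cartan_ne_zero_iff h).2 hm))
      rw [serre_of_mul_eq_one H hrs h hm, map_qad, pair_symm H hrs i j] at this
      simpa [mk_E] using this
  serre_f i j h := by
    by_cases hm : cartanNat X n i j = 0
    · have := mk_rel (DJRel.F_comm (X := X) (q := r) i j (by rw [cartan_eq_of_ne h, hm]; rfl))
      rw [hm, qad_one, pair_of_mul_eq_one H hrs h, hm, mul_zero, pow_zero, inv_one,
        one_smul, sub_eq_zero]
      simpa [mk_F] using this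
    · have := mk_rel (DJRel.F_serre (X := X) (q := r) i j h ((cartan_ne_zero_iff h).2 hm))
      rw [serre_of_mul_eq_one H hrs h hm, map_qad] at this
      simpa [mk_F] using this

variable {A : Type*} [Ring A] [Algebra K A]

/-- The images of the generators in an algebra with a quantum group structure. -/
def genMap (q : QG (pair X n r s) (commScale X n r s) (fun i j : Fin n => cartanNat X n i j) A) :
    DJGen n → A
  | .E i => q.e i
  | .F i => q.f i
  | .k i => q.w i
  | .kInv i => q.v i

theorem lift_rel (H : Admissible X n r s) (hrs : r * s = 1)
    (q : QG (pair X n r s) (commScale X n r s) (fun i j : Fin n => cartanNat X n i j) A)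
    (hq : ∀ i, q.w i * q.v i = 1) {x y : FreeAlgebra K (DJGen n)} (h : DJRel X n r x y) :
    FreeAlgebra.lift K (genMap q) x = FreeAlgebra.lift K (genMap q) y := by
  have hv : ∀ i, q.v i = (q.w i)⁻¹ := fun i => (inv_eq_of_mul_eq_one_right (hq i)).symm
  cases h with
  | k_comm i j =>
    have := q.w_w i j
    simpa [genMap, ← Units.val_mul] using congrArg Units.val this
  | k_inv i => simp [genMap, hv]
  | inv_k i => simp [genMap, hv]
  | k_E i j =>
    have := (q.w_e j i).conj
    rw [pair_symm H hrs, pair_eq_zpow H hrs] at this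
    simpa [genMap, hv] using this
  | k_F i j =>
    have := (q.w_f j i).conj
    rw [pair_symm H hrs, pair_eq_zpow H hrs, ← zpow_neg] at this
    simpa [genMap, hv] using this
  | E_F i j =>
    split_ifs with h
    · subst h
      have := q.e_f i
      rw [commScale, pow_sym_of_mul_eq_one hrs] at this
      simpa [genMap] using this
    · simpa [genMap, sub_eq_zero] using q.e_f_ne i j h
  | E_comm i j ha =>
    rcases eq_or_ne i j with rfl | h
    · rfl
    have hm : cartanNat X n i j = 0 := by
      by_contra h'; exact (cartan_ne_zero_iff h).2 h' ha
    have := q.serre_e i j h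
    simp only [hm, zero_add, qad_one, sub_eq_zero] at this
    rw [pair_symm H hrs, pair_of_mul_eq_one H hrs h, hm, mul_zero, pow_zero, inv_one,
      one_smul] at this
    simpa [genMap] using this
  | F_comm i j ha =>
    rcases eq_or_ne i j with rfl | h
    · rfl
    have hm : cartanNat X n i j = 0 := by
      by_contra h'; exact (cartan_ne_zero_iff h).2 h' ha
    have := q.serre_f i j h
    simp only [hm, zero_add, qad_one, sub_eq_zero] at this
    rw [pair_of_mul_eq_one H hrs h, hm, mul_zero, pow_zero, inv_one, one_smul] at this
    simpa [genMap] using this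
  | E_serre i j h ha =>
    rw [serre_of_mul_eq_one H hrs h ((cartan_ne_zero_iff h).1 ha), map_qad, pair_symm H hrs i j]
    simpa [genMap] using q.serre_e i j h
  | F_serre i j h ha =>
    rw [serre_of_mul_eq_one H hrs h ((cartan_ne_zero_iff h).1 ha), map_qad]
    simpa [genMap] using q.serre_f i j h

/-- The universal property of `U_q(𝔤)`. -/
noncomputable def lift (H : Admissible X n r s) (hrs : r * s = 1)
    (q : QG (pair X n r s) (commScale X n r s) (fun i j : Fin n => cartanNat X n i j) A)
    (hq : ∀ i, q.w i * q.v i = 1) : Uq X n r →ₐ[K] A :=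
  RingQuot.liftAlgHom K ⟨FreeAlgebra.lift K (genMap q), fun _ _ h => lift_rel H hrs q hq h⟩

theorem lift_gen (H : Admissible X n r s) (hrs : r * s = 1)
    (q : QG (pair X n r s) (commScale X n r s) (fun i j : Fin n => cartanNat X n i j) A)
    (hq : ∀ i, q.w i * q.v i = 1) (g : DJGen n) : lift H hrs q hq (gen g) = genMap q g := by
  rw [lift, gen]
  exact (RingQuot.liftAlgHom_mkAlgHom_apply K _ _ _).trans (by simp)

section

variable (H : Admissible X n r s) (hrs : r * s = 1)
  (q : QG (pair X n r s) (commScale X n r s) (fun i j : Fin n => cartanNat X n i j) A)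
  (hq : ∀ i, q.w i * q.v i = 1) (i : Fin n)

@[simp] theorem lift_E : lift H hrs q hq (E i) = q.e i := lift_gen H hrs q hq _
@[simp] theorem lift_F : lift H hrs q hq (F i) = q.f i := lift_gen H hrs q hq _
@[simp] theorem lift_k : lift H hrs q hq (k i) = q.w i := lift_gen H hrs q hq _
@[simp] theorem lift_kInv : lift H hrs q hq (kInv i) = q.v i := lift_gen H hrs q hq _

end

theorem adjoin_gen : Algebra.adjoin K (Set.range (gen : DJGen n → Uq X n r)) = ⊤ := by
  rw [eq_top_iff]
  rintro x -
  obtain ⟨x, rfl⟩ : ∃ y, mk y = x := RingQuot.mkAlgHom_surjective K _ x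
  induction x using FreeAlgebra.induction with
  | grade0 c => rw [AlgHom.commutes]; exact Subalgebra.algebraMap_mem _ c
  | grade1 g => exact Algebra.subset_adjoin ⟨g, rfl⟩
  | mul a b ha hb => rw [map_mul]; exact Subalgebra.mul_mem _ ha hb
  | add a b ha hb => rw [map_add]; exact Subalgebra.add_mem _ ha hb

theorem algHom_ext {φ ψ : Uq X n r →ₐ[K] A} (h : ∀ g, φ (gen g) = ψ (gen g)) : φ = ψ :=
  AlgHom.ext_of_adjoin_eq_top adjoin_gen (by rintro _ ⟨g, rfl⟩; exact h g)

/-- The canonical projection of `U_{r,s}(𝔤)`. -/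
noncomputable def proj (H : Admissible X n r s) (hrs : r * s = 1) : U X n r s →ₐ[K] Uq X n r :=
  U.lift H (qg H hrs)

theorem proj_isProjection (H : Admissible X n r s) (hrs : r * s = 1) :
    IsProjection (proj H hrs) where
  surjective := by
    rw [← AlgHom.range_eq_top, eq_top_iff, ← adjoin_gen, Algebra.adjoin_le_iff]
    rintro _ ⟨g, rfl⟩
    cases g with
    | E i => exact ⟨e i, U.lift_e H _ i⟩
    | F i => exact ⟨f i, U.lift_f H _ i⟩
    | k i => exact ⟨w i, U.lift_w H _ i⟩
    | kInv i => exact ⟨w' i, U.lift_w' H _ i⟩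
  map_e i := U.lift_e H _ i
  map_f i := U.lift_f H _ i
  map_w i := U.lift_w H _ i
  map_w' i := U.lift_w' H _ i

end Uq

end OneParameter

end TwoParam

/-! ### Reflections and rescalings of `U_q(𝔤)`. -/

namespace TwoParam

section UnitProduct

variable {K ι : Type*} [Field K] {p : ι → ι → K} {lam : ι → K} {m : ι → ι → ℕ}
  {A : Type*} [Ring A] [Algebra K A] [DecidableEq ι]

/-- The relation `ω_i ω_i' = 1`, which distinguishes `U_q`, survives reflection. The homomorphism
`φ` lets this be used in `U_q` itself and also for units of `U_{q,q⁻¹}` whose product becomes 1 only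
after projection. -/
theorem PreQG.map_reflW_mul {G : Type*} [Group G] (q : PreQG p lam A) (φ : Aˣ →* G)
    (h : ∀ i, φ (q.w i) * φ (q.v i) = 1) (i j : ι) :
    φ (q.reflW m i j) * φ (q.dual.reflW m i j) = 1 := by
  have hv : ∀ i, φ (q.v i) = (φ (q.w i))⁻¹ := fun i => (inv_eq_of_mul_eq_one_right (h i)).symm
  rcases eq_or_ne i j with rfl | hij
  · rw [reflW_self, reflW_self, map_inv]
    change _ * φ (q.v i)⁻¹ = 1
    rw [map_inv, hv]
    group
  · rw [reflW_of_ne _ hij, reflW_of_ne _ hij]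
    change _ * φ (q.v j * q.v i ^ m i j) = 1
    have hc : Commute (φ (q.w i) ^ m i j) (φ (q.w j)) := ((q.commute_w_w i j).map φ).pow_left _
    rw [map_mul, map_mul, map_pow, map_pow, hv, hv, mul_assoc, ← mul_assoc (_ ^ _),
      hc.inv_right.eq, inv_pow, mul_assoc, mul_inv_cancel, mul_one, mul_inv_cancel]

end UnitProduct

section OneParameterReflection

variable {K : Type*} [Field K] {X : ClassicalType} {n : ℕ} {r s : K}

theorem pair_transpose (H : Admissible X n r s) (hrs : r * s = 1) :
    (fun i j => pair X n r s j i) = pair X n r s := by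
  funext i j
  exact pair_symm H hrs j i

namespace Uq

/-- The reflection of `U_q(𝔤)`. -/
noncomputable def reflQG (H : Admissible X n r s) (hrs : r * s = 1) {i : Fin n}
    (h : ReflData (pair X n r s) (fun i j : Fin n => cartanNat X n i j) i) :
    QG (pair X n r s) (commScale X n r s) (fun i j : Fin n => cartanNat X n i j) (Uq X n r) :=
  ((qg H hrs).refl h (lusztigScale_self i) (fun _ hij => lusztigScale_mul H hij)).cast
    (pair_transpose H hrs)

/-- The reflection of `U_q(𝔤)`, as an endomorphism. -/
noncomputable def reflHom (H : Admissible X n r s) (hrs : r * s = 1) {i : Fin n}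
    (h : ReflData (pair X n r s) (fun i j : Fin n => cartanNat X n i j) i) :
    Uq X n r →ₐ[K] Uq X n r :=
  lift H hrs (reflQG H hrs h) (fun j => by
    rw [reflQG, QG.cast_w, QG.cast_v]
    exact (qg H hrs).map_reflW_mul (MonoidHom.id _) (fun i => mul_inv_cancel _) i j)

section

variable (H : Admissible X n r s) (hrs : r * s = 1) {i : Fin n}
    (h : ReflData (pair X n r s) (fun i j : Fin n => cartanNat X n i j) i) (j : Fin n)

theorem reflHom_E : reflHom H hrs h (E j) = (qg H hrs).toPreQG.reflE
    (fun i j : Fin n => cartanNat X n i j) i (lusztigScaleE X n r s i) j := by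
  rw [reflHom, lift_E, reflQG, QG.cast_e]
  rfl

theorem reflHom_F : reflHom H hrs h (F j) = (qg H hrs).toPreQG.dual.reflE
    (fun i j : Fin n => cartanNat X n i j) i (lusztigScaleF X n r s i) j := by
  rw [reflHom, lift_F, reflQG, QG.cast_f]
  rfl

theorem reflHom_k : reflHom H hrs h (k j) = ((qg H hrs).toPreQG.reflW
    (fun i j : Fin n => cartanNat X n i j) i j : Uq X n r) := by
  rw [reflHom, lift_k, reflQG, QG.cast_w]
  rfl

theorem reflHom_kInv : reflHom H hrs h (kInv j) = ((qg H hrs).toPreQG.dual.reflW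
    (fun i j : Fin n => cartanNat X n i j) i j : Uq X n r) := by
  rw [reflHom, lift_kInv, reflQG, QG.cast_v]
  rfl

end

section Projection

variable (H : Admissible X n r s) (hrs : r * s = 1)

theorem proj_e (i : Fin n) : proj H hrs (TwoParam.e i) = E i := U.lift_e H _ i
theorem proj_f (i : Fin n) : proj H hrs (TwoParam.f i) = F i := U.lift_f H _ i
theorem proj_w (i : Fin n) : proj H hrs (w i) = k i := U.lift_w H _ i
theorem proj_w' (i : Fin n) : proj H hrs (w' i) = kInv i := U.lift_w' H _ i
theorem proj_wInv (i : Fin n) : proj H hrs (wInv i) = kInv i := U.lift_wInv H _ i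

theorem proj_w'Inv (i : Fin n) : proj H hrs (w'Inv i) = k i := by
  rw [proj, U.lift_w'Inv]
  change ((((kUnit i)⁻¹)⁻¹ : (Uq X n r)ˣ) : Uq X n r) = k i
  rw [inv_inv]
  rfl

theorem proj_reflE (i j : Fin n) (c : Fin n → K) :
    proj H hrs ((U.qg H).toPreQG.reflE (fun i j : Fin n => cartanNat X n i j) i c j) =
      (qg H hrs).toPreQG.reflE (fun i j : Fin n => cartanNat X n i j) i c j := by
  rcases eq_or_ne i j with rfl | hij
  · rw [PreQG.reflE_self, PreQG.reflE_self, map_smul, map_mul]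
    change c i • (proj H hrs (w'Inv i) * proj H hrs (TwoParam.f i)) = _
    rw [proj_w'Inv, proj_f]
    change _ = c i • (((((kUnit i)⁻¹)⁻¹ : (Uq X n r)ˣ) : Uq X n r) * F i)
    rw [inv_inv]
    rfl
  · rw [PreQG.reflE_of_ne _ hij, PreQG.reflE_of_ne _ hij, map_smul, PreQG.es, map_qad]
    change c j • qad (proj H hrs (TwoParam.e i)) _ _ (proj H hrs (TwoParam.e j)) _ = _
    rw [proj_e, proj_e]
    rfl

theorem proj_reflF (i j : Fin n) (c : Fin n → K) :
    proj H hrs ((U.qg H).toPreQG.dual.reflE (fun i j : Fin n => cartanNat X n i j) i c j) =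
      (qg H hrs).toPreQG.dual.reflE (fun i j : Fin n => cartanNat X n i j) i c j := by
  rcases eq_or_ne i j with rfl | hij
  · rw [PreQG.reflE_self, PreQG.reflE_self, map_smul, map_mul]
    change c i • (proj H hrs (wInv i) * proj H hrs (TwoParam.e i)) = _
    rw [proj_wInv, proj_e]
    rfl
  · rw [PreQG.reflE_of_ne _ hij, PreQG.reflE_of_ne _ hij, map_smul, PreQG.es, map_qad]
    change c j • qad (proj H hrs (TwoParam.f i)) _ _ (proj H hrs (TwoParam.f j)) _ = _
    rw [proj_f, proj_f]
    rfl

theorem proj_reflW (i j : Fin n) :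
    proj H hrs ((U.qg H).toPreQG.reflW (fun i j : Fin n => cartanNat X n i j) i j : U X n r s) =
      ((qg H hrs).toPreQG.reflW (fun i j : Fin n => cartanNat X n i j) i j : Uq X n r) := by
  rcases eq_or_ne i j with rfl | hij
  · rw [PreQG.reflW_self, PreQG.reflW_self]
    exact proj_wInv H hrs i
  · rw [PreQG.reflW_of_ne _ hij, PreQG.reflW_of_ne _ hij]
    simp only [Units.val_mul, Units.val_pow_eq_pow_val, map_mul, map_pow]
    change proj H hrs (w j) * proj H hrs (w i) ^ _ = _
    rw [proj_w, proj_w]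
    rfl

theorem proj_reflV (i j : Fin n) :
    proj H hrs ((U.qg H).toPreQG.dual.reflW (fun i j : Fin n => cartanNat X n i j) i j :
      U X n r s) =
      ((qg H hrs).toPreQG.dual.reflW (fun i j : Fin n => cartanNat X n i j) i j : Uq X n r) := by
  rcases eq_or_ne i j with rfl | hij
  · rw [PreQG.reflW_self, PreQG.reflW_self]
    change proj H hrs (w'Inv i) = ((((kUnit i)⁻¹)⁻¹ : (Uq X n r)ˣ) : Uq X n r)
    rw [proj_w'Inv, inv_inv]
    rfl
  · rw [PreQG.reflW_of_ne _ hij, PreQG.reflW_of_ne _ hij]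
    simp only [Units.val_mul, Units.val_pow_eq_pow_val, map_mul, map_pow]
    change proj H hrs (w' j) * proj H hrs (w' i) ^ _ = _
    rw [proj_w', proj_w']
    rfl

end Projection

section Equivalence

variable (H : Admissible X n r s) (hrs : r * s = 1) {i : Fin n}
    (h : ReflData (pair X n r s) (fun i j : Fin n => cartanNat X n i j) i)
    {T : U X n r s ≃ₐ[K] U X n r s}

theorem reflHom_comp_proj
    (h2 : ∀ j, T (TwoParam.e j) = lusztigE i j) (h3 : ∀ j, T (TwoParam.f j) = lusztigF i j)
    (h4 : ∀ j, T (w j) = w j * wPow i (-cartan X n i j))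
    (h5 : ∀ j, T (w' j) = w' j * w'Pow i (-cartan X n i j)) :
    (reflHom H hrs h).comp (proj H hrs) = (proj H hrs).comp (T : U X n r s →ₐ[K] U X n r s) := by
  apply U.algHom_ext <;> intro j
  · change reflHom H hrs h (proj H hrs (TwoParam.e j)) = proj H hrs (T (TwoParam.e j))
    rw [h2, lusztigE_eq H, proj_reflE, proj_e, reflHom_E]
  · change reflHom H hrs h (proj H hrs (TwoParam.f j)) = proj H hrs (T (TwoParam.f j))
    rw [h3, lusztigF_eq H, map_smul, proj_reflF, proj_f, reflHom_F, ← mul_pow, hrs, one_pow,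
      one_smul]
  · change reflHom H hrs h (proj H hrs (w j)) = proj H hrs (T (w j))
    rw [h4, mul_wPow_eq H, proj_reflW, proj_w, reflHom_k]
  · change reflHom H hrs h (proj H hrs (w' j)) = proj H hrs (T (w' j))
    rw [h5, mul_w'Pow_eq H, proj_reflV, proj_w', reflHom_kInv]

/-- The inverse is induced by `T⁻¹`. On the torus `T` is an involution, so `T⁻¹` sends `ω_j` and
`ω_j'` to reflected units, whose product projects to 1; hence the projection of `T⁻¹` factors
through `U_q`. -/
theorem reflHom_bijective
    (h2 : ∀ j, T (TwoParam.e j) = lusztigE i j) (h3 : ∀ j, T (TwoParam.f j) = lusztigF i j)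
    (h4 : ∀ j, T (w j) = w j * wPow i (-cartan X n i j))
    (h5 : ∀ j, T (w' j) = w' j * w'Pow i (-cartan X n i j)) : Function.Bijective (reflHom H hrs h) := by
  have hcomp := reflHom_comp_proj H hrs h h2 h3 h4 h5
  have happ : ∀ x, reflHom H hrs h (proj H hrs x) = proj H hrs (T x) :=
    fun x => DFunLike.congr_fun hcomp x
  let q := U.qg H
  let Tu : (U X n r s)ˣ ≃* (U X n r s)ˣ := Units.mapEquiv (T : U X n r s ≃* U X n r s)
  have hTw : ∀ j, Tu (q.w j) = q.toPreQG.reflW (fun i j : Fin n => cartanNat X n i j) i j :=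
    fun j => Units.ext ((h4 j).trans (mul_wPow_eq H i j))
  have hTv : ∀ j, Tu (q.v j) = q.toPreQG.dual.reflW (fun i j : Fin n => cartanNat X n i j) i j :=
    fun j => Units.ext ((h5 j).trans (mul_w'Pow_eq H i j))
  have hw : ∀ j, Tu.symm (q.w j) = q.toPreQG.reflW (fun i j : Fin n => cartanNat X n i j) i j := by
    intro j
    rw [MulEquiv.symm_apply_eq]
    rcases eq_or_ne i j with rfl | hij
    · rw [PreQG.reflW_self, map_inv, hTw, PreQG.reflW_self, inv_inv]
    · rw [PreQG.reflW_of_ne _ hij, map_mul, map_pow, hTw, hTw, PreQG.reflW_self,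
        PreQG.reflW_of_ne _ hij, inv_pow, mul_inv_cancel_right]
  have hv : ∀ j, Tu.symm (q.v j) =
      q.toPreQG.dual.reflW (fun i j : Fin n => cartanNat X n i j) i j := by
    intro j
    rw [MulEquiv.symm_apply_eq]
    rcases eq_or_ne i j with rfl | hij
    · rw [PreQG.reflW_self, map_inv]
      change q.v i = (Tu (q.v i))⁻¹
      rw [hTv, PreQG.reflW_self, inv_inv]
      rfl
    · rw [PreQG.reflW_of_ne _ hij, map_mul, map_pow]
      change q.v j = Tu (q.v j) * Tu (q.v i) ^ _
      rw [hTv, hTv, PreQG.reflW_self,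
        PreQG.reflW_of_ne _ hij, inv_pow, mul_inv_cancel_right]
      rfl
  let ψ : U X n r s →ₐ[K] Uq X n r := (proj H hrs).comp (T.symm : U X n r s →ₐ[K] U X n r s)
  have hψ : ∀ j, (q.map ψ).w j * (q.map ψ).v j = 1 := by
    intro j
    have h1 := q.toPreQG.map_reflW_mul (m := fun i j : Fin n => cartanNat X n i j)
      (Units.map (proj H hrs : U X n r s →* Uq X n r)) (fun i => by
        have e1 : Units.map (proj H hrs : U X n r s →* Uq X n r) (q.w i) = kUnit i :=
          Units.ext (proj_w H hrs i)
        have e2 : Units.map (proj H hrs : U X n r s →* Uq X n r) (q.v i) = (kUnit i)⁻¹ :=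
          Units.ext (proj_w' H hrs i)
        rw [e1, e2, mul_inv_cancel]) i j
    rw [← hw, ← hv] at h1
    exact h1
  let N : Uq X n r →ₐ[K] Uq X n r := lift H hrs (q.map ψ) hψ
  have hN : N.comp (proj H hrs) = ψ := by
    apply U.algHom_ext <;> intro j <;> rw [AlgHom.comp_apply]
    · rw [proj_e]; exact lift_E H hrs (q.map ψ) hψ j
    · rw [proj_f]; exact lift_F H hrs (q.map ψ) hψ j
    · rw [proj_w]; exact lift_k H hrs (q.map ψ) hψ j
    · rw [proj_w']; exact lift_kInv H hrs (q.map ψ) hψ j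
  have hN' : ∀ x, N (proj H hrs x) = proj H hrs (T.symm x) := fun x => DFunLike.congr_fun hN x
  have hsurj := (proj_isProjection H hrs).surjective
  refine Function.bijective_iff_has_inverse.2 ⟨N, fun x => ?_, fun x => ?_⟩
  · obtain ⟨x, rfl⟩ := hsurj x
    rw [happ, hN', T.symm_apply_apply]
  · obtain ⟨x, rfl⟩ := hsurj x
    rw [hN', happ, T.apply_symm_apply]

end Equivalence

section Rescaling

/-- The rescaling endomorphisms of `U_q(𝔤)`. -/
noncomputable def scaleHom (H : Admissible X n r s) (hrs : r * s = 1) (c d : Fin n → K)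
    (h : ∀ i, c i * d i = 1) : Uq X n r →ₐ[K] Uq X n r :=
  lift H hrs ((qg H hrs).rescale c d (by simp [h])) (fun i => mul_inv_cancel (kUnit i))

theorem scaleHom_comp (H : Admissible X n r s) (hrs : r * s = 1) {c d : Fin n → K}
    (h : ∀ i, c i * d i = 1) (h' : ∀ i, d i * c i = 1) :
    (scaleHom H hrs c d h).comp (scaleHom H hrs d c h') = AlgHom.id K _ := by
  apply algHom_ext
  intro g
  cases g with
  | E i =>
    change scaleHom H hrs c d h (scaleHom H hrs d c h' (E i)) = E i
    simp [scaleHom, QG.rescale, qg, smul_smul, h']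
  | F i =>
    change scaleHom H hrs c d h (scaleHom H hrs d c h' (F i)) = F i
    simp [scaleHom, QG.rescale, qg, smul_smul, h]
  | k i =>
    change scaleHom H hrs c d h (scaleHom H hrs d c h' (k i)) = k i
    simp [scaleHom, QG.rescale, qg]
  | kInv i =>
    change scaleHom H hrs c d h (scaleHom H hrs d c h' (kInv i)) = kInv i
    simp [scaleHom, QG.rescale, qg]

/-- The rescaling automorphisms of `U_q(𝔤)`. -/
noncomputable def scaleEquiv (H : Admissible X n r s) (hrs : r * s = 1) (c : Fin n → K)
    (hc : ∀ i, c i ≠ 0) : Uq X n r ≃ₐ[K] Uq X n r :=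
  AlgEquiv.ofAlgHom
    (scaleHom H hrs c (fun i => (c i)⁻¹) (fun i => mul_inv_cancel₀ (hc i)))
    (scaleHom H hrs (fun i => (c i)⁻¹) c (fun i => inv_mul_cancel₀ (hc i)))
    (scaleHom_comp H hrs _ _) (scaleHom_comp H hrs _ _)

theorem scaleEquiv_isRescaling (H : Admissible X n r s) (hrs : r * s = 1) (c : Fin n → K)
    (hc : ∀ i, c i ≠ 0) : IsRescaling c (scaleEquiv H hrs c hc) where
  map_k j := lift_k H hrs _ _ j
  map_E j := lift_E H hrs _ _ j
  map_F j := lift_F H hrs _ _ j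

end Rescaling

section DividedPowers

variable {x y : Uq X n r}

theorem angleFact_inv (u : K) (M : ℕ) : angleFact u u⁻¹ M = qFact u M := by
  simp [angleFact, qFact, angleInt, qInt]

theorem sum_eq_qad {u : K} (hu : u ≠ 0) (hu' : u ≠ u⁻¹) {M : ℕ} (hM : M ≤ 2)
    (hu2 : M = 2 → u ^ 2 + 1 ≠ 0) :
    ∑ ν ∈ Finset.range (M + 1), ((-1) ^ ν * u ^ ν) • (divPow u x ν * y * divPow u x (M - ν)) =
      ((-u) ^ M * (qFact u M)⁻¹) • qad x (u ^ M)⁻¹ (u ^ 2) y M := by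
  simp only [divPow, ← angleFact_inv]
  obtain rfl | rfl | rfl : M = 0 ∨ M = 1 ∨ M = 2 := by omega
  · simp [angleFact_zero]
  · simp [Finset.sum_range_succ, angleFact_zero, angleFact_one hu', qad_succ,
      qstep, smul_sub, smul_smul, mul_inv_cancel₀ hu]
    abel
  · simp only [Finset.sum_range_succ, Finset.sum_range_zero, angleFact_zero,
      angleFact_one hu', angleFact_two hu', qad_succ, qstep, qad_zero, inv_inv]
    norm_num [angleFact_zero]
    simp only [mul_sub, sub_mul, mul_smul_comm, smul_mul_assoc, mul_assoc, pow_two]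
    have h1 : u ^ 2 + 1 ≠ 0 := hu2 rfl
    have h2 : 1 + u ^ 2 ≠ 0 := by rwa [add_comm]
    have h3 : u + u⁻¹ ≠ 0 := fun e => h1 (by field_simp at e; simpa using e)
    match_scalars <;> field_simp <;> ring

theorem sum_eq_qad' {u : K} (hu : u ≠ 0) (hu' : u ≠ u⁻¹) {M : ℕ} (hM : M ≤ 2)
    (hu2 : M = 2 → u ^ 2 + 1 ≠ 0) :
    ∑ ν ∈ Finset.range (M + 1), ((-1) ^ ν * u⁻¹ ^ ν) • (divPow u x (M - ν) * y * divPow u x ν) =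
      (qFact u M)⁻¹ • qad x (u ^ M)⁻¹ (u ^ 2) y M := by
  simp only [divPow, ← angleFact_inv]
  obtain rfl | rfl | rfl : M = 0 ∨ M = 1 ∨ M = 2 := by omega
  · simp [angleFact_zero]
  · simp [Finset.sum_range_succ, angleFact_zero, angleFact_one hu', qad_succ, qstep]
    abel
  · simp only [Finset.sum_range_succ, Finset.sum_range_zero, angleFact_zero,
      angleFact_one hu', angleFact_two hu', qad_succ, qstep, qad_zero, inv_inv]
    norm_num [angleFact_zero]
    simp only [mul_sub, sub_mul, mul_smul_comm, smul_mul_assoc, mul_assoc, pow_two]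
    have h1 : u ^ 2 + 1 ≠ 0 := hu2 rfl
    have h2 : 1 + u ^ 2 ≠ 0 := by rwa [add_comm]
    have h3 : u + u⁻¹ ≠ 0 := fun e => h1 (by field_simp at e; simpa using e)
    match_scalars <;> field_simp <;> ring

end DividedPowers

/-- This scalar is the whole discrepancy in type `B`: there the prescribed `T_i(e_j)` carries no
such leading factor, whereas the usual symmetry does, and for `f_j` it is the other way round. The
rescaling constant is its inverse. -/
theorem lusztigLead_eq (H : Admissible X n r s) (hrs : r * s = 1) {i j : Fin n} (h : i ≠ j) :
    lusztigLead X n r s i j = (-(r ^ sym X n i)) ^ cartanNat X n i j := by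
  have hr := H.r_ne
  have hs : s = r⁻¹ := eq_inv_of_mul_eq_one_right hrs
  have hp : lusztigPair X n r s i j = ((r ^ sym X n i) ^ cartanNat X n i j)⁻¹ := by
    rw [lusztigPair, pair_symm H hrs j i, ite_self, pair_of_mul_eq_one H hrs h, pow_mul]
  rw [lusztigLead, hp, inv_inv]
  by_cases hm : cartanNat X n i j = 0
  · simp [hm, halfCoeff]
  · rcases cartanNat_cases i j hm with hm | hm <;> rw [hm]
    · simp [halfCoeff]
    · rw [(sym_of_cartanNat_two i.2 j.2 hm).1, hs]
      norm_num [halfCoeff]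
      field_simp

theorem rescale_mul_lead (H : Admissible X n r s) (hrs : r * s = 1) {i j : Fin n} (h : i ≠ j)
    (hB : X.isB = true) : rescale X n r i j * lusztigLead X n r s i j = 1 := by
  rw [lusztigLead_eq H hrs h, rescale, if_pos ⟨hB, h.symm⟩, cartan_eq_of_ne h, zpow_neg,
    zpow_natCast, inv_mul_cancel₀ (pow_ne_zero _ (neg_ne_zero.2 (pow_ne_zero _ H.r_ne)))]

theorem rescale_ne_zero (H : Admissible X n r s) (i j : Fin n) : rescale X n r i j ≠ 0 := by
  rw [rescale]
  split_ifs
  · exact zpow_ne_zero _ (neg_ne_zero.2 (pow_ne_zero _ H.r_ne))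
  · exact one_ne_zero

theorem rescale_inv_mul_scaleE (H : Admissible X n r s) (hrs : r * s = 1) {i j : Fin n}
    (h : i ≠ j) : (rescale X n r i j)⁻¹ * lusztigScaleE X n r s i j =
      (-(r ^ sym X n i)) ^ cartanNat X n i j * (qFact (r ^ sym X n i) (cartanNat X n i j))⁻¹ := by
  rw [lusztigScaleE, if_neg h.symm, pow_sym_of_mul_eq_one hrs, angleFact_inv]
  cases hB : X.isB with
  | true =>
    rw [if_pos rfl, ← lusztigLead_eq H hrs h, one_mul,
      inv_eq_of_mul_eq_one_right (rescale_mul_lead H hrs h hB)]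
  | false =>
    have : rescale X n r i j = 1 := by simp [rescale, hB]
    rw [this, inv_one, one_mul, ← lusztigLead_eq H hrs h]
    simp

theorem rescale_mul_scaleF (H : Admissible X n r s) (hrs : r * s = 1) {i j : Fin n} (h : i ≠ j) :
    rescale X n r i j * lusztigScaleF X n r s i j =
      (qFact (r ^ sym X n i) (cartanNat X n i j))⁻¹ := by
  rw [lusztigScaleF, if_neg h.symm, pow_sym_of_mul_eq_one hrs (sym X n i), angleFact_inv,
    ← mul_pow, hrs, one_pow, one_pow, one_mul]
  cases hB : X.isB with
  | true =>
    rw [if_pos rfl, ← mul_assoc, rescale_mul_lead H hrs h hB, one_mul]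
  | false =>
    have : rescale X n r i j = 1 := by simp [rescale, hB]
    rw [this]
    simp

end Uq

end OneParameterReflection

end TwoParam

/-! ### Comparison with the usual Lusztig symmetries, and the theorem. -/

namespace TwoParam

section LusztigSymmetry

variable {K : Type*} [Field K] {X : ClassicalType} {n : ℕ} {r s : K}

namespace Uq

theorem mul_kPow_eq (H : Admissible X n r s) (hrs : r * s = 1) (i j : Fin n) :
    (k j * kPow i (-cartan X n i j) : Uq X n r) =
      ((qg H hrs).toPreQG.reflW (fun i j : Fin n => cartanNat X n i j) i j : Uq X n r) := by
  rcases eq_or_ne i j with rfl | hij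
  · rw [PreQG.reflW_self, cartan_self]
    change k i * kInv i ^ 2 = kInv i
    rw [pow_two, ← mul_assoc, ← coe_kUnit, ← coe_kUnit_inv, Units.mul_inv, one_mul]
  · rw [PreQG.reflW_of_ne _ hij, cartan_eq_of_ne hij, neg_neg, Units.val_mul,
      Units.val_pow_eq_pow_val]
    rfl

theorem pow_sym_ne_inv (H : Admissible X n r s) (hrs : r * s = 1) (i : Fin n) :
    r ^ sym X n i ≠ (r ^ sym X n i)⁻¹ := by
  rw [← pow_sym_of_mul_eq_one hrs]
  exact sub_ne_zero.1 (H.sub_ne i)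

theorem pow_sym_sq_add_one (H : Admissible X n r s) (hrs : r * s = 1) {i j : Fin n}
    (h : cartanNat X n i j = 2) : (r ^ sym X n i) ^ 2 + 1 ≠ 0 := by
  rw [(sym_of_cartanNat_two i.2 j.2 h).1, pow_one, ← hrs, pow_two, ← mul_add]
  exact mul_ne_zero H.r_ne H.add_ne

theorem pair_eq_inv_pow (H : Admissible X n r s) (hrs : r * s = 1) {i j : Fin n} (h : i ≠ j) :
    pair X n r s i j = ((r ^ sym X n i) ^ cartanNat X n i j)⁻¹ := by
  rw [pair_of_mul_eq_one H hrs h, pow_mul]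

theorem pair_self_eq_sq (H : Admissible X n r s) (hrs : r * s = 1) (i : Fin n) :
    pair X n r s i i = (r ^ sym X n i) ^ 2 := by
  rw [pair_self_of_mul_eq_one H hrs, mul_comm, pow_mul]

/-- The reflection of `U_q(𝔤)` after the inverse rescaling is the Lusztig symmetry. -/
theorem isLusztig_of_reflHom (H : Admissible X n r s) (hrs : r * s = 1) {i : Fin n}
    (h : ReflData (pair X n r s) (fun i j : Fin n => cartanNat X n i j) i)
    {D M : Uq X n r ≃ₐ[K] Uq X n r} (hD : IsRescaling (rescale X n r i) D)
    (hM : ∀ x, M x = reflHom H hrs h x) : IsLusztig i (D.symm.trans M) := by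
  have hk : ∀ j, D.symm (k j) = k j := fun j => by rw [AlgEquiv.symm_apply_eq, hD.map_k]
  have hE : ∀ j, D.symm (E j) = (rescale X n r i j)⁻¹ • E j := fun j => by
    rw [AlgEquiv.symm_apply_eq, map_smul, hD.map_E, inv_smul_smul₀ (rescale_ne_zero H i j)]
  have hF : ∀ j, D.symm (F j) = rescale X n r i j • F j := fun j => by
    rw [AlgEquiv.symm_apply_eq, map_smul, hD.map_F, smul_inv_smul₀ (rescale_ne_zero H i j)]
  have hself : rescale X n r i i = 1 := by simp [rescale]
  refine ⟨fun j => ?_, ?_, ?_, fun j hj => ?_, fun j hj => ?_⟩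
  · rw [AlgEquiv.trans_apply, hk, hM, reflHom_k, mul_kPow_eq H hrs]
  · rw [AlgEquiv.trans_apply, hE, hself, inv_one, one_smul, hM, reflHom_E, PreQG.reflE_self]
    change lusztigScaleE X n r s i i • (((((kUnit i)⁻¹)⁻¹ : (Uq X n r)ˣ) : Uq X n r) * F i) = _
    rw [inv_inv, coe_kUnit, lusztigScaleE, if_pos rfl, neg_smul, one_smul]
  · rw [AlgEquiv.trans_apply, hF, hself, one_smul, hM, reflHom_F, PreQG.reflE_self]
    change lusztigScaleF X n r s i i • (kInv i * E i) = _
    have h1 : QComm (pair X n r s i i)⁻¹ (kInv i : Uq X n r) (E i) :=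
      (k_E H hrs i i).units_inv (H.pair_ne _ _)
    unfold QComm at h1
    rw [h1, lusztigScaleF, if_pos rfl, smul_smul, neg_mul, mul_inv_cancel₀ (H.pair_ne _ _),
      neg_smul, one_smul]
  · rw [AlgEquiv.trans_apply, hE, map_smul, hM, reflHom_E, PreQG.reflE_of_ne _ hj.symm, smul_smul,
      rescale_inv_mul_scaleE H hrs hj.symm, cartan_eq_of_ne hj.symm, neg_neg, Int.toNat_natCast,
      sum_eq_qad (pow_ne_zero _ H.r_ne) (pow_sym_ne_inv H hrs i) (cartanNat_le_two _ _)
        (pow_sym_sq_add_one H hrs), ← pair_eq_inv_pow H hrs hj.symm, ← pair_self_eq_sq H hrs,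
      pair_symm H hrs i j]
    rfl
  · rw [AlgEquiv.trans_apply, hF, map_smul, hM, reflHom_F, PreQG.reflE_of_ne _ hj.symm, smul_smul,
      rescale_mul_scaleF H hrs hj.symm, cartan_eq_of_ne hj.symm, neg_neg, Int.toNat_natCast,
      sum_eq_qad' (pow_ne_zero _ H.r_ne) (pow_sym_ne_inv H hrs i) (cartanNat_le_two _ _)
        (pow_sym_sq_add_one H hrs), ← pair_eq_inv_pow H hrs hj.symm, ← pair_self_eq_sq H hrs]
    rfl

end Uq

theorem exists_lusztigSymmetry (H : Admissible X n r s) (Θ : U X n r s ≃ₐ[K] U X n s⁻¹ r⁻¹)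
    {σ : K ≃+* K} (hσ : IsSwap r s σ) {i : Fin n}
    (h : ReflData (pair X n r s) (fun i j : Fin n => cartanNat X n i j) i) :
    ∃ T : U X n r s →+* U X n s⁻¹ r⁻¹, IsLusztigSymmetry Θ σ i T ∧ Function.Bijective T := by
  obtain ⟨T, h1, h2, h3, h4, h5⟩ := U.exists_lusztig H hσ h
  exact ⟨_, isLusztigSymmetry_comp Θ h1 h2 h3 h4 h5, Θ.bijective.comp T.bijective⟩

theorem exists_lusztigSymmetry_proj (H : Admissible X n r s) (hrs : r * s = 1)
    (Θ : U X n r s ≃ₐ[K] U X n s⁻¹ r⁻¹) {i : Fin n}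
    (h : ReflData (pair X n r s) (fun i j : Fin n => cartanNat X n i j) i) :
    ∃ T : U X n r s →+* U X n s⁻¹ r⁻¹, IsLusztigSymmetry Θ (RingEquiv.refl K) i T ∧
      Function.Bijective T ∧
      ∃ L D : Uq X n r ≃ₐ[K] Uq X n r, Uq.IsLusztig i L ∧
        Uq.IsRescaling (Uq.rescale X n r i) D ∧
        ∀ x, Uq.proj H hrs (Θ.symm (T x)) = L (D (Uq.proj H hrs x)) := by
  -- For `rs = 1` the identity of `K` is an admissible `σ`, so the symmetry is linear.
  have hσ : IsSwap r s (RingEquiv.refl K) :=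
    ⟨eq_inv_of_mul_eq_one_left hrs, eq_inv_of_mul_eq_one_right hrs⟩
  obtain ⟨T, h1, h2, h3, h4, h5⟩ := U.exists_lusztig H hσ h
  let T' : U X n r s ≃ₐ[K] U X n r s := AlgEquiv.ofRingEquiv (f := T) h1
  let M := AlgEquiv.ofBijective (Uq.reflHom H hrs h)
    (Uq.reflHom_bijective H hrs h (T := T') h2 h3 h4 h5)
  have hD := Uq.scaleEquiv_isRescaling H hrs _ (Uq.rescale_ne_zero H i)
  refine ⟨_, isLusztigSymmetry_comp Θ h1 h2 h3 h4 h5, Θ.bijective.comp T.bijective, _, _,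
    Uq.isLusztig_of_reflHom H hrs h (M := M) hD (fun _ => rfl), hD, fun x => ?_⟩
  -- The symmetry `L` is the reflection of `U_q` preceded by the inverse of `D`, so `L ∘ D` is the
  -- reflection itself.
  change Uq.proj H hrs (Θ.symm (Θ (T x))) = Uq.reflHom H hrs h
    ((Uq.scaleEquiv H hrs _ (Uq.rescale_ne_zero H i)).symm (Uq.scaleEquiv H hrs _ _ _))
  rw [AlgEquiv.symm_apply_apply, AlgEquiv.symm_apply_apply]
  exact (DFunLike.congr_fun
    (Uq.reflHom_comp_proj H hrs h (T := T') h2 h3 h4 h5) x).symm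

end LusztigSymmetry

end TwoParam

open TwoParam in
theorem theorem3p1 {K : Type*} [Field K] [CharZero K] (r s : K) (hr : r ≠ 0) (hs : s ≠ 0)
    (hrs : r ^ 2 ≠ s ^ 2) :
    -- rank two: types A, B, C
    (∀ X : ClassicalType, X ≠ .D →
      ∃ Θ : U X 2 r s ≃ₐ[K] U X 2 s⁻¹ r⁻¹, IsAssocIdentification Θ ∧
        ∀ σ : K ≃+* K, IsSwap r s σ → ∀ i : Fin 2,
          ∃ T : U X 2 r s →+* U X 2 s⁻¹ r⁻¹, IsLusztigSymmetry Θ σ i T ∧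
            Function.Bijective T) ∧
    -- rank greater than two
    (∀ (X : ClassicalType) (n : ℕ), 2 < n →
      ∃ Θ : U X n r s ≃ₐ[K] U X n s⁻¹ r⁻¹, IsAssocIdentification Θ ∧
        ((X = .B ∨ X = .D ∧ n = 3 → r * s ≠ -1) →
          HasLusztigSymmetries Θ → r * s = 1) ∧
        ((X = .B ∨ X = .C → r ^ 3 ≠ s ^ 3 ∧ r ^ 4 ≠ s ^ 4) → r * s = 1 →
          HasLusztigSymmetries Θ ∧
          ∃ π : U X n r s →ₐ[K] Uq X n r, Uq.IsProjection π ∧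
            ∀ i : Fin n,
              ∃ T : U X n r s →+* U X n s⁻¹ r⁻¹, IsLusztigSymmetry Θ (RingEquiv.refl K) i T ∧
                Function.Bijective T ∧
              ∃ L D : Uq X n r ≃ₐ[K] Uq X n r, Uq.IsLusztig i L ∧
                Uq.IsRescaling (Uq.rescale X n r i) D ∧
                ∀ x, π (Θ.symm (T x)) = L (D (π x)))) := by
  refine ⟨fun X hX => ?_, fun X n hn => ?_⟩
  · have H : Admissible X 2 r s := ⟨hr, hs, hrs, le_rfl, fun h => absurd h hX⟩
    exact ⟨U.assoc H, U.assoc_isAssocIdentification H, fun σ hσ i =>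
      exists_lusztigSymmetry H _ hσ (reflData_rank_two H i)⟩
  · have H : Admissible X n r s := ⟨hr, hs, hrs, hn.le, fun _ => hn⟩
    refine ⟨U.assoc H, U.assoc_isAssocIdentification H,
      fun hX h => mul_eq_one_of_hasLusztigSymmetries H hn hX h, fun hBC h1 => ?_⟩
    have hT := fun i => exists_lusztigSymmetry_proj H h1 (U.assoc H)
      (reflData_of_mul_eq_one H h1 hBC i)
    refine ⟨⟨RingEquiv.refl K, ⟨eq_inv_of_mul_eq_one_left h1, eq_inv_of_mul_eq_one_right h1⟩,
      fun i => ?_⟩, Uq.proj H h1, Uq.proj_isProjection H h1, hT⟩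
    obtain ⟨T, h, -⟩ := hT i
    exact ⟨T, h⟩
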